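/- Let $T>0$, let $N\ge 2$ be an integer, and let $(\Omega,\mathcal F,(\mathcal F_t)_{0\le t\le T},\mathbb P)$ be a filtered probability space satisfying the usual conditions; write $\mathbb E_t=\mathbb E[\,\cdot\mid\mathcal F_t]$ and $\langle\cdot,\cdot\rangle$ for the inner product of $L^2=L^2([0,T],\mathbb R)$. A kernel $K:[0,T]^2\to\mathbb R$ in $L^2([0,T]^2)$ induces the operator $(\boldsymbol Kf)(s)=\int_0^TK(s,u)f(u)\,du$ on $L^2$; its adjoint $\boldsymbol K^*$ is induced by $K^*(s,u)=K(u,s)$. Put $K_t(s,r)=K(s,r)1_{\{r\ge t\}}$, with operator $\boldsymbol K_t$. Let $\mathcal G$ be the class of measurable kernels $G:[0,T]^2\to\mathbb R_+$ with $G(t,s)=0$ for $s\ge t$, with $\int_0^T\!\int_0^T(G(t,s)+G(s,t))f(s)f(t)\,ds\,dt\ge0$ for all $f\in L^2$, and with $\sup_t\int_0^TG(t,s)^2ds+\sup_s\int_0^TG(t,s)^2dt<\infty$. Let $\mathcal U$ be the set of progressively measurable processes $u$ with $\int_0^T\mathbb E[u_s^2]\,ds<\infty$. Let $A_1,\hat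 A_2,A_3\in\mathcal G$, $\lambda>0$, $\boldsymbol A_2=\lambda\,\mathrm{id}+\hat{\boldsymbol A}_2$, let $b^0,b^1,\dots,b^N\in\mathcal U$, and let $c^1,\dots,c^N$ be integrable random variables. In the $N$-player game, player $i$ chooses $u^i\in\mathcal U$ to maximise $$J^{i}(u^i;u^{-i})=\mathbb E\big[-\langle\bar u,\boldsymbol A_1\bar u\rangle-\langle u^i,\boldsymbol A_2u^i\rangle-\langle u^i,(\boldsymbol A_3+\boldsymbol A_3^*)\bar u\rangle+\langle b^i,u^i\rangle+\langle b^0,\bar u\rangle+c^i\big],\qquad \bar u=\frac1N\sum_{j=1}^Nu^j .$$ A profile $\hat u\in\mathcal U^N$ is a Nash equilibrium if $J^i(\hat u^i;\hat u^{-i})\ge J^i(v;\hat u^{-i})$ for all $i$ and all $v\in\mathcal U$. Define $$G=\frac{A_1}{N^2}+\frac{2A_3}{N}+\hat A_2,\quad H=\frac{A_1}{N}+A_3,\quad \overline K=\frac{N-1}{N}H+G,\quad \hat K=G-\frac1NH,\quad \bar b=\frac1N\sum_{i=1}^Nb^i,$$ $$\overline{\boldsymbol D}_t=2\lambda\,\mathrm{id}+\frac{N-1}{N}(\boldsymbol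 H_t+\boldsymbol H_t^*)+\boldsymbol G_t+\boldsymbol G_t^*,\qquad \widetilde{\boldsymbol D}_t=2\lambda\,\mathrm{id}-\frac1N(\boldsymbol H_t+\boldsymbol H_t^*)+\boldsymbol G_t+\boldsymbol G_t^* .$$ Theorem. The operators $\overline{\boldsymbol D}_t$ and $\widetilde{\boldsymbol D}_t$ are invertible on $L^2$ for every $t\in[0,T]$; the kernels $$\overline B(t,s)=1_{\{s<t\}}\frac1{2\lambda}\Big(\big\langle1_{\{t\le\cdot\}}\overline K(\cdot,t),\overline{\boldsymbol D}_t^{-1}1_{\{t\le\cdot\}}\overline K(\cdot,s)\big\rangle-\overline K(t,s)\Big),$$ $$B(t,s)=1_{\{s<t\}}\frac1{2\lambda}\Big(\big\langle1_{\{t\le\cdot\}}\hat K(\cdot,t),\widetilde{\boldsymbol D}_t^{-1}1_{\{t\le\cdot\}}\hat K(\cdot,s)\big\rangle-\hat K(t,s)\Big)$$ are in $L^2([0,T]^2)$, and $\mathrm{id}-\overline{\boldsymbol B}$ and $\mathrm{id}-\boldsymbol B$ are invertible. The game has a Nash equilibrium $\hat u=(\hat u^1,\dots,\hat u^N)$,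 unique up to $d\mathbb P\otimes dt$-null sets, and it is given by $$\hat u^i=(\mathrm{id}-\boldsymbol B)^{-1}a^i\ \text{ a.s.},\qquad i=1,\dots,N,$$ $$a^i_t=\frac1{2\lambda}\Big(\mathbb E_t[g^i_t]-\big\langle1_{\{t\le\cdot\}}\hat K(\cdot,t),\widetilde{\boldsymbol D}_t^{-1}1_{\{t\le\cdot\}}\mathbb E_t[g^i_\cdot]\big\rangle\Big),\qquad g^i=b^i+\frac1Nb^0-(\boldsymbol H+\boldsymbol H^*)\bar u^N,$$ where $\bar u^N=\frac1N\sum_{j=1}^N\hat u^j$ is itself given by $\bar u^N=(\mathrm{id}-\overline{\boldsymbol B})^{-1}\bar a$ a.s. with $$\bar a_t=\frac1{2\lambda}\Big(\bar b_t+\frac1Nb^0_t-\big\langle1_{\{t\le\cdot\}}\overline K(\cdot,t),\overline{\boldsymbol D}_t^{-1}1_{\{t\le\cdot\}}\mathbb E_t\big[\bar b_\cdot+\frac1Nb^0_\cdot\big]\big\rangle\Big).$$ Here $\bar a$ and the $a^i$ have versions in $\mathcal U$ (processes that satisfy these formulas almost surely, for almost every $t$), the conditional expectations of paths are those of $L^2$-valued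 random variables, and the inverses are applied path by path in $L^2$. -/

import Mathlib

open MeasureTheory

noncomputable section

namespace VolterraGame

/-! ### Function spaces, kernels and integral operators on `[0,T]` -/

/-- The time interval `[0,T]`. -/
abbrev Time (T : ℝ) : Type := Set.Icc (0 : ℝ) T

/-- Lebesgue measure on `[0,T]`. -/
instance instMeasureSpaceTime (T : ℝ) : MeasureSpace (Time T) := Measure.Subtype.measureSpace

instance instIsFiniteMeasureTime (T : ℝ) : IsFiniteMeasure (volume : Measure (Time T)) := by
  refine ⟨?_⟩
  have h : (volume : Measure (Time T)) Set.univ = volume (Set.Icc (0 : ℝ) T) :=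
    Measure.Subtype.volume_univ measurableSet_Icc.nullMeasurableSet
  rw [h]
  exact measure_Icc_lt_top

/-- The Hilbert space `L²([0,T], ℝ)`. -/
abbrev L2 (T : ℝ) : Type := Lp ℝ 2 (volume : Measure (Time T))

/-- A kernel `K : [0,T]² → ℝ`, written `K t s`. -/
abbrev Kernel (T : ℝ) : Type := Time T → Time T → ℝ

/-- A real-valued process `u : [0,T] × Ω → ℝ`, written `u t ω`. -/
abbrev Proc (T : ℝ) (Ω : Type*) : Type _ := Time T → Ω → ℝ

/-- The pairing `⟨f, g⟩ = ∫₀ᵀ f(s) g(s) ds` of two functions. -/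
def pairing {T : ℝ} (f g : Time T → ℝ) : ℝ := ∫ s, f s * g s

/-- The integral transform `(𝐊 f)(s) = ∫₀ᵀ K(s,u) f(u) du`, evaluated pointwise. -/
def kerApply {T : ℝ} (K : Kernel T) (f : Time T → ℝ) : Time T → ℝ :=
  fun s => ∫ u, K s u * f u

/-- The adjoint kernel `K*(s,u) = K(u,s)`. -/
def adjKernel {T : ℝ} (K : Kernel T) : Kernel T := fun s u => K u s

/-- Membership of a kernel in `L²([0,T]², ℝ)`. -/
def IsL2Kernel {T : ℝ} (K : Kernel T) : Prop :=
  MemLp (Function.uncurry K) 2 ((volume : Measure (Time T)).prod volume)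

/-- The class in `L²([0,T])` of a function (`0` if the function is not in `L²`). -/
def toL2 {T : ℝ} (f : Time T → ℝ) : L2 T :=
  open Classical in if h : MemLp f 2 volume then h.toLp f else 0

/-- The class in `L²([0,T])` of the function `s ↦ 1_{t ≤ s} f(s)`. -/
def tailL2 {T : ℝ} (t : Time T) (f : Time T → ℝ) : L2 T :=
  toL2 (fun s => if t ≤ s then f s else 0)

theorem eLpNorm_two_sq {α : Type*} [MeasurableSpace α] (μ : Measure α) (f : α → ℝ) :
    eLpNorm f 2 μ ^ 2 = ∫⁻ x, ‖f x‖ₑ ^ 2 ∂μ := by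
  have h := eLpNorm_nnreal_pow_eq_lintegral (f := f) (μ := μ) (p := 2) (by norm_num)
  simpa using h

theorem sq_lintegral_mul_le {α : Type*} [MeasurableSpace α] (μ : Measure α) {f g : α → ℝ}
    (hf : AEStronglyMeasurable f μ) (hg : AEStronglyMeasurable g μ) :
    (∫⁻ x, ‖f x‖ₑ * ‖g x‖ₑ ∂μ) ^ 2 ≤ (∫⁻ x, ‖f x‖ₑ ^ 2 ∂μ) * ∫⁻ x, ‖g x‖ₑ ^ 2 ∂μ := by
  have h := ENNReal.lintegral_mul_le_Lp_mul_Lq μ Real.HolderConjugate.two_two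
    hf.enorm hg.enorm
  calc (∫⁻ x, ‖f x‖ₑ * ‖g x‖ₑ ∂μ) ^ 2
      ≤ ((∫⁻ x, ‖f x‖ₑ ^ (2 : ℝ) ∂μ) ^ (1 / (2 : ℝ)) *
          (∫⁻ x, ‖g x‖ₑ ^ (2 : ℝ) ∂μ) ^ (1 / (2 : ℝ))) ^ 2 := by
        gcongr
        simpa using h
    _ = _ := by
        rw [mul_pow, ← ENNReal.rpow_natCast, ← ENNReal.rpow_natCast, ← ENNReal.rpow_mul,
          ← ENNReal.rpow_mul]
        norm_num

theorem kerApply_eLpNorm_le {T : ℝ} {K : Kernel T} (hK : IsL2Kernel K) {f : Time T → ℝ}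
    (hf : MemLp f 2 volume) :
    eLpNorm (kerApply K f) 2 volume
      ≤ eLpNorm (Function.uncurry K) 2 ((volume : Measure (Time T)).prod volume)
        * eLpNorm f 2 volume := by
  refine (ENNReal.pow_le_pow_left_iff (two_ne_zero)).1 ?_
  rw [mul_pow, eLpNorm_two_sq, eLpNorm_two_sq, eLpNorm_two_sq,
    lintegral_prod _ (hK.1.enorm.pow_const 2), ← lintegral_mul_const'']
  · refine lintegral_mono_ae ?_
    filter_upwards [hK.1.prodMk_left] with s hs
    refine le_trans ?_ (sq_lintegral_mul_le volume hs hf.1)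
    gcongr
    refine (enorm_integral_le_lintegral_enorm _).trans (le_of_eq ?_)
    simp [enorm_mul, Function.uncurry]
  · exact (hK.1.enorm.pow_const 2).lintegral_prod_right'

theorem kerApply_memLp {T : ℝ} {K : Kernel T} (hK : IsL2Kernel K) {f : Time T → ℝ}
    (hf : MemLp f 2 volume) : MemLp (kerApply K f) 2 volume := by
  refine ⟨?_, (kerApply_eLpNorm_le hK hf).trans_lt (ENNReal.mul_lt_top hK.2 hf.2)⟩
  exact (hK.1.mul (hf.1.comp_snd)).integral_prod_right'

theorem kerApply_add_ae {T : ℝ} {K : Kernel T} (hK : IsL2Kernel K) {f g : Time T → ℝ}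
    (hf : MemLp f 2 volume) (hg : MemLp g 2 volume) :
    kerApply K (f + g) =ᵐ[volume] kerApply K f + kerApply K g := by
  have h2 : ∀ᵐ s : Time T, MemLp (K s) 2 volume := by
    have hfin : ∫⁻ s : Time T, ∫⁻ u : Time T, ‖K s u‖ₑ ^ 2 < ⊤ := by
      have := hK.2
      have h2 := ENNReal.pow_lt_top (n := 2) this
      rw [eLpNorm_two_sq, lintegral_prod _ (hK.1.enorm.pow_const 2)] at h2
      exact h2
    filter_upwards [hK.1.prodMk_left,
      ae_lt_top' (hK.1.enorm.pow_const 2).lintegral_prod_right' hfin.ne] with s h1 h3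
    refine ⟨h1, ?_⟩
    by_contra hcon
    have htop : eLpNorm (K s) 2 volume = ⊤ := not_lt_top_iff.1 hcon
    have h4 : eLpNorm (K s) 2 volume ^ 2 < ⊤ := by
      rw [eLpNorm_two_sq]
      exact h3
    simp [htop] at h4
  filter_upwards [h2] with s hs
  have e1 : Integrable (fun u => K s u * f u) volume := hs.integrable_mul hf
  have e2 : Integrable (fun u => K s u * g u) volume := hs.integrable_mul hg
  simp only [kerApply, Pi.add_apply, mul_add]
  exact integral_add e1 e2

theorem kerApply_congr {T : ℝ} (K : Kernel T) {f g : Time T → ℝ} (h : f =ᵐ[volume] g) :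
    kerApply K f = kerApply K g := by
  funext s
  refine integral_congr_ae ?_
  filter_upwards [h] with u hu
  rw [hu]

theorem kerApply_smul {T : ℝ} (K : Kernel T) (c : ℝ) (f : Time T → ℝ) :
    kerApply K (c • f) = c • kerApply K f := by
  funext s
  simp only [kerApply, Pi.smul_apply, smul_eq_mul, ← integral_const_mul]
  congr 1
  funext u
  ring

/-- The bounded operator on `L²([0,T])` induced by a kernel in `L²([0,T]²)`. -/
def intOpOfL2 {T : ℝ} (K : Kernel T) (hK : IsL2Kernel K) : L2 T →L[ℝ] L2 T :=
  LinearMap.mkContinuous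
    { toFun := fun f => (kerApply_memLp hK (Lp.memLp f)).toLp (kerApply K f)
      map_add' := by
        intro f g
        rw [← MemLp.toLp_add, MemLp.toLp_eq_toLp_iff, kerApply_congr K (Lp.coeFn_add f g)]
        exact kerApply_add_ae hK (Lp.memLp f) (Lp.memLp g)
      map_smul' := by
        intro c f
        rw [RingHom.id_apply, ← MemLp.toLp_const_smul, MemLp.toLp_eq_toLp_iff,
          kerApply_congr K (Lp.coeFn_smul c f), kerApply_smul] }
    (eLpNorm (Function.uncurry K) 2 ((volume : Measure (Time T)).prod volume)).toReal
    (by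
      intro f
      simp only [LinearMap.coe_mk, AddHom.coe_mk, Lp.norm_toLp]
      rw [Lp.norm_def, ← ENNReal.toReal_mul]
      exact ENNReal.toReal_mono (ENNReal.mul_lt_top hK.2 (Lp.memLp f).2).ne
        (kerApply_eLpNorm_le hK (Lp.memLp f)))

/-- The integral operator `𝐊` on `L²([0,T])` induced by the kernel `K` (set to `0` if `K` is not
in `L²([0,T]²)`). -/
def intOp {T : ℝ} (K : Kernel T) : L2 T →L[ℝ] L2 T :=
  open Classical in if hK : IsL2Kernel K then intOpOfL2 K hK else 0

theorem intOp_apply {T : ℝ} {K : Kernel T} (hK : IsL2Kernel K) (f : L2 T) :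
    intOp K f =ᵐ[volume] kerApply K f := by
  rw [intOp, dif_pos hK]
  exact MemLp.coeFn_toLp (kerApply_memLp hK (Lp.memLp f))

/-- The class `𝒢` of admissible kernels: measurable, nonnegative, Volterra (vanishing for
`s ≥ t`), nonnegative definite, with square integrable rows and columns, uniformly. -/
structure IsAdmissibleKernel {T : ℝ} (G : Kernel T) : Prop where
  measurable : Measurable (Function.uncurry G)
  nonneg : ∀ t s, 0 ≤ G t s
  volterra : ∀ t s, t ≤ s → G t s = 0
  nonneg_def : ∀ f : Time T → ℝ, MemLp f 2 volume →
    0 ≤ ∫ t, ∫ s, (G t s + G s t) * f s * f t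
  sup_lt_top : (⨆ t, ∫⁻ s, ‖G t s‖ₑ ^ 2) + (⨆ s, ∫⁻ t, ‖G t s‖ₑ ^ 2) < ⊤

/-! ### The game -/

/-- The set `𝒰` of progressively measurable processes `u` with `∫₀ᵀ E[u_s²] ds < ∞`. -/
def IsAdmissible {Ω : Type*} [mΩ : MeasurableSpace Ω] (P : Measure Ω) {T : ℝ}
    (𝓕 : Filtration (Time T) mΩ) (u : Proc T Ω) : Prop :=
  IsStronglyProgressive 𝓕 u ∧ ∫⁻ s, ∫⁻ ω, ‖u s ω‖ₑ ^ 2 ∂P < ⊤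

/-- Equality of two processes `dt ⊗ dP`-almost everywhere. -/
def ProcessEq {Ω : Type*} [MeasurableSpace Ω] (P : Measure Ω) {T : ℝ} (u v : Proc T Ω) : Prop :=
  ∀ᵐ p ∂((volume : Measure (Time T)).prod P), u p.1 p.2 = v p.1 p.2

/-- The average `(1/N) ∑ⱼ uʲ`. -/
def playerAverage {Ω : Type*} {T : ℝ} {N : ℕ} (u : Fin N → Proc T Ω) : Proc T Ω :=
  fun t ω => (1 / (N : ℝ)) * ∑ j, u j t ω

/-- The performance functional of player `i` at the strategy profile `u`:
`E[-⟨ū, A₁ū⟩ - ⟨uⁱ, A₂uⁱ⟩ - ⟨uⁱ, (A₃ + A₃*)ū⟩ + ⟨bⁱ, uⁱ⟩ + ⟨b⁰, ū⟩ + cⁱ]`,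
where `A₂ = λ id + Â₂`. -/
def performance {Ω : Type*} [MeasurableSpace Ω] (P : Measure Ω) {T : ℝ} {N : ℕ}
    (lam : ℝ) (A1 A2hat A3 : Kernel T) (b : Fin N → Proc T Ω) (b0 : Proc T Ω)
    (c : Fin N → Ω → ℝ) (i : Fin N) (u : Fin N → Proc T Ω) : ℝ :=
  ∫ ω,
    let ui : Time T → ℝ := fun t => u i t ω
    let ubar : Time T → ℝ := fun t => playerAverage u t ω
    (- pairing ubar (kerApply A1 ubar)
      - pairing ui (fun t => lam * ui t + kerApply A2hat ui t)
      - pairing ui (fun t => kerApply A3 ubar t + kerApply (adjKernel A3) ubar t)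
      + pairing (fun t => b i t ω) ui
      + pairing (fun t => b0 t ω) ubar
      + c i ω) ∂P

/-- Nash equilibrium for payoffs `J i u` (payoff of player `i` at profile `u`): all strategies
are admissible and no player gains by a unilateral admissible deviation. -/
def IsNash {Ω : Type*} [mΩ : MeasurableSpace Ω] (P : Measure Ω) {T : ℝ}
    (𝓕 : Filtration (Time T) mΩ) {N : ℕ} (J : Fin N → (Fin N → Proc T Ω) → ℝ)
    (u : Fin N → Proc T Ω) : Prop :=
  (∀ i, IsAdmissible P 𝓕 (u i)) ∧
    ∀ i, ∀ v : Proc T Ω, IsAdmissible P 𝓕 v → J i (Function.update u i v) ≤ J i u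

/-! ### The kernels and operators of the explicit solution -/

/-- `G = A₁/N² + 2A₃/N + Â₂`. -/
def kerG {T : ℝ} (N : ℕ) (A1 A2hat A3 : Kernel T) : Kernel T :=
  fun t s => A1 t s / (N : ℝ) ^ 2 + 2 * (A3 t s / (N : ℝ)) + A2hat t s

/-- `H = A₁/N + A₃`. -/
def kerH {T : ℝ} (N : ℕ) (A1 A3 : Kernel T) : Kernel T :=
  fun t s => A1 t s / (N : ℝ) + A3 t s

/-- `K̄ = ((N-1)/N) H + G`. -/
def kerBar {T : ℝ} (N : ℕ) (G H : Kernel T) : Kernel T :=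
  fun t s => (((N : ℝ) - 1) / (N : ℝ)) * H t s + G t s

/-- `K̂ = G - H/N`. -/
def kerHat {T : ℝ} (N : ℕ) (G H : Kernel T) : Kernel T :=
  fun t s => G t s - (1 / (N : ℝ)) * H t s

/-- The truncated kernel `K_t(s,r) = K(s,r) 1_{r ≥ t}`. -/
def truncKernel {T : ℝ} (K : Kernel T) (t : Time T) : Kernel T :=
  fun s r => if t ≤ r then K s r else 0

/-- The symmetrised truncated operator `𝐊_t + 𝐊_t*`. -/
def symTrunc {T : ℝ} (K : Kernel T) (t : Time T) : L2 T →L[ℝ] L2 T :=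
  intOp (truncKernel K t) + intOp (adjKernel (truncKernel K t))

/-- `D̄_t = 2λ id + ((N-1)/N)(H_t + H_t*) + G_t + G_t*`. -/
def opDBar {T : ℝ} (N : ℕ) (lam : ℝ) (G H : Kernel T) (t : Time T) : L2 T →L[ℝ] L2 T :=
  (2 * lam) • ContinuousLinearMap.id ℝ (L2 T)
    + (((N : ℝ) - 1) / (N : ℝ)) • symTrunc H t + symTrunc G t

/-- `D̃_t = 2λ id - (1/N)(H_t + H_t*) + G_t + G_t*`. -/
def opDTilde {T : ℝ} (N : ℕ) (lam : ℝ) (G H : Kernel T) (t : Time T) : L2 T →L[ℝ] L2 T :=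
  (2 * lam) • ContinuousLinearMap.id ℝ (L2 T)
    - (1 / (N : ℝ)) • symTrunc H t + symTrunc G t

/-- The Volterra kernel
`1_{s<t} (1/2λ) (⟨1_{t≤·} K(·,t), D_t⁻¹ 1_{t≤·} K(·,s)⟩ - K(t,s))`. -/
def kerB {T : ℝ} (lam : ℝ) (D : Time T → (L2 T →L[ℝ] L2 T)) (K : Kernel T) : Kernel T :=
  fun t s => if s < t then
    (1 / (2 * lam)) *
      (inner ℝ (tailL2 t (fun r => K r t)) (Ring.inverse (D t) (tailL2 t (fun r => K r s)))
        - K t s)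
    else 0

/-- `(1/2λ) (x_t - ⟨1_{t≤·} K(·,t), D_t⁻¹ 1_{t≤·} E_t[g]⟩)`. For fixed `t`, the random function
`1_{t≤·} E_t[g]` is the (Bochner) conditional expectation given `𝓕 t` of the
`L²([0,T])`-valued random variable `ω ↦ 1_{t≤·} g(ω)`; so the expression is defined up to a
`P`-null set for each `t`. -/
def coeffA {Ω : Type*} [mΩ : MeasurableSpace Ω] (P : Measure Ω) {T : ℝ}
    (𝓕 : Filtration (Time T) mΩ) (lam : ℝ) (D : Time T → (L2 T →L[ℝ] L2 T)) (K : Kernel T)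
    (x g : Proc T Ω) : Proc T Ω :=
  fun t ω => (1 / (2 * lam)) *
    (x t ω - inner ℝ (tailL2 t (fun r => K r t))
      (Ring.inverse (D t) ((P[fun ω' => tailL2 t (fun s => g s ω') | 𝓕 t]) ω)))

/-- `a` is a version of `a'`: for almost every `t`, `a_t = a'_t` almost surely. -/
def IsVersion {Ω : Type*} [MeasurableSpace Ω] (P : Measure Ω) {T : ℝ} (a a' : Proc T Ω) : Prop :=
  ∀ᵐ t : Time T, a t =ᵐ[P] a' t

/-- `u = (id - 𝐁)⁻¹ a`, path by path in `L²([0,T])`, almost surely. -/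
def IsResolventSolution {Ω : Type*} [MeasurableSpace Ω] (P : Measure Ω) {T : ℝ} (B : Kernel T)
    (a u : Proc T Ω) : Prop :=
  ∀ᵐ ω ∂P, toL2 (fun t => u t ω) = Ring.inverse (1 - intOp B) (toL2 (fun t => a t ω))

/-- The process `b̄ + b⁰/N`, with `b̄ = (1/N) ∑ᵢ bⁱ`. -/
def inputBar {Ω : Type*} {T : ℝ} {N : ℕ} (b : Fin N → Proc T Ω) (b0 : Proc T Ω) :
    Proc T Ω :=
  fun t ω => playerAverage b t ω + (1 / (N : ℝ)) * b0 t ω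

/-- The (not necessarily adapted) process `bⁱ + b⁰/N - (H + H*) ū`. -/
def inputHat {Ω : Type*} {T : ℝ} (N : ℕ) (H : Kernel T) (bi b0 ubar : Proc T Ω) :
    Proc T Ω :=
  fun t ω => bi t ω + (1 / (N : ℝ)) * b0 t ω
    - (kerApply H (fun s => ubar s ω) t + kerApply (adjKernel H) (fun s => ubar s ω) t)

end VolterraGame

end

open VolterraGame

open scoped ENNReal Topology

noncomputable section

namespace VolterraGame

/-! ### The space `L²([0,T])` -/

section LTwo

variable {T : ℝ}

/-! The problem is lifted to the Hilbert space E = L²(Ω; L²([0,T])). There the payoffs are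
quadratic, and strategies range over the closed subspace W of classes of progressive processes
(`progSubmodule`). In a player's own strategy the second order part is −⟨h, (λ + G)h⟩, which is
negative definite. So a profile is an equilibrium exactly when, for every i, (2λ + K̂ + K̂*)uⁱ − (bⁱ
+ b⁰/N − (H + H*)ū) is orthogonal to W (`quadPayoff_isMax_iff`, `isNash_iff`).

Since K̂ + H = K̄, averaging these conditions closes them on ū: (2λ + K̄ + K̄*)ū − (b̄ + b⁰/N) is
orthogonal to W. Both operators are coercive, because K̂ = A₃/N + Â₂ and K̄ = K̂ + H are nonnegative
definite. Lax–Milgram on W gives a unique ū, then a unique uⁱ for this frozen ū; by uniqueness the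
average of the uⁱ is ū (`exists_unique_average_fixed_point`).

For the explicit formula, let ρ = 2λu + Ku + K*u − g be orthogonal to W. Then E_t[1_{t≤·}ρ] = 0 for
every t (`condExp_tailProj_eq_zero`) and E_t[ρ_t] = 0 for almost every t
(`condExp_eq_zero_of_orthogonal`). As K is Volterra and the past of u is known at time t, the first
identity reads D_t m_t = E_t[1_{t≤·}g] − 1_{t≤·}K(1_{·<t}u) for the forecast m_t = E_t[1_{t≤·}u],
and D_t is coercive. The second reads 2λu_t + (Ku)_t + ⟨K(·,t), m_t⟩ = E_t[g_t]. Eliminating m_t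
leaves u = a + Bu (`isVersion_coeffA`). The Volterra kernel B has uniformly square integrable rows,
so id − B is invertible by an exponentially weighted norm (`isUnit_one_sub_intOp`). -/

instance instNullSingletonTime (T : ℝ) :
    NullSingletonClass (volume : Measure (Time T)) := by
  refine ⟨fun x => ?_⟩
  have h : (volume : Measure (Time T)) {x} = volume (Subtype.val '' ({x} : Set (Time T))) :=
    comap_subtype_coe_apply measurableSet_Icc volume _
  rw [h]
  simp

instance instSecondCountableL2 (T : ℝ) : SecondCountableTopology (L2 T) := by
  have : Fact ((2 : ℝ≥0∞) ≠ ⊤) := ⟨by norm_num⟩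
  infer_instance

theorem toL2_of_memLp {f : Time T → ℝ} (hf : MemLp f 2 volume) : toL2 f = hf.toLp f :=
  dif_pos hf

theorem toL2_coeFn {f : Time T → ℝ} (hf : MemLp f 2 volume) : toL2 f =ᵐ[volume] f := by
  rw [toL2_of_memLp hf]
  exact hf.coeFn_toLp

theorem toL2_congr {f g : Time T → ℝ} (h : f =ᵐ[volume] g) : toL2 f = toL2 g := by
  by_cases hf : MemLp f 2 volume
  · have hg := (memLp_congr_ae h).1 hf
    rw [toL2_of_memLp hf, toL2_of_memLp hg]
    exact (MemLp.toLp_eq_toLp_iff _ _).2 h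
  · have hg : ¬ MemLp g 2 volume := fun hg => hf ((memLp_congr_ae h).2 hg)
    simp [toL2, hf, hg]

theorem toL2_self (f : L2 T) : toL2 (f : Time T → ℝ) = f := by
  rw [toL2_of_memLp (Lp.memLp f), Lp.toLp_coeFn]

theorem toL2_eq_of_ae {f : Time T → ℝ} {x : L2 T} (h : f =ᵐ[volume] x) : toL2 f = x := by
  rw [toL2_congr h, toL2_self]

theorem inner_toL2 {f g : Time T → ℝ} (hf : MemLp f 2 volume) (hg : MemLp g 2 volume) :
    inner ℝ (toL2 f) (toL2 g) = pairing f g := by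
  rw [L2.inner_def]
  refine integral_congr_ae ?_
  filter_upwards [toL2_coeFn hf, toL2_coeFn hg] with s h1 h2
  simp [h1, h2, mul_comm]

theorem norm_toL2_sq {f : Time T → ℝ} (hf : MemLp f 2 volume) :
    ENNReal.ofReal (‖toL2 f‖ ^ 2) = ∫⁻ s, ‖f s‖ₑ ^ 2 := by
  rw [toL2_of_memLp hf, Lp.norm_toLp, ← eLpNorm_two_sq, ← ENNReal.toReal_pow,
    ENNReal.ofReal_toReal]
  exact ENNReal.pow_ne_top hf.2.ne

theorem memLp_two_iff_lintegral {α : Type*} [MeasurableSpace α] {μ : Measure α} {f : α → ℝ}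
    (hf : AEStronglyMeasurable f μ) : MemLp f 2 μ ↔ ∫⁻ x, ‖f x‖ₑ ^ 2 ∂μ < ⊤ := by
  rw [← eLpNorm_two_sq, MemLp]
  simp [hf, ENNReal.pow_lt_top_iff]

/-! ### Measurability of maps into `L²([0,T])` -/

/-- In a second countable space an open set is a countable union of balls, and distances to the
centres control the preimages of balls. -/
theorem measurable_of_measurable_edist {X E : Type*} [MeasurableSpace X] [PseudoEMetricSpace E]
    [SecondCountableTopology E] [MeasurableSpace E] [BorelSpace E] {g : X → E}
    (h : ∀ y, Measurable fun x => edist (g x) y) : Measurable g := by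
  refine measurable_of_isOpen fun U hU => ?_
  have hU' : ∀ x : U, ∃ r > 0, Metric.eball (x : E) r ⊆ U :=
    fun x => EMetric.isOpen_iff.1 hU x x.2
  choose r hr0 hr using hU'
  obtain ⟨S, hS, hSU⟩ := TopologicalSpace.isOpen_iUnion_countable
    (fun x : U => Metric.eball (x : E) (r x)) (fun x => Metric.isOpen_eball)
  have hEq : U = ⋃ x ∈ S, Metric.eball (x : E) (r x) := by
    rw [hSU]
    refine Set.Subset.antisymm (fun x hx => ?_) (Set.iUnion_subset hr)
    exact Set.mem_iUnion.2 ⟨⟨x, hx⟩, Metric.mem_eball_self (hr0 _)⟩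
  rw [hEq, Set.preimage_iUnion₂]
  refine MeasurableSet.biUnion hS fun x _ => ?_
  exact measurableSet_lt (h x) measurable_const

/-- The distance to a fixed `y` is the root of a parametric integral on the measurable set where the
section is square integrable. Off this set `toL2` takes its default value 0 and the distance is
constant. -/
theorem stronglyMeasurable_toL2 {X : Type*} [MeasurableSpace X] {f : X → Time T → ℝ}
    (hf : Measurable (Function.uncurry f)) : StronglyMeasurable fun x => toL2 (f x) := by
  borelize (L2 T)
  refine Measurable.stronglyMeasurable (measurable_of_measurable_edist fun y => ?_)
  have hsec : ∀ x, Measurable (f x) := fun x => hf.comp measurable_prodMk_left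
  have hset : MeasurableSet {x | ∫⁻ s, ‖f x s‖ₑ ^ 2 < ⊤} :=
    measurableSet_lt (Measurable.lintegral_prod_right' (f := fun p : X × Time T =>
      ‖f p.1 p.2‖ₑ ^ 2) (hf.enorm.pow_const 2)) measurable_const
  have hy : Measurable (y : Time T → ℝ) := (Lp.stronglyMeasurable y).measurable
  have hdist : Measurable fun x => (∫⁻ s, ‖f x s - y s‖ₑ ^ 2) ^ (1 / 2 : ℝ) :=
    (Measurable.lintegral_prod_right' (f := fun p : X × Time T =>
      ‖f p.1 p.2 - y p.2‖ₑ ^ 2)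
      ((hf.sub (hy.comp measurable_snd)).enorm.pow_const 2)).pow_const _
  classical
  have hEq : (fun x => edist (toL2 (f x)) y) = {x | ∫⁻ s, ‖f x s‖ₑ ^ 2 < ⊤}.piecewise
      (fun x => (∫⁻ s, ‖f x s - y s‖ₑ ^ 2) ^ (1 / 2 : ℝ)) (fun _ => edist 0 y) := by
    funext x
    by_cases hx : ∫⁻ s, ‖f x s‖ₑ ^ 2 < ⊤
    · rw [Set.piecewise_eq_of_mem _ _ _ (show x ∈ {x | ∫⁻ s, ‖f x s‖ₑ ^ 2 < ⊤} from hx)]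
      have hm := (memLp_two_iff_lintegral (hsec x).aestronglyMeasurable).2 hx
      rw [toL2_of_memLp hm, Lp.edist_def,
        eLpNorm_congr_ae (g := fun s => f x s - y s)
          (by filter_upwards [hm.coeFn_toLp] with s hs; simp [hs]),
        eLpNorm_eq_lintegral_rpow_enorm_toReal (by norm_num) (by norm_num)]
      simp
    · rw [Set.piecewise_eq_of_notMem _ _ _ (show x ∉ {x | ∫⁻ s, ‖f x s‖ₑ ^ 2 < ⊤} from hx)]
      have hm : ¬ MemLp (f x) 2 volume := fun h =>
        hx ((memLp_two_iff_lintegral (hsec x).aestronglyMeasurable).1 h)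
      simp [toL2, hm]
  rw [hEq]
  exact hdist.piecewise hset measurable_const

/-! ### Restriction to `[t,T]` -/

/-- Multiplication by `1_{t ≤ ·}` on `L²([0,T])`. -/
def tailProj (t : Time T) : L2 T →L[ℝ] L2 T :=
  LinearMap.mkContinuous
    { toFun := fun f => ((Lp.memLp f).indicator (measurableSet_Ici (a := t))).toLp
        ((Set.Ici t).indicator f)
      map_add' := by
        intro f g
        rw [← MemLp.toLp_add, MemLp.toLp_eq_toLp_iff]
        filter_upwards [Lp.coeFn_add f g] with s hs
        by_cases h : s ∈ Set.Ici t
        · simpa only [Pi.add_apply, Set.indicator_of_mem h] using hs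
        · simp [h]
      map_smul' := by
        intro c f
        rw [RingHom.id_apply, ← MemLp.toLp_const_smul, MemLp.toLp_eq_toLp_iff]
        filter_upwards [Lp.coeFn_smul c f] with s hs
        by_cases h : s ∈ Set.Ici t
        · simpa only [Pi.smul_apply, Set.indicator_of_mem h] using hs
        · simp [h] }
    1
    (by
      intro f
      simp only [LinearMap.coe_mk, AddHom.coe_mk, Lp.norm_toLp, one_mul]
      rw [Lp.norm_def]
      exact ENNReal.toReal_mono (Lp.memLp f).2.ne (eLpNorm_indicator_le _))

theorem tailProj_coeFn (t : Time T) (f : L2 T) :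
    tailProj t f =ᵐ[volume] fun s => if t ≤ s then f s else 0 := by
  have h : tailProj t f = ((Lp.memLp f).indicator (measurableSet_Ici (a := t))).toLp
        ((Set.Ici t).indicator f) := rfl
  rw [h]
  filter_upwards [((Lp.memLp f).indicator (measurableSet_Ici (a := t))).coeFn_toLp] with s hs
  rw [hs]
  simp [Set.indicator_apply]

theorem norm_tailProj_le (t : Time T) (f : L2 T) : ‖tailProj t f‖ ≤ ‖f‖ := by
  have h : ‖tailProj t‖ ≤ 1 := LinearMap.mkContinuous_norm_le _ zero_le_one _
  simpa using (tailProj t).le_of_opNorm_le h f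

theorem memLp_tail (t : Time T) {f : Time T → ℝ} (hf : MemLp f 2 volume) :
    MemLp (fun s => if t ≤ s then f s else 0) 2 volume := by
  have := hf.indicator (measurableSet_Ici (a := t))
  refine (memLp_congr_ae (ae_of_all _ fun s => ?_)).1 this
  simp [Set.indicator_apply]

theorem tailL2_eq (t : Time T) {f : Time T → ℝ} (hf : MemLp f 2 volume) :
    tailL2 t f = tailProj t (toL2 f) := by
  refine toL2_eq_of_ae ?_
  filter_upwards [tailProj_coeFn t (toL2 f), toL2_coeFn hf] with s h1 h2
  rw [h1, h2]

theorem tailProj_tailProj (t : Time T) (f : L2 T) : tailProj t (tailProj t f) = tailProj t f := by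
  refine Lp.ext ?_
  filter_upwards [tailProj_coeFn t (tailProj t f), tailProj_coeFn t f] with s h1 h2
  rw [h1, h2]
  split_ifs <;> rfl

theorem inner_tailProj_left (t : Time T) (f g : L2 T) :
    inner ℝ (tailProj t f) g = inner ℝ f (tailProj t g) := by
  rw [L2.inner_def, L2.inner_def]
  refine integral_congr_ae ?_
  filter_upwards [tailProj_coeFn t f, tailProj_coeFn t g] with s h1 h2
  rw [h1, h2]
  split_ifs <;> simp

/-- Dominated convergence: the two indicators agree in the limit at every point except `t`, which is
null. This strong continuity is all that the joint measurability of the solution kernels requires.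
-/
theorem continuous_tailProj (f : L2 T) : Continuous fun t => tailProj t f := by
  rw [continuous_iff_continuousAt]
  intro t
  rw [ContinuousAt, tendsto_iff_edist_tendsto_0]
  have hE : ∀ t', edist (tailProj t' f) (tailProj t f)
      = (∫⁻ s, ‖(if t' ≤ s then f s else 0) - (if t ≤ s then f s else 0)‖ₑ ^ 2) ^ (1 / 2 : ℝ) := by
    intro t'
    rw [Lp.edist_def, eLpNorm_congr_ae
      (g := fun s => (if t' ≤ s then f s else 0) - (if t ≤ s then f s else 0))
          (by filter_upwards [tailProj_coeFn t f, tailProj_coeFn t' f] with s h1 h2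
              rw [Pi.sub_apply, h1, h2]),
        eLpNorm_eq_lintegral_rpow_enorm_toReal (by norm_num) (by norm_num)]
    simp
  simp_rw [hE]
  have hm : ∀ t', Measurable fun s => (if t' ≤ s then f s else 0) := fun t' =>
    Measurable.ite measurableSet_Ici (Lp.stronglyMeasurable f).measurable measurable_const
  have h0 : Filter.Tendsto (fun t' => ∫⁻ s, ‖(if t' ≤ s then f s else 0)
      - (if t ≤ s then f s else 0)‖ₑ ^ 2) (𝓝 t) (𝓝 (∫⁻ _ : Time T, 0)) := by
    refine tendsto_lintegral_filter_of_dominated_convergence (fun s => ‖f s‖ₑ ^ 2)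
      (Filter.Eventually.of_forall fun t' => ((hm t').sub (hm t)).enorm.pow_const 2)
      (Filter.Eventually.of_forall fun t' => ae_of_all _ fun s => ?_) ?_ ?_
    · split_ifs <;> simp
    · exact ((memLp_two_iff_lintegral (Lp.memLp f).1).1 (Lp.memLp f)).ne
    · have hne : ∀ᵐ s : Time T, s ≠ t := by
        simp [ae_iff, measure_singleton]
      filter_upwards [hne] with s hs
      refine tendsto_const_nhds.congr' ?_
      rcases lt_or_gt_of_ne hs with h | h
      · filter_upwards [lt_mem_nhds h] with t' ht'
        simp [not_le.2 h, not_le.2 ht']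
      · filter_upwards [gt_mem_nhds h] with t' ht'
        simp [h.le, ht'.le]
  have := (ENNReal.continuous_rpow_const (y := (1 / 2 : ℝ))).continuousAt.tendsto.comp h0
  simpa [Function.comp_def] using this

end LTwo

/-! ### Integral operators -/

section Operators

variable {T : ℝ}

theorem IsL2Kernel.adj {K : Kernel T} (hK : IsL2Kernel K) : IsL2Kernel (adjKernel K) :=
  hK.comp_measurePreserving Measure.measurePreserving_swap

theorem IsL2Kernel.trunc {K : Kernel T} (hK : IsL2Kernel K) (t : Time T) :
    IsL2Kernel (truncKernel K t) := by
  have h := MemLp.indicator (s := {p : Time T × Time T | t ≤ p.2})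
    (measurableSet_le measurable_const measurable_snd) hK
  refine (memLp_congr_ae (ae_of_all _ fun p => ?_)).1 h
  simp [Set.indicator_apply, truncKernel, Function.uncurry]

theorem IsL2Kernel.const_mul {K : Kernel T} (hK : IsL2Kernel K) (a : ℝ) :
    IsL2Kernel fun t s => a * K t s :=
  MemLp.const_mul hK a

theorem IsL2Kernel.add {K K' : Kernel T} (hK : IsL2Kernel K) (hK' : IsL2Kernel K') :
    IsL2Kernel fun t s => K t s + K' t s :=
  MemLp.add hK hK'

theorem IsL2Kernel.integrable_mul {K : Kernel T} (hK : IsL2Kernel K) {f g : Time T → ℝ}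
    (hf : MemLp f 2 volume) (hg : MemLp g 2 volume) :
    Integrable (fun p : Time T × Time T => K p.1 p.2 * (f p.1 * g p.2))
      ((volume : Measure (Time T)).prod volume) := by
  have h : MemLp (fun p : Time T × Time T => f p.1 * g p.2) 2
      ((volume : Measure (Time T)).prod volume) := by
    refine (memLp_two_iff_integrable_sq (hf.1.comp_fst.mul hg.1.comp_snd)).2 ?_
    have := hf.integrable_sq.mul_prod hg.integrable_sq
    refine this.congr (ae_of_all _ fun p => ?_)
    simp [mul_pow]
  exact MemLp.integrable_mul hK h

theorem inner_intOp_eq {K : Kernel T} (hK : IsL2Kernel K) (f g : L2 T) :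
    inner ℝ f (intOp K g) = ∫ s, ∫ u, K s u * (f s * g u) := by
  rw [L2.inner_def]
  refine integral_congr_ae ?_
  filter_upwards [intOp_apply hK g] with s hs
  rw [hs, kerApply]
  simp only [RCLike.inner_apply, conj_trivial]
  rw [← integral_mul_const]
  congr 1
  funext u
  ring

theorem inner_intOp_adj {K : Kernel T} (hK : IsL2Kernel K) (f g : L2 T) :
    inner ℝ (intOp (adjKernel K) f) g = inner ℝ f (intOp K g) := by
  rw [real_inner_comm, inner_intOp_eq hK.adj, inner_intOp_eq hK, integral_integral_swap]
  · congr 1; funext s; congr 1; funext u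
    simp only [adjKernel]; ring
  · exact IsL2Kernel.integrable_mul hK.adj (Lp.memLp g) (Lp.memLp f)

theorem inner_intOp_adj_right {K : Kernel T} (hK : IsL2Kernel K) (f g : L2 T) :
    inner ℝ f (intOp (adjKernel K) g) = inner ℝ (intOp K f) g := by
  rw [real_inner_comm, inner_intOp_adj hK, real_inner_comm]

theorem kerApply_const_mul (K : Kernel T) (a : ℝ) (f : Time T → ℝ) (t : Time T) :
    kerApply (fun t s => a * K t s) f t = a * kerApply K f t := by
  simp only [kerApply, ← integral_const_mul, mul_assoc]

theorem intOp_const_mul {K : Kernel T} (hK : IsL2Kernel K) (a : ℝ) :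
    intOp (fun t s => a * K t s) = a • intOp K := by
  refine ContinuousLinearMap.ext fun f => Lp.ext ?_
  filter_upwards [intOp_apply (hK.const_mul a) f, intOp_apply hK f,
    Lp.coeFn_smul a (intOp K f)] with s h1 h2 h3
  rw [_root_.smul_apply, h3, h1, Pi.smul_apply, h2, kerApply_const_mul, smul_eq_mul]

theorem ext_inner_L2 {A B : L2 T →L[ℝ] L2 T} (h : ∀ f g, inner ℝ f (A g) = inner ℝ f (B g)) :
    A = B :=
  ContinuousLinearMap.ext fun g => ext_inner_left ℝ fun f => h f g

theorem intOp_add {K K' : Kernel T} (hK : IsL2Kernel K) (hK' : IsL2Kernel K') :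
    intOp (fun t s => K t s + K' t s) = intOp K + intOp K' := by
  refine ext_inner_L2 fun f g => ?_
  have h1 := IsL2Kernel.integrable_mul hK (Lp.memLp f) (Lp.memLp g)
  have h2 := IsL2Kernel.integrable_mul hK' (Lp.memLp f) (Lp.memLp g)
  rw [_root_.add_apply, inner_add_right, inner_intOp_eq hK, inner_intOp_eq hK',
    inner_intOp_eq (hK.add hK'), ← integral_prod _ h1, ← integral_prod _ h2, ← integral_add h1 h2,
    ← integral_prod (fun p : Time T × Time T => (K p.1 p.2 + K' p.1 p.2) * (f p.1 * g p.2))]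
  · congr 1; funext p; ring
  · exact IsL2Kernel.integrable_mul (hK.add hK') (Lp.memLp f) (Lp.memLp g)

theorem intOp_trunc {K : Kernel T} (hK : IsL2Kernel K) (t : Time T) :
    intOp (truncKernel K t) = intOp K ∘L tailProj t := by
  refine ContinuousLinearMap.ext fun f => Lp.ext ?_
  filter_upwards [intOp_apply (hK.trunc t) f, intOp_apply hK (tailProj t f)] with s h1 h2
  rw [h1, ContinuousLinearMap.comp_apply, h2, kerApply_congr K (tailProj_coeFn t f)]
  simp only [kerApply, truncKernel]
  congr 1; funext u
  split_ifs <;> simp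

theorem intOp_adj_trunc {K : Kernel T} (hK : IsL2Kernel K) (t : Time T) :
    intOp (adjKernel (truncKernel K t)) = tailProj t ∘L intOp (adjKernel K) := by
  refine ContinuousLinearMap.ext fun f => Lp.ext ?_
  filter_upwards [intOp_apply (hK.trunc t).adj f, intOp_apply hK.adj f,
    tailProj_coeFn t (intOp (adjKernel K) f)] with s h1 h2 h3
  rw [h1, ContinuousLinearMap.comp_apply, h3, h2]
  simp only [kerApply, truncKernel, adjKernel]
  split_ifs <;> simp

theorem symTrunc_eq {K : Kernel T} (hK : IsL2Kernel K) (t : Time T) :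
    symTrunc K t = intOp K ∘L tailProj t + tailProj t ∘L intOp (adjKernel K) := by
  rw [symTrunc, intOp_trunc hK, intOp_adj_trunc hK]

end Operators

/-! ### Nonnegative definite Volterra kernels -/

section Volterra

variable {T : ℝ}

/-- Measurable, nonnegative definite Volterra kernels (of any sign) whose rows and columns are
uniformly bounded in `L²([0,T])`. -/
structure IsVolterraKernel (K : Kernel T) : Prop where
  measurable : Measurable (Function.uncurry K)
  volterra : ∀ t s, t ≤ s → K t s = 0
  row_bound : ∃ C : ℝ≥0∞, C < ⊤ ∧ ∀ t, ∫⁻ s, ‖K t s‖ₑ ^ 2 ≤ C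
  col_bound : ∃ C : ℝ≥0∞, C < ⊤ ∧ ∀ s, ∫⁻ t, ‖K t s‖ₑ ^ 2 ≤ C
  inner_nonneg : ∀ f : L2 T, 0 ≤ inner ℝ f (intOp K f)

theorem isL2Kernel_of_row_bound {K : Kernel T} (hm : Measurable (Function.uncurry K))
    {C : ℝ≥0∞} (hC : C < ⊤) (h : ∀ t, ∫⁻ s, ‖K t s‖ₑ ^ 2 ≤ C) : IsL2Kernel K := by
  rw [IsL2Kernel, memLp_two_iff_lintegral hm.aestronglyMeasurable,
    lintegral_prod _ (hm.enorm.pow_const 2).aemeasurable]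
  refine (lintegral_mono h).trans_lt ?_
  rw [lintegral_const]
  exact ENNReal.mul_lt_top hC (measure_lt_top _ _)

theorem IsVolterraKernel.isL2Kernel {K : Kernel T} (hK : IsVolterraKernel K) : IsL2Kernel K :=
  let ⟨_, hC, h⟩ := hK.row_bound
  isL2Kernel_of_row_bound hK.measurable hC h

theorem IsVolterraKernel.memLp_row {K : Kernel T} (hK : IsVolterraKernel K) (t : Time T) :
    MemLp (K t) 2 volume :=
  let ⟨_, hC, h⟩ := hK.row_bound
  (memLp_two_iff_lintegral
    (hK.measurable.comp measurable_prodMk_left).aestronglyMeasurable).2 ((h t).trans_lt hC)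

theorem IsVolterraKernel.memLp_col {K : Kernel T} (hK : IsVolterraKernel K) (s : Time T) :
    MemLp (fun t => K t s) 2 volume :=
  let ⟨_, hC, h⟩ := hK.col_bound
  (memLp_two_iff_lintegral
    (hK.measurable.comp measurable_prodMk_right).aestronglyMeasurable).2 ((h s).trans_lt hC)

theorem IsVolterraKernel.norm_col_le {K : Kernel T} (hK : IsVolterraKernel K) :
    ∃ C : ℝ, ∀ s, ‖toL2 fun t => K t s‖ ≤ C := by
  obtain ⟨C, hC, h⟩ := hK.col_bound
  refine ⟨√C.toReal, fun s => Real.le_sqrt_of_sq_le ?_⟩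
  refine (ENNReal.ofReal_le_iff_le_toReal hC.ne).1 ?_
  rw [norm_toL2_sq (hK.memLp_col s)]
  exact h s

/-- The symmetrised form of the class is twice ⟨f, 𝐊f⟩, because an operator and its adjoint have the
same quadratic form. -/
theorem IsAdmissibleKernel.isVolterraKernel {K : Kernel T} (hK : IsAdmissibleKernel K) :
    IsVolterraKernel K := by
  have hrow : ∃ C : ℝ≥0∞, C < ⊤ ∧ ∀ t, ∫⁻ s, ‖K t s‖ₑ ^ 2 ≤ C :=
    ⟨_, (self_le_add_right _ _).trans_lt hK.sup_lt_top,
      fun t => le_iSup (fun t => ∫⁻ s, ‖K t s‖ₑ ^ 2) t⟩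
  obtain ⟨C, hC, h⟩ := hrow
  refine ⟨hK.measurable, hK.volterra, ⟨C, hC, h⟩,
    ⟨_, (self_le_add_left _ _).trans_lt hK.sup_lt_top,
      fun s => le_iSup (fun s => ∫⁻ t, ‖K t s‖ₑ ^ 2) s⟩, fun f => ?_⟩
  have hL := isL2Kernel_of_row_bound hK.measurable hC h
  have h0 := hK.nonneg_def f (Lp.memLp f)
  have h1 : ∫ t, ∫ s, (K t s + K s t) * f s * f t
      = inner ℝ f (intOp (fun t s => K t s + adjKernel K t s) f) := by
    rw [inner_intOp_eq (hL.add hL.adj)]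
    congr 1; funext s; congr 1; funext u
    simp only [adjKernel]; ring
  rw [h1, intOp_add hL hL.adj, _root_.add_apply, inner_add_right,
    inner_intOp_adj_right hL, real_inner_comm f (intOp K f)] at h0
  linarith

theorem IsVolterraKernel.const_mul {K : Kernel T} (hK : IsVolterraKernel K) {a : ℝ}
    (ha : 0 ≤ a) : IsVolterraKernel fun t s => a * K t s := by
  obtain ⟨C, hC, h⟩ := hK.row_bound
  obtain ⟨C', hC', h'⟩ := hK.col_bound
  have hfin : ‖a‖ₑ ^ 2 < ⊤ := ENNReal.pow_lt_top enorm_lt_top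
  refine ⟨hK.measurable.const_mul a, fun t s hts => by simp [hK.volterra t s hts],
    ⟨‖a‖ₑ ^ 2 * C, ENNReal.mul_lt_top hfin hC, fun t => ?_⟩,
    ⟨‖a‖ₑ ^ 2 * C', ENNReal.mul_lt_top hfin hC', fun s => ?_⟩, fun f => ?_⟩
  · simp only [enorm_mul, mul_pow]
    rw [lintegral_const_mul' _ _ hfin.ne]
    exact mul_le_mul_right (h t) _
  · simp only [enorm_mul, mul_pow]
    rw [lintegral_const_mul' _ _ hfin.ne]
    exact mul_le_mul_right (h' s) _
  · rw [intOp_const_mul hK.isL2Kernel, _root_.smul_apply, inner_smul_right]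
    exact mul_nonneg ha (hK.inner_nonneg f)

theorem lintegral_enorm_add_sq_le {α : Type*} [MeasurableSpace α] {μ : Measure α} {f g : α → ℝ}
    (hf : Measurable f) :
    ∫⁻ x, ‖f x + g x‖ₑ ^ 2 ∂μ ≤ 2 * ∫⁻ x, ‖f x‖ₑ ^ 2 ∂μ + 2 * ∫⁻ x, ‖g x‖ₑ ^ 2 ∂μ := by
  rw [← lintegral_const_mul' _ _ (by norm_num), ← lintegral_const_mul' _ _ (by norm_num),
    ← lintegral_add_left ((hf.enorm.pow_const 2).const_mul 2)]
  refine lintegral_mono fun x => ?_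
  have e : ∀ y : ℝ, ‖y‖ₑ ^ 2 = ENNReal.ofReal (y ^ 2) := fun y => by
    rw [Real.enorm_eq_ofReal_abs, ← ENNReal.ofReal_pow (abs_nonneg _), sq_abs]
  have e2 : (2 : ℝ≥0∞) = ENNReal.ofReal 2 := by simp
  rw [e, e, e, e2, ← ENNReal.ofReal_mul (by norm_num), ← ENNReal.ofReal_mul (by norm_num),
    ← ENNReal.ofReal_add (by positivity) (by positivity)]
  exact ENNReal.ofReal_le_ofReal (by nlinarith [sq_nonneg (f x - g x)])

theorem IsVolterraKernel.add {K K' : Kernel T} (hK : IsVolterraKernel K)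
    (hK' : IsVolterraKernel K') : IsVolterraKernel fun t s => K t s + K' t s := by
  obtain ⟨C, hC, h⟩ := hK.row_bound
  obtain ⟨C', hC', h'⟩ := hK.col_bound
  obtain ⟨D, hD, k⟩ := hK'.row_bound
  obtain ⟨D', hD', k'⟩ := hK'.col_bound
  have h2 : (2 : ℝ≥0∞) < ⊤ := by norm_num
  refine ⟨hK.measurable.add hK'.measurable, fun t s hts => by
    simp [hK.volterra t s hts, hK'.volterra t s hts],
    ⟨2 * C + 2 * D, ENNReal.add_lt_top.2 ⟨ENNReal.mul_lt_top h2 hC, ENNReal.mul_lt_top h2 hD⟩,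
      fun t => ?_⟩,
    ⟨2 * C' + 2 * D', ENNReal.add_lt_top.2 ⟨ENNReal.mul_lt_top h2 hC', ENNReal.mul_lt_top h2 hD'⟩,
      fun s => ?_⟩, fun f => ?_⟩
  · refine (lintegral_enorm_add_sq_le (hK.measurable.comp measurable_prodMk_left)).trans ?_
    exact add_le_add (mul_le_mul_right (h t) _) (mul_le_mul_right (k t) _)
  · refine (lintegral_enorm_add_sq_le (f := fun t => K t s)
      (hK.measurable.comp measurable_prodMk_right)).trans ?_
    exact add_le_add (mul_le_mul_right (h' s) _) (mul_le_mul_right (k' s) _)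
  · rw [intOp_add hK.isL2Kernel hK'.isL2Kernel, _root_.add_apply, inner_add_right]
    exact add_nonneg (hK.inner_nonneg f) (hK'.inner_nonneg f)

theorem IsVolterraKernel.kerApply_adj_eq_inner {K : Kernel T} (hK : IsVolterraKernel K)
    {f : Time T → ℝ} (hf : MemLp f 2 volume) (t : Time T) :
    kerApply (adjKernel K) f t = inner ℝ (toL2 fun s => K s t) (toL2 f) :=
  (inner_toL2 (hK.memLp_col t) hf).symm

/-- Causality: an input that vanishes before `t` produces an output that vanishes before `t`. -/
theorem IsVolterraKernel.tailProj_intOp_tailProj {K : Kernel T} (hK : IsVolterraKernel K)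
    (t : Time T) (f : L2 T) :
    tailProj t (intOp K (tailProj t f)) = intOp K (tailProj t f) := by
  refine Lp.ext ?_
  filter_upwards [tailProj_coeFn t (intOp K (tailProj t f)),
    intOp_apply hK.isL2Kernel (tailProj t f)] with s h1 h2
  rw [h1]
  split_ifs with h
  · rfl
  · rw [h2, kerApply_congr K (tailProj_coeFn t f), kerApply]
    symm
    refine integral_eq_zero_of_ae (ae_of_all _ fun u => ?_)
    by_cases hu : t ≤ u
    · simp [hK.volterra s u ((not_le.1 h).le.trans hu)]
    · simp [hu]

/-- The operator `2λ id + K_t + K_t*`. -/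
def truncOp (lam : ℝ) (K : Kernel T) (t : Time T) : L2 T →L[ℝ] L2 T :=
  (2 * lam) • ContinuousLinearMap.id ℝ (L2 T)
    + (intOp K ∘L tailProj t + tailProj t ∘L intOp (adjKernel K))

theorem truncOp_apply (lam : ℝ) (K : Kernel T) (t : Time T) (f : L2 T) :
    truncOp lam K t f
      = (2 * lam) • f + (intOp K (tailProj t f) + tailProj t (intOp (adjKernel K) f)) := rfl

theorem truncOp_symm {K : Kernel T} (hK : IsVolterraKernel K) (lam : ℝ) (t : Time T) (f g : L2 T) :
    inner ℝ (truncOp lam K t f) g = inner ℝ f (truncOp lam K t g) := by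
  simp only [truncOp_apply, inner_add_left, inner_add_right, inner_smul_left, inner_smul_right]
  rw [← inner_intOp_adj_right hK.isL2Kernel, inner_tailProj_left, inner_tailProj_left,
    inner_intOp_adj hK.isL2Kernel]
  simp only [conj_trivial]
  ring

/-- By causality and adjunction each of the two truncated terms contributes ⟨p, 𝐊p⟩ ≥ 0 with p =
`tailProj t f`, so only the multiple of the identity is left in the bound. -/
theorem IsVolterraKernel.truncOp_coercive {K : Kernel T} (hK : IsVolterraKernel K) (lam : ℝ)
    (t : Time T) (f : L2 T) : 2 * lam * ‖f‖ ^ 2 ≤ inner ℝ (truncOp lam K t f) f := by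
  simp only [truncOp_apply, inner_add_left, inner_smul_left]
  rw [inner_tailProj_left, inner_intOp_adj hK.isL2Kernel, real_inner_self_eq_norm_sq,
    real_inner_comm f, ← hK.tailProj_intOp_tailProj, ← inner_tailProj_left]
  have := hK.inner_nonneg (tailProj t f)
  simp only [conj_trivial]
  linarith

theorem IsVolterraKernel.isUnit_truncOp {K : Kernel T} (hK : IsVolterraKernel K) {lam : ℝ}
    (hlam : 0 < lam) (t : Time T) : IsUnit (truncOp lam K t) := by
  refine ContinuousLinearMap.isUnit_of_forall_le_norm_inner_map _ (c := ⟨2 * lam, by positivity⟩)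
    (show (0 : ℝ) < 2 * lam by positivity) fun f => ?_
  exact (mul_comm _ _).trans_le ((hK.truncOp_coercive lam t f).trans (le_abs_self _))

/-- The inverse of `2λ id + K_t + K_t*`. -/
def truncInv (lam : ℝ) (K : Kernel T) (t : Time T) : L2 T →L[ℝ] L2 T :=
  Ring.inverse (truncOp lam K t)

theorem IsVolterraKernel.truncInv_truncOp {K : Kernel T} (hK : IsVolterraKernel K) {lam : ℝ}
    (hlam : 0 < lam) (t : Time T) (f : L2 T) :
    truncInv lam K t (truncOp lam K t f) = f :=
  congrArg (fun A : L2 T →L[ℝ] L2 T => A f)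
    (Ring.inverse_mul_cancel _ (hK.isUnit_truncOp hlam t))

theorem IsVolterraKernel.truncOp_truncInv {K : Kernel T} (hK : IsVolterraKernel K) {lam : ℝ}
    (hlam : 0 < lam) (t : Time T) (f : L2 T) :
    truncOp lam K t (truncInv lam K t f) = f :=
  congrArg (fun A : L2 T →L[ℝ] L2 T => A f)
    (Ring.mul_inverse_cancel _ (hK.isUnit_truncOp hlam t))

theorem IsVolterraKernel.truncInv_symm {K : Kernel T} (hK : IsVolterraKernel K) {lam : ℝ}
    (hlam : 0 < lam) (t : Time T) (f g : L2 T) :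
    inner ℝ (truncInv lam K t f) g = inner ℝ f (truncInv lam K t g) := by
  conv_lhs => rw [← hK.truncOp_truncInv hlam t g]
  rw [← truncOp_symm hK, hK.truncOp_truncInv hlam]

theorem IsVolterraKernel.norm_truncInv_le {K : Kernel T} (hK : IsVolterraKernel K) {lam : ℝ}
    (hlam : 0 < lam) (t : Time T) (f : L2 T) :
    ‖truncInv lam K t f‖ ≤ (2 * lam)⁻¹ * ‖f‖ := by
  set g := truncInv lam K t f with hg
  have h1 := hK.truncOp_coercive lam t g
  rw [hg, hK.truncOp_truncInv hlam, ← hg] at h1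
  have h2 := real_inner_le_norm f g
  rcases (norm_nonneg g).eq_or_lt with h0 | h0
  · rw [← h0]; positivity
  · rw [le_inv_mul_iff₀ (by positivity)]
    refine le_of_mul_le_mul_right ?_ h0
    nlinarith

theorem continuous_truncOp_apply (lam : ℝ) (K : Kernel T) (f : L2 T) :
    Continuous fun t => truncOp lam K t f := by
  simp only [truncOp_apply]
  exact continuous_const.add (((intOp K).continuous.comp (continuous_tailProj f)).add
    (continuous_tailProj _))

/-- With y = D_{t₀}⁻¹x₀, the difference D_t⁻¹x − y equals D_t⁻¹(x − D_t y). The bound (2λ)⁻¹ on the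
inverses is uniform in t, so strong continuity of t ↦ D_t suffices. -/
theorem IsVolterraKernel.continuous_truncInv {K : Kernel T} (hK : IsVolterraKernel K) {lam : ℝ}
    (hlam : 0 < lam) : Continuous fun p : Time T × L2 T => truncInv lam K p.1 p.2 := by
  rw [continuous_iff_continuousAt]
  rintro ⟨t₀, x₀⟩
  rw [ContinuousAt, tendsto_iff_norm_sub_tendsto_zero]
  set y := truncInv lam K t₀ x₀ with hy
  have hb : ∀ p : Time T × L2 T,
      ‖truncInv lam K p.1 p.2 - y‖ ≤ (2 * lam)⁻¹ * ‖p.2 - truncOp lam K p.1 y‖ := by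
    intro p
    have h : truncInv lam K p.1 p.2 - y = truncInv lam K p.1 (p.2 - truncOp lam K p.1 y) := by
      rw [map_sub, hK.truncInv_truncOp hlam]
    rw [h]
    exact hK.norm_truncInv_le hlam _ _
  refine squeeze_zero (fun p => norm_nonneg _) hb ?_
  have hc : Continuous fun p : Time T × L2 T =>
      (2 * lam)⁻¹ * ‖p.2 - truncOp lam K p.1 y‖ :=
    continuous_const.mul
      (continuous_snd.sub ((continuous_truncOp_apply lam K y).comp continuous_fst)).norm
  have := hc.tendsto (t₀, x₀)
  rwa [hy, hK.truncOp_truncInv hlam, sub_self, norm_zero, mul_zero, ← hy] at this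

/-- Writing p for `tailProj t`, the adjoint of causality is p𝐊*p = p𝐊*. Hence the part of `f` before
`t` enters the projected equation through 𝐊 alone, and can be moved to the right-hand side as a
known term. -/
theorem IsVolterraKernel.truncOp_tailProj {K : Kernel T} (hK : IsVolterraKernel K) (lam : ℝ)
    (t : Time T) (f : L2 T) :
    truncOp lam K t (tailProj t f)
      = tailProj t ((2 * lam) • f + (intOp K f + intOp (adjKernel K) f))
        - tailProj t (intOp K (f - tailProj t f)) := by
  have h : tailProj t (intOp (adjKernel K) (tailProj t f)) = tailProj t (intOp (adjKernel K) f) := by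
    refine ext_inner_left ℝ fun g => ?_
    rw [← inner_tailProj_left, inner_intOp_adj_right hK.isL2Kernel, ← inner_tailProj_left,
      hK.tailProj_intOp_tailProj, ← inner_tailProj_left t g, inner_intOp_adj_right hK.isL2Kernel]
  rw [truncOp_apply, h, tailProj_tailProj]
  simp only [map_add, map_sub, map_smul]
  rw [hK.tailProj_intOp_tailProj]
  abel

end Volterra

/-! ### Invertibility of `id - 𝐁` for Volterra kernels -/

section Resolvent

variable {T : ℝ}

theorem lintegral_exp_neg_Ioi_le {γ : ℝ} (hγ : 0 < γ) (s : Time T) :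
    ∫⁻ t : Time T, (Set.Ioi s).indicator (fun t => ENNReal.ofReal (Real.exp (-γ * t))) t
      ≤ ENNReal.ofReal γ⁻¹ * ENNReal.ofReal (Real.exp (-γ * s)) := by
  have h1 : ∫⁻ t : Time T, (Set.Ioi s).indicator (fun t => ENNReal.ofReal (Real.exp (-γ * t))) t
      = ∫⁻ t in Set.Icc 0 T, (Set.Ioi (s : ℝ)).indicator
          (fun t => ENNReal.ofReal (Real.exp (-γ * t))) t := by
    rw [← lintegral_subtype_comap measurableSet_Icc]
    rfl
  rw [h1]
  refine (lintegral_mono' Measure.restrict_le_self le_rfl).trans ?_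
  rw [lintegral_indicator measurableSet_Ioi, ← ofReal_integral_eq_lintegral_ofReal
    (integrableOn_exp_mul_Ioi (by linarith) _) (ae_of_all _ fun t => (Real.exp_pos _).le),
    integral_exp_mul_Ioi (by linarith), ← ENNReal.ofReal_mul (by positivity)]
  refine ENNReal.ofReal_le_ofReal (le_of_eq ?_)
  field_simp

/-- Cauchy–Schwarz with the row bound leaves C∫_{s<t}|f(s)|² ds. Tonelli and the integral of
exp(−γt) over t > s then give the factor 1/γ. -/
theorem weighted_kerApply_le {B : Kernel T} (hm : Measurable (Function.uncurry B))
    (hV : ∀ t s, t ≤ s → B t s = 0) {C : ℝ≥0∞} (h : ∀ t, ∫⁻ s, ‖B t s‖ₑ ^ 2 ≤ C) {γ : ℝ}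
    (hγ : 0 < γ) {f : Time T → ℝ} (hf : Measurable f) :
    ∫⁻ t, ‖kerApply B f t‖ₑ ^ 2 * ENNReal.ofReal (Real.exp (-γ * t))
      ≤ C * ENNReal.ofReal γ⁻¹ * ∫⁻ s, ‖f s‖ₑ ^ 2 * ENNReal.ofReal (Real.exp (-γ * s)) := by
  have hpt : ∀ t, ‖kerApply B f t‖ₑ ^ 2
      ≤ C * ∫⁻ s, (Set.Iio t).indicator (fun s => ‖f s‖ₑ ^ 2) s := by
    intro t
    have hmt : Measurable (B t) := hm.comp measurable_prodMk_left
    have hmi : Measurable ((Set.Iio t).indicator f) := hf.indicator measurableSet_Iio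
    have h1 : ‖kerApply B f t‖ₑ ≤ ∫⁻ s, ‖B t s‖ₑ * ‖(Set.Iio t).indicator f s‖ₑ := by
      refine (enorm_integral_le_lintegral_enorm _).trans (lintegral_mono fun s => ?_)
      rw [enorm_mul]
      by_cases hs : s < t
      · rw [Set.indicator_of_mem (show s ∈ Set.Iio t from hs)]
      · simp [hV t s (not_lt.1 hs)]
    refine (pow_le_pow_left' h1 2).trans
      ((sq_lintegral_mul_le volume hmt.aestronglyMeasurable hmi.aestronglyMeasurable).trans ?_)
    refine mul_le_mul' (h t) (lintegral_mono fun s => ?_)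
    by_cases hs : s ∈ Set.Iio t <;> simp [hs]
  have hw : Measurable fun t : Time T => ENNReal.ofReal (Real.exp (-γ * t)) := by fun_prop
  calc ∫⁻ t, ‖kerApply B f t‖ₑ ^ 2 * ENNReal.ofReal (Real.exp (-γ * t))
      ≤ ∫⁻ t : Time T, C * ∫⁻ s, (Set.Ioi s).indicator
          (fun t : Time T => ENNReal.ofReal (Real.exp (-γ * t))) t * ‖f s‖ₑ ^ 2 := by
        refine lintegral_mono fun t => ?_
        refine (mul_le_mul_left (hpt t) _).trans ?_
        rw [mul_assoc]
        refine mul_le_mul_right ?_ _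
        rw [← lintegral_mul_const' _ _ ENNReal.ofReal_ne_top]
        refine lintegral_mono fun s => ?_
        by_cases hs : s < t
        · simp [hs, mul_comm]
        · simp [hs]
    _ = C * ∫⁻ s, ∫⁻ t : Time T, (Set.Ioi s).indicator
          (fun t : Time T => ENNReal.ofReal (Real.exp (-γ * t))) t * ‖f s‖ₑ ^ 2 := by
        have hmm : Measurable fun p : Time T × Time T => (Set.Ioi p.2).indicator
            (fun t : Time T => ENNReal.ofReal (Real.exp (-γ * t))) p.1 * ‖f p.2‖ₑ ^ 2 := by
          refine Measurable.mul ?_ ((hf.comp measurable_snd).enorm.pow_const 2)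
          have := (hw.comp measurable_fst).indicator (s := {p : Time T × Time T | p.2 < p.1})
            (measurableSet_lt measurable_snd measurable_fst)
          exact this
        rw [lintegral_const_mul _ hmm.lintegral_prod_right', lintegral_lintegral_swap
          hmm.aemeasurable]
    _ ≤ C * ∫⁻ s, ENNReal.ofReal γ⁻¹ * (‖f s‖ₑ ^ 2 * ENNReal.ofReal (Real.exp (-γ * s))) := by
        refine mul_le_mul_right (lintegral_mono fun s => ?_) _
        rw [lintegral_mul_const _ (hw.indicator measurableSet_Ioi)]
        refine (mul_le_mul_left (lintegral_exp_neg_Ioi_le hγ s) _).trans (le_of_eq ?_)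
        ring
    _ = _ := by
        rw [lintegral_const_mul' _ _ ENNReal.ofReal_ne_top, mul_assoc]

/-- The invertible element 1 − xⁿ is the product of 1 − x and a geometric sum, and these commute. -/
theorem isUnit_one_sub_of_norm_pow_lt_one {R : Type*} [NormedRing R] [HasSummableGeomSeries R]
    {x : R} {n : ℕ} (h : ‖x ^ n‖ < 1) : IsUnit (1 - x) := by
  have h1 : IsUnit (1 - x ^ n) := isUnit_one_sub_of_norm_lt_one h
  have hc : Commute (1 - x) (∑ i ∈ Finset.range n, x ^ i) :=
    Commute.sum_right _ _ _ fun i _ =>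
      (Commute.one_left _).sub_left ((Commute.refl x).pow_right i)
  rw [← mul_neg_geom_sum, hc.isUnit_mul_iff] at h1
  exact h1.1

/-- The weight exp(−γs) makes 𝐁 a contraction. The weighted norm is equivalent to the original one,
so a high power of 𝐁 has norm below 1. -/
theorem isUnit_one_sub_intOp {B : Kernel T} (hm : Measurable (Function.uncurry B))
    (hV : ∀ t s, t ≤ s → B t s = 0) {C : ℝ≥0∞} (hC : C < ⊤)
    (h : ∀ t, ∫⁻ s, ‖B t s‖ₑ ^ 2 ≤ C) : IsUnit (1 - intOp B) := by
  have hL := isL2Kernel_of_row_bound hm hC h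
  -- This choice makes C/γ at most 1/4; the added 1 keeps γ positive when C = 0.
  set γ : ℝ := 4 * (C.toReal + 1) with hγd
  have hC0 : 0 ≤ C.toReal := ENNReal.toReal_nonneg
  have hγ : 0 < γ := by positivity
  set q : L2 T → ℝ≥0∞ := fun f => ∫⁻ s, ‖f s‖ₑ ^ 2 * ENNReal.ofReal (Real.exp (-γ * s)) with hq
  have hstep : ∀ f, q (intOp B f) ≤ ENNReal.ofReal (1 / 4) * q f := by
    intro f
    have h1 : q (intOp B f)
        = ∫⁻ t, ‖kerApply B f t‖ₑ ^ 2 * ENNReal.ofReal (Real.exp (-γ * t)) := by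
      refine lintegral_congr_ae ?_
      filter_upwards [intOp_apply hL f] with s hs
      rw [hs]
    rw [h1]
    refine (weighted_kerApply_le hm hV h hγ (Lp.stronglyMeasurable f).measurable).trans ?_
    refine mul_le_mul_left ?_ _
    rw [← ENNReal.ofReal_toReal hC.ne, ← ENNReal.ofReal_mul hC0]
    refine ENNReal.ofReal_le_ofReal ?_
    rw [← div_eq_mul_inv, div_le_iff₀ hγ]
    linarith
  have hpow : ∀ n f, q ((intOp B ^ n) f) ≤ ENNReal.ofReal ((1 / 4) ^ n) * q f := by
    intro n
    induction n with
    | zero => intro f; simp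
    | succ n ih =>
      intro f
      rw [pow_succ', pow_succ', ENNReal.ofReal_mul (by norm_num), mul_assoc]
      exact (hstep _).trans (mul_le_mul_right (ih f) _)
  have hnorm : ∀ f : L2 T, ENNReal.ofReal (‖f‖ ^ 2) = ∫⁻ s, ‖f s‖ₑ ^ 2 := fun f => by
    conv_lhs => rw [← toL2_self f]
    exact norm_toL2_sq (Lp.memLp f)
  have hq1 : ∀ f, q f ≤ ENNReal.ofReal (‖f‖ ^ 2) := by
    intro f
    rw [hnorm]
    refine lintegral_mono fun s => ?_
    refine (mul_le_mul_right (b := ENNReal.ofReal _) (c := 1) ?_ _).trans (mul_one _).le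
    rw [← ENNReal.ofReal_one]
    refine ENNReal.ofReal_le_ofReal (Real.exp_le_one_iff.2 ?_)
    nlinarith [s.2.1]
  have hq2 : ∀ f, ENNReal.ofReal (‖f‖ ^ 2) ≤ ENNReal.ofReal (Real.exp (γ * T)) * q f := by
    intro f
    rw [hnorm, ← lintegral_const_mul' _ _ ENNReal.ofReal_ne_top]
    refine lintegral_mono fun s => ?_
    rw [mul_left_comm, ← ENNReal.ofReal_mul (Real.exp_pos _).le, ← Real.exp_add]
    refine (mul_one _).symm.le.trans (mul_le_mul_right ?_ _)
    rw [← ENNReal.ofReal_one]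
    refine ENNReal.ofReal_le_ofReal (Real.one_le_exp ?_)
    nlinarith [s.2.2]
  have hb : ∀ n (f : L2 T), ‖(intOp B ^ n) f‖ ≤ √(Real.exp (γ * T) * (1 / 4) ^ n) * ‖f‖ := by
    intro n f
    have h1 := (hq2 ((intOp B ^ n) f)).trans
      (mul_le_mul_right ((hpow n f).trans (mul_le_mul_right (hq1 f) _)) _)
    rw [← ENNReal.ofReal_mul (by positivity), ← ENNReal.ofReal_mul (by positivity),
      ENNReal.ofReal_le_ofReal_iff (by positivity), ← mul_assoc] at h1
    refine le_of_sq_le_sq ?_ (by positivity)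
    rwa [mul_pow, Real.sq_sqrt (by positivity)]
  -- The factor exp(γT) is the price of returning to the unweighted norm; `n` is taken so large that
  -- exp(γT)/4ⁿ < 1/4.
  obtain ⟨n, hn⟩ := exists_pow_lt_of_lt_one (show 0 < (Real.exp (γ * T))⁻¹ * (1 / 4) by positivity)
    (show (1 / 4 : ℝ) < 1 by norm_num)
  refine isUnit_one_sub_of_norm_pow_lt_one (n := n) ?_
  refine (ContinuousLinearMap.opNorm_le_bound _ (Real.sqrt_nonneg _) (hb n)).trans_lt ?_
  rw [Real.sqrt_lt' one_pos, one_pow]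
  have := mul_lt_mul_of_pos_left hn (Real.exp_pos (γ * T))
  rw [← mul_assoc, mul_inv_cancel₀ (Real.exp_pos _).ne'] at this
  linarith

end Resolvent

/-! ### The resolvent kernel of the explicit solution -/

section KerB

variable {T : ℝ}

theorem IsVolterraKernel.stronglyMeasurable_tail {K : Kernel T} (hK : IsVolterraKernel K) :
    StronglyMeasurable fun p : Time T × Time T => tailL2 p.1 (fun r => K r p.2) := by
  refine stronglyMeasurable_toL2 (f := fun (p : Time T × Time T) r =>
    if p.1 ≤ r then K r p.2 else 0) ?_
  refine Measurable.ite (measurableSet_le (measurable_fst.comp measurable_fst) measurable_snd)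
    ?_ measurable_const
  exact hK.measurable.comp (measurable_snd.prodMk (measurable_snd.comp measurable_fst))

theorem kerB_of_le (lam : ℝ) (D : Time T → L2 T →L[ℝ] L2 T) (K : Kernel T) {t s : Time T}
    (h : t ≤ s) : kerB lam D K t s = 0 := by
  simp [kerB, not_lt.2 h]

theorem stronglyMeasurable_comp_pair {X : Type*} [MeasurableSpace X] {t : X → Time T}
    {g : X → L2 T} (ht : Measurable t) (hg : StronglyMeasurable g) {F : Time T × L2 T → L2 T}
    (hF : Continuous F) : StronglyMeasurable fun x => F (t x, g x) :=
  hF.comp_stronglyMeasurable (ht.stronglyMeasurable.prodMk hg)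

theorem IsVolterraKernel.stronglyMeasurable_truncInv {K : Kernel T} (hK : IsVolterraKernel K)
    {lam : ℝ} (hlam : 0 < lam) {X : Type*} [MeasurableSpace X] {t : X → Time T} {g : X → L2 T}
    (ht : Measurable t) (hg : StronglyMeasurable g) :
    StronglyMeasurable fun x => truncInv lam K (t x) (g x) := by
  exact stronglyMeasurable_comp_pair ht hg (hK.continuous_truncInv hlam)

/-- The inverse D_t⁻¹ depends on `t`, so its measurability comes from the joint continuity of (t, x)
↦ D_t⁻¹x. -/
theorem IsVolterraKernel.measurable_kerB {K : Kernel T} (hK : IsVolterraKernel K) {lam : ℝ}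
    (hlam : 0 < lam) : Measurable (Function.uncurry (kerB lam (truncOp lam K) K)) := by
  have h1 : StronglyMeasurable fun p : Time T × Time T => tailL2 p.1 (fun r => K r p.1) :=
    hK.stronglyMeasurable_tail.comp_measurable (measurable_fst.prodMk measurable_fst)
  have h2 : StronglyMeasurable fun p : Time T × Time T =>
      truncInv lam K p.1 (tailL2 p.1 (fun r => K r p.2)) := by
    have h0 : Measurable fun p : Time T × Time T => p.1 := measurable_fst
    exact hK.stronglyMeasurable_truncInv hlam h0 hK.stronglyMeasurable_tail
  have h3 : Measurable fun p : Time T × Time T =>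
      (inner ℝ (tailL2 p.1 (fun r => K r p.1))
        (truncInv lam K p.1 (tailL2 p.1 (fun r => K r p.2))) : ℝ) :=
    (h1.inner h2).measurable
  have h5 : Function.uncurry (kerB lam (truncOp lam K) K) = fun p : Time T × Time T =>
      if p.2 < p.1 then (1 / (2 * lam)) * (inner ℝ (tailL2 p.1 (fun r => K r p.1))
        (truncInv lam K p.1 (tailL2 p.1 (fun r => K r p.2))) - K p.1 p.2) else 0 := by
    funext p
    rw [Function.uncurry, kerB, truncInv]
  rw [h5]
  exact Measurable.ite (measurableSet_lt measurable_snd measurable_fst)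
    ((h3.sub hK.measurable).const_mul (1 / (2 * lam))) measurable_const

/-- Columns of K are bounded in norm by some M and inverses by (2λ)⁻¹, so the inner product in the
kernel is at most M²/(2λ). The other term is a multiple of K, whose rows are bounded by assumption.
-/
theorem IsVolterraKernel.kerB_row_bound {K : Kernel T} (hK : IsVolterraKernel K) {lam : ℝ}
    (hlam : 0 < lam) :
    ∃ C : ℝ≥0∞, C < ⊤ ∧ ∀ t, ∫⁻ s, ‖kerB lam (truncOp lam K) K t s‖ₑ ^ 2 ≤ C := by
  obtain ⟨M, hM⟩ := hK.norm_col_le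
  obtain ⟨C, hC, h⟩ := hK.row_bound
  set c : ℝ := 1 / (2 * lam) with hc
  have hc0 : 0 ≤ c := by positivity
  set b : ℝ := c * (M * ((2 * lam)⁻¹ * M)) with hb
  have hpt : ∀ t s, ‖kerB lam (truncOp lam K) K t s‖ₑ ≤ ‖b + c * |K t s|‖ₑ := by
    intro t s
    have hM0 : 0 ≤ M := (norm_nonneg _).trans (hM t)
    have hb0 : 0 ≤ b := by positivity
    rw [enorm_le_iff_norm_le, Real.norm_eq_abs, Real.norm_eq_abs,
      abs_of_nonneg (a := b + c * |K t s|) (by positivity)]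
    by_cases hs : s < t
    · rw [kerB, if_pos hs, tailL2_eq t (hK.memLp_col t), tailL2_eq t (hK.memLp_col s),
        abs_mul, abs_of_nonneg hc0, hb, ← mul_add]
      refine mul_le_mul_of_nonneg_left ((abs_sub _ _).trans (add_le_add_left ?_ _)) hc0
      refine (abs_real_inner_le_norm _ _).trans ?_
      have h1 := (norm_tailProj_le t (toL2 fun r => K r t)).trans (hM t)
      have h2 := (norm_tailProj_le t (toL2 fun r => K r s)).trans (hM s)
      refine mul_le_mul h1 ((hK.norm_truncInv_le hlam t _).trans ?_) (norm_nonneg _) hM0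
      exact mul_le_mul_of_nonneg_left h2 (by positivity)
    · rw [kerB_of_le _ _ _ (not_lt.1 hs), abs_zero]
      positivity
  have h2 : (2 : ℝ≥0∞) < ⊤ := by norm_num
  have hfin : ∀ x : ℝ, ‖x‖ₑ ^ 2 < ⊤ := fun x => ENNReal.pow_lt_top enorm_lt_top
  refine ⟨2 * (‖b‖ₑ ^ 2 * (volume : Measure (Time T)) Set.univ) + 2 * (‖c‖ₑ ^ 2 * C),
    ENNReal.add_lt_top.2 ⟨ENNReal.mul_lt_top h2 (ENNReal.mul_lt_top (hfin b) (measure_lt_top _ _)),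
      ENNReal.mul_lt_top h2 (ENNReal.mul_lt_top (hfin c) hC)⟩, fun t => ?_⟩
  refine (lintegral_mono fun s => pow_le_pow_left' (hpt t s) 2).trans ?_
  refine (lintegral_enorm_add_sq_le measurable_const).trans ?_
  refine add_le_add (by rw [lintegral_const]) (mul_le_mul_right ?_ _)
  simp only [enorm_mul, mul_pow, Real.enorm_abs]
  rw [lintegral_const_mul' _ _ (hfin c).ne]
  exact mul_le_mul_right (h t) _

theorem IsVolterraKernel.isL2Kernel_kerB {K : Kernel T} (hK : IsVolterraKernel K) {lam : ℝ}
    (hlam : 0 < lam) : IsL2Kernel (kerB lam (truncOp lam K) K) :=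
  let ⟨_, hC, h⟩ := hK.kerB_row_bound hlam
  isL2Kernel_of_row_bound (hK.measurable_kerB hlam) hC h

theorem IsVolterraKernel.isUnit_one_sub_kerB {K : Kernel T} (hK : IsVolterraKernel K) {lam : ℝ}
    (hlam : 0 < lam) : IsUnit (1 - intOp (kerB lam (truncOp lam K) K)) :=
  let ⟨_, hC, h⟩ := hK.kerB_row_bound hlam
  isUnit_one_sub_intOp (hK.measurable_kerB hlam) (fun _ _ => kerB_of_le _ _ _) hC h

/-- Integrating the columns K(·,s) against f over s < t gives 𝐊 applied to the part of `f` before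
`t`, which is `toL2 f - tailProj t (toL2 f)`. -/
theorem IsVolterraKernel.kerApply_kerB {K : Kernel T} (hK : IsVolterraKernel K) {lam : ℝ}
    (hlam : 0 < lam) {f : Time T → ℝ} (hf : MemLp f 2 volume) (t : Time T) :
    kerApply (kerB lam (truncOp lam K) K) f t
      = (1 / (2 * lam)) * (inner ℝ (tailL2 t fun r => K r t)
          (truncInv lam K t (tailProj t (intOp K (toL2 f - tailProj t (toL2 f)))))
          - kerApply K f t) := by
  -- Symmetry of D_t⁻¹ moves it onto the fixed column at `t`. The inner product becomes the scalar
  -- function 𝐊*y of s, so no vector-valued integral of columns is needed.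
  set y := tailProj t (truncInv lam K t (tailL2 t fun r => K r t)) with hy
  have hpt : ∀ s, kerB lam (truncOp lam K) K t s * f s
      = (1 / (2 * lam)) * (kerApply (adjKernel K) y s * (f s - if t ≤ s then f s else 0)
          - K t s * f s) := by
    intro s
    by_cases hs : s < t
    · have h1 : inner ℝ (tailL2 t fun r => K r t)
          (Ring.inverse (truncOp lam K t) (tailL2 t fun r => K r s))
          = kerApply (adjKernel K) y s := by
        change inner ℝ _ (truncInv lam K t _) = _
        rw [← hK.truncInv_symm hlam, tailL2_eq t (hK.memLp_col s), ← inner_tailProj_left, ← hy,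
          hK.kerApply_adj_eq_inner (Lp.memLp y), toL2_self, real_inner_comm]
      rw [kerB, if_pos hs, h1, if_neg (not_le.2 hs)]
      ring
    · rw [kerB_of_le _ _ _ (not_lt.1 hs), if_pos (not_lt.1 hs), hK.volterra _ _ (not_lt.1 hs)]
      ring
  have hg : MemLp (fun s => f s - if t ≤ s then f s else 0) 2 volume := hf.sub (memLp_tail t hf)
  have hz : MemLp (kerApply (adjKernel K) y) 2 volume :=
    kerApply_memLp hK.isL2Kernel.adj (Lp.memLp y)
  have h2 : ∫ s, kerApply (adjKernel K) y s * (f s - if t ≤ s then f s else 0)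
      = inner ℝ (tailL2 t fun r => K r t)
          (truncInv lam K t (tailProj t (intOp K (toL2 f - tailProj t (toL2 f))))) := by
    have e1 : toL2 (fun s => f s - if t ≤ s then f s else 0)
        = toL2 f - tailProj t (toL2 f) := by
      refine toL2_eq_of_ae ?_
      filter_upwards [Lp.coeFn_sub (toL2 f) (tailProj t (toL2 f)), toL2_coeFn hf,
        tailProj_coeFn t (toL2 f)] with s a1 a2 a3
      rw [a1, Pi.sub_apply, a3, a2]
    have e2 : toL2 (kerApply (adjKernel K) y) = intOp (adjKernel K) y :=
      toL2_eq_of_ae (intOp_apply hK.isL2Kernel.adj y).symm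
    rw [← hK.truncInv_symm hlam, ← inner_tailProj_left, ← hy, ← inner_intOp_adj hK.isL2Kernel,
      ← e1, ← e2, inner_toL2 hz hg]
    rfl
  rw [← h2, kerApply, kerApply, ← integral_sub, ← integral_const_mul]
  · exact integral_congr_ae (ae_of_all _ hpt)
  · exact hz.integrable_mul hg
  · exact (hK.memLp_row t).integrable_mul hf

end KerB

/-! ### Square integrable processes as `L²([0,T])`-valued random variables -/

section Processes

variable {Ω : Type*} [mΩ : MeasurableSpace Ω] {P : Measure Ω} {T : ℝ}

/-- Jointly measurable processes `u` with `∫₀ᵀ E[u_s²] ds < ∞`. -/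
structure IsSqProc (P : Measure Ω) {T : ℝ} (u : Proc T Ω) : Prop where
  measurable : Measurable (Function.uncurry u)
  memLp : MemLp (Function.uncurry u) 2 ((volume : Measure (Time T)).prod P)

/-- The class in `L²(Ω; L²([0,T]))` of a process (`0` if it is not square integrable). -/
def procL2 (P : Measure Ω) {T : ℝ} (u : Proc T Ω) : Lp (L2 T) 2 P :=
  open Classical in if h : MemLp (fun ω => toL2 fun t => u t ω) 2 P then h.toLp _ else 0

theorem ae_ae_of_ae_prod_swap [SFinite P] {q : Time T × Ω → Prop}
    (h : ∀ᵐ p ∂((volume : Measure (Time T)).prod P), q p) :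
    ∀ᵐ ω ∂P, ∀ᵐ t : Time T, q (t, ω) :=
  Measure.ae_ae_of_ae_prod (Measure.measurePreserving_swap.quasiMeasurePreserving.ae h)

theorem IsSqProc.add {u v : Proc T Ω} (hu : IsSqProc P u) (hv : IsSqProc P v) :
    IsSqProc P fun t ω => u t ω + v t ω :=
  ⟨hu.measurable.add hv.measurable, MemLp.add hu.memLp hv.memLp⟩

theorem IsSqProc.sub {u v : Proc T Ω} (hu : IsSqProc P u) (hv : IsSqProc P v) :
    IsSqProc P fun t ω => u t ω - v t ω :=
  ⟨hu.measurable.sub hv.measurable, MemLp.sub hu.memLp hv.memLp⟩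

theorem IsSqProc.const_mul {u : Proc T Ω} (hu : IsSqProc P u) (c : ℝ) :
    IsSqProc P fun t ω => c * u t ω :=
  ⟨hu.measurable.const_mul c, MemLp.const_mul hu.memLp c⟩

theorem isSqProc_sum {ι : Type*} (s : Finset ι) {u : ι → Proc T Ω}
    (hu : ∀ j, IsSqProc P (u j)) : IsSqProc P fun t ω => ∑ j ∈ s, u j t ω := by
  classical
  induction s using Finset.induction_on with
  | empty => simpa using (⟨measurable_const, MemLp.zero⟩ : IsSqProc P fun (_ : Time T) (_ : Ω) => 0)
  | insert j s hj ih => simpa only [Finset.sum_insert hj] using (hu j).add ih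

theorem isSqProc_playerAverage {N : ℕ} {u : Fin N → Proc T Ω} (hu : ∀ j, IsSqProc P (u j)) :
    IsSqProc P (playerAverage u) :=
  (isSqProc_sum _ hu).const_mul _

variable [IsProbabilityMeasure P]

theorem isSqProc_of_lintegral {u : Proc T Ω} (hm : Measurable (Function.uncurry u))
    (h : ∫⁻ s, ∫⁻ ω, ‖u s ω‖ₑ ^ 2 ∂P < ⊤) : IsSqProc P u := by
  refine ⟨hm, (memLp_two_iff_lintegral hm.aestronglyMeasurable).2 ?_⟩
  rwa [lintegral_prod _ (hm.enorm.pow_const 2).aemeasurable]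

theorem IsSqProc.lintegral_lt_top {u : Proc T Ω} (hu : IsSqProc P u) :
    ∫⁻ s, ∫⁻ ω, ‖u s ω‖ₑ ^ 2 ∂P < ⊤ := by
  have h := (memLp_two_iff_lintegral hu.memLp.1).1 hu.memLp
  rwa [lintegral_prod _ (hu.measurable.enorm.pow_const 2).aemeasurable] at h

theorem IsSqProc.memLp_path {u : Proc T Ω} (hu : IsSqProc P u) :
    ∀ᵐ ω ∂P, MemLp (fun t => u t ω) 2 volume := by
  have h := (memLp_two_iff_lintegral hu.memLp.1).1 hu.memLp
  have hm : Measurable fun p : Time T × Ω => ‖Function.uncurry u p‖ₑ ^ 2 :=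
    hu.measurable.enorm.pow_const 2
  rw [lintegral_prod_symm _ hm.aemeasurable] at h
  filter_upwards [ae_lt_top hm.lintegral_prod_left' h.ne] with ω hω
  exact (memLp_two_iff_lintegral
    (hu.measurable.comp measurable_prodMk_right).aestronglyMeasurable).2 hω

theorem IsSqProc.memLp_time {u : Proc T Ω} (hu : IsSqProc P u) :
    ∀ᵐ t : Time T, MemLp (u t) 2 P := by
  have hm : Measurable fun p : Time T × Ω => ‖Function.uncurry u p‖ₑ ^ 2 :=
    hu.measurable.enorm.pow_const 2
  filter_upwards [ae_lt_top hm.lintegral_prod_right' hu.lintegral_lt_top.ne] with t ht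
  exact (memLp_two_iff_lintegral
    (hu.measurable.comp measurable_prodMk_left).aestronglyMeasurable).2 ht

theorem stronglyMeasurable_path {u : Proc T Ω} (hu : Measurable (Function.uncurry u)) :
    StronglyMeasurable fun ω => toL2 fun t => u t ω :=
  stronglyMeasurable_toL2 (f := fun ω t => u t ω) (hu.comp measurable_swap)

theorem eLpNorm_two_sq_normed {α E : Type*} [MeasurableSpace α] [NormedAddCommGroup E]
    (μ : Measure α) (f : α → E) : eLpNorm f 2 μ ^ 2 = ∫⁻ x, ‖f x‖ₑ ^ 2 ∂μ := by
  simpa using eLpNorm_nnreal_pow_eq_lintegral (f := f) (μ := μ) (p := 2) (by norm_num)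

theorem enorm_toL2_sq {f : Time T → ℝ} (hf : MemLp f 2 volume) :
    ‖toL2 f‖ₑ ^ 2 = ∫⁻ s, ‖f s‖ₑ ^ 2 := by
  rw [← norm_toL2_sq hf, ENNReal.ofReal_pow (norm_nonneg _), ofReal_norm]

/-- Tonelli, on which the isometry between L²([0,T] × Ω) and its image in L²(Ω; L²([0,T])) rests. -/
theorem IsSqProc.eLpNorm_path {u : Proc T Ω} (hu : IsSqProc P u) :
    eLpNorm (fun ω => toL2 fun t => u t ω) 2 P
      = eLpNorm (Function.uncurry u) 2 ((volume : Measure (Time T)).prod P) := by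
  refine (ENNReal.pow_right_strictMono two_ne_zero).injective ?_
  rw [eLpNorm_two_sq_normed, eLpNorm_two_sq, lintegral_prod_symm _
    (hu.measurable.enorm.pow_const 2).aemeasurable]
  refine lintegral_congr_ae ?_
  filter_upwards [hu.memLp_path] with ω hω
  rw [enorm_toL2_sq hω]
  rfl

theorem IsSqProc.memLp_toL2 {u : Proc T Ω} (hu : IsSqProc P u) :
    MemLp (fun ω => toL2 fun t => u t ω) 2 P :=
  ⟨(stronglyMeasurable_path hu.measurable).aestronglyMeasurable,
    hu.eLpNorm_path.trans_lt hu.memLp.2⟩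

theorem IsSqProc.procL2_coeFn {u : Proc T Ω} (hu : IsSqProc P u) :
    procL2 P u =ᵐ[P] fun ω => toL2 fun t => u t ω := by
  rw [procL2, dif_pos hu.memLp_toL2]
  exact hu.memLp_toL2.coeFn_toLp

theorem IsSqProc.norm_procL2 {u : Proc T Ω} (hu : IsSqProc P u) :
    ‖procL2 P u‖
      = (eLpNorm (Function.uncurry u) 2 ((volume : Measure (Time T)).prod P)).toReal := by
  rw [procL2, dif_pos hu.memLp_toL2, Lp.norm_toLp, hu.eLpNorm_path]

theorem procL2_eq_of_ae {u : Proc T Ω} (hu : IsSqProc P u) {x : Lp (L2 T) 2 P}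
    (h : ∀ᵐ ω ∂P, (fun t => u t ω) =ᵐ[volume] (x ω : Time T → ℝ)) : procL2 P u = x := by
  refine Lp.ext ?_
  filter_upwards [hu.procL2_coeFn, h] with ω h1 h2
  rw [h1, toL2_eq_of_ae h2]

theorem IsSqProc.procL2_path {u : Proc T Ω} (hu : IsSqProc P u) :
    ∀ᵐ ω ∂P, (procL2 P u ω : Time T → ℝ) =ᵐ[volume] fun t => u t ω := by
  filter_upwards [hu.procL2_coeFn, hu.memLp_path] with ω h1 h2
  rw [h1]
  exact toL2_coeFn h2

theorem ProcessEq.procL2_eq {u v : Proc T Ω} (hu : IsSqProc P u) (hv : IsSqProc P v)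
    (h : ProcessEq P u v) : procL2 P u = procL2 P v := by
  refine procL2_eq_of_ae hu ?_
  filter_upwards [ae_ae_of_ae_prod_swap h, hv.procL2_path] with ω h1 h2
  exact Filter.EventuallyEq.trans h1 h2.symm

theorem processEq_of_procL2_eq {u v : Proc T Ω} (hu : IsSqProc P u) (hv : IsSqProc P v)
    (h : procL2 P u = procL2 P v) : ProcessEq P u v := by
  have h1 : ∀ᵐ ω ∂P, ∀ᵐ t : Time T, u t ω = v t ω := by
    filter_upwards [hu.procL2_path, hv.procL2_path] with ω h1 h2
    rw [← h] at h2
    exact h1.symm.trans h2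
  have h2 : ∀ᵐ p ∂(P.prod (volume : Measure (Time T))), u p.2 p.1 = v p.2 p.1 :=
    (Measure.ae_prod_iff_ae_ae (measurableSet_eq_fun (hu.measurable.comp measurable_swap)
      (hv.measurable.comp measurable_swap))).2 h1
  exact (Measure.measurePreserving_swap (μ := (volume : Measure (Time T)))
    (ν := P)).quasiMeasurePreserving.ae h2

theorem procL2_add {u v : Proc T Ω} (hu : IsSqProc P u) (hv : IsSqProc P v) :
    procL2 P (fun t ω => u t ω + v t ω) = procL2 P u + procL2 P v := by
  refine procL2_eq_of_ae (hu.add hv) ?_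
  filter_upwards [hu.procL2_path, hv.procL2_path, Lp.coeFn_add (procL2 P u) (procL2 P v)]
    with ω h1 h2 h3
  rw [h3, Pi.add_apply]
  filter_upwards [h1, h2, Lp.coeFn_add (procL2 P u ω) (procL2 P v ω)] with t e1 e2 e3
  rw [e3, Pi.add_apply, e1, e2]

theorem procL2_sub {u v : Proc T Ω} (hu : IsSqProc P u) (hv : IsSqProc P v) :
    procL2 P (fun t ω => u t ω - v t ω) = procL2 P u - procL2 P v := by
  refine procL2_eq_of_ae (hu.sub hv) ?_
  filter_upwards [hu.procL2_path, hv.procL2_path, Lp.coeFn_sub (procL2 P u) (procL2 P v)]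
    with ω h1 h2 h3
  rw [h3, Pi.sub_apply]
  filter_upwards [h1, h2, Lp.coeFn_sub (procL2 P u ω) (procL2 P v ω)] with t e1 e2 e3
  rw [e3, Pi.sub_apply, e1, e2]

theorem procL2_const_mul {u : Proc T Ω} (hu : IsSqProc P u) (c : ℝ) :
    procL2 P (fun t ω => c * u t ω) = c • procL2 P u := by
  refine procL2_eq_of_ae (hu.const_mul c) ?_
  filter_upwards [hu.procL2_path, Lp.coeFn_smul c (procL2 P u)] with ω h1 h3
  rw [h3, Pi.smul_apply]
  filter_upwards [h1, Lp.coeFn_smul c (procL2 P u ω)] with t e1 e3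
  rw [e3, Pi.smul_apply, e1, smul_eq_mul]

theorem procL2_sum {ι : Type*} (s : Finset ι) {u : ι → Proc T Ω}
    (hu : ∀ j, IsSqProc P (u j)) :
    procL2 P (fun t ω => ∑ j ∈ s, u j t ω) = ∑ j ∈ s, procL2 P (u j) := by
  classical
  induction s using Finset.induction_on with
  | empty =>
    have h := procL2_const_mul
      (⟨measurable_const, MemLp.zero⟩ : IsSqProc P fun (_ : Time T) (_ : Ω) => 0) 0
    simpa using h
  | insert j s hj ih =>
    simp only [Finset.sum_insert hj]
    rw [procL2_add (hu j) (isSqProc_sum s hu), ih]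

theorem procL2_playerAverage {N : ℕ} {u : Fin N → Proc T Ω} (hu : ∀ j, IsSqProc P (u j)) :
    procL2 P (playerAverage u) = (1 / (N : ℝ)) • ∑ j, procL2 P (u j) := by
  rw [← procL2_sum _ hu]
  exact procL2_const_mul (isSqProc_sum _ hu) _

theorem measurable_kerApply {Y : Type*} [MeasurableSpace Y] {K : Kernel T}
    (hK : Measurable (Function.uncurry K)) {t : Y → Time T} (ht : Measurable t)
    {v : Y → Time T → ℝ} (hv : Measurable (Function.uncurry v)) :
    Measurable fun y => kerApply K (v y) (t y) := by
  have h : Measurable fun p : Y × Time T => K (t p.1) p.2 * v p.1 p.2 :=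
    (hK.comp ((ht.comp measurable_fst).prodMk measurable_snd)).mul hv
  exact h.stronglyMeasurable.integral_prod_right'.measurable

theorem IsSqProc.kerApply {u : Proc T Ω} (hu : IsSqProc P u) {K : Kernel T}
    (hm : Measurable (Function.uncurry K)) (hK : IsL2Kernel K) :
    IsSqProc P fun t ω => kerApply K (fun s => u s ω) t := by
  have hmeas : Measurable (Function.uncurry
      fun (t : Time T) (ω : Ω) => VolterraGame.kerApply K (fun s => u s ω) t) :=
    measurable_kerApply (Y := Time T × Ω) (t := fun p => p.1) (v := fun p s => u s p.2) hm
      measurable_fst (hu.measurable.comp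
        (measurable_snd.prodMk (measurable_snd.comp measurable_fst)))
  have hpath : ∀ᵐ ω ∂P, ∫⁻ t, ‖VolterraGame.kerApply K (fun s => u s ω) t‖ₑ ^ 2
      ≤ eLpNorm (Function.uncurry K) 2 ((volume : Measure (Time T)).prod volume) ^ 2
        * ∫⁻ t, ‖u t ω‖ₑ ^ 2 := by
    filter_upwards [hu.memLp_path] with ω hω
    rw [← eLpNorm_two_sq, ← eLpNorm_two_sq, ← mul_pow]
    exact pow_le_pow_left' (kerApply_eLpNorm_le hK hω) 2
  refine ⟨hmeas, (memLp_two_iff_lintegral hmeas.aestronglyMeasurable).2 ?_⟩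
  have hfin := (memLp_two_iff_lintegral hu.memLp.1).1 hu.memLp
  have hm2 : Measurable fun p : Time T × Ω => ‖Function.uncurry u p‖ₑ ^ 2 :=
    hu.measurable.enorm.pow_const 2
  rw [lintegral_prod_symm _ hm2.aemeasurable] at hfin
  rw [lintegral_prod_symm _ (hmeas.enorm.pow_const 2).aemeasurable]
  refine (lintegral_mono_ae hpath).trans_lt ?_
  rw [lintegral_const_mul' _ _ (ENNReal.pow_lt_top hK.2).ne]
  exact ENNReal.mul_lt_top (ENNReal.pow_lt_top hK.2) hfin

theorem procL2_kerApply {u : Proc T Ω} (hu : IsSqProc P u) {K : Kernel T}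
    (hm : Measurable (Function.uncurry K)) (hK : IsL2Kernel K) :
    procL2 P (fun t ω => kerApply K (fun s => u s ω) t)
      = (intOp K).compLpL 2 P (procL2 P u) := by
  refine procL2_eq_of_ae (hu.kerApply hm hK) ?_
  filter_upwards [hu.procL2_path, (intOp K).coeFn_compLpL (procL2 P u)] with ω h1 h2
  rw [h2]
  filter_upwards [intOp_apply hK (procL2 P u ω)] with t e1
  rw [e1, kerApply_congr K h1]

theorem inner_procL2 {u v : Proc T Ω} (hu : IsSqProc P u) (hv : IsSqProc P v) :
    inner ℝ (procL2 P u) (procL2 P v) = ∫ ω, pairing (fun t => u t ω) (fun t => v t ω) ∂P := by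
  rw [L2.inner_def]
  refine integral_congr_ae ?_
  filter_upwards [hu.procL2_coeFn, hv.procL2_coeFn, hu.memLp_path, hv.memLp_path] with ω h1 h2 h3 h4
  rw [h1, h2, inner_toL2 h3 h4]

theorem integrable_pairing {u v : Proc T Ω} (hu : IsSqProc P u) (hv : IsSqProc P v) :
    Integrable (fun ω => pairing (fun t => u t ω) (fun t => v t ω)) P := by
  refine (L2.integrable_inner (𝕜 := ℝ) (procL2 P u) (procL2 P v)).congr ?_
  filter_upwards [hu.procL2_coeFn, hv.procL2_coeFn, hu.memLp_path, hv.memLp_path] with ω h1 h2 h3 h4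
  rw [h1, h2, inner_toL2 h3 h4]

end Processes

/-! ### Progressively measurable processes -/

section Progressive

variable {Ω : Type*} [mΩ : MeasurableSpace Ω] {P : Measure Ω} {T : ℝ}

theorem stronglyMeasurable_real {α : Type*} (m : MeasurableSpace α) {f : α → ℝ}
    (h : Measurable[m] f) : StronglyMeasurable[m] f :=
  h.stronglyMeasurable

/-- The progressive `σ`-algebra. -/
@[reducible]
def progSpace {T : ℝ} (𝓕 : Filtration (Time T) mΩ) : MeasurableSpace (Time T × Ω) :=
  ⨅ τ : Time T, @MeasurableSpace.map (Set.Iic τ × Ω) (Time T × Ω) (fun p => ((p.1 : Time T), p.2))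
    (Subtype.instMeasurableSpace.prod (𝓕 τ))

/-- Progressive measurability becomes measurability for a single σ-algebra, so progressive classes
form an `lpMeas` space and completeness comes for free. -/
theorem isStronglyProgressive_iff {𝓕 : Filtration (Time T) mΩ} {u : Proc T Ω} :
    IsStronglyProgressive 𝓕 u ↔ Measurable[progSpace 𝓕] (Function.uncurry u) := by
  constructor
  · intro h s hs
    rw [progSpace, MeasurableSpace.measurableSet_iInf]
    intro τ
    exact (h τ).measurable hs
  · intro h τ
    refine stronglyMeasurable_real (Subtype.instMeasurableSpace.prod (𝓕 τ)) ?_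
    intro s hs
    have := h hs
    rw [progSpace, MeasurableSpace.measurableSet_iInf] at this
    exact this τ

theorem progSpace_le (hT : 0 ≤ T) (𝓕 : Filtration (Time T) mΩ) :
    progSpace 𝓕 ≤ (inferInstance : MeasurableSpace (Time T × Ω)) := by
  intro S hS
  rw [progSpace, MeasurableSpace.measurableSet_iInf] at hS
  -- At the terminal time the restriction to [0,τ] is no restriction.
  set τ : Time T := ⟨T, hT, le_rfl⟩
  have h1 := hS τ
  have h2 : Measurable fun p : Time T × Ω => ((⟨p.1, p.1.2.2⟩ : Set.Iic τ), p.2) :=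
    (measurable_fst.subtype_mk).prodMk measurable_snd
  have h3 : @Measurable _ _ _ (Subtype.instMeasurableSpace.prod (𝓕 τ))
      fun p : Time T × Ω => ((⟨p.1, p.1.2.2⟩ : Set.Iic τ), p.2) :=
    h2.mono le_rfl (sup_le_sup le_rfl (MeasurableSpace.comap_mono (𝓕.le τ)))
  exact h3 h1

theorem IsAdmissible.measurable {𝓕 : Filtration (Time T) mΩ} {u : Proc T Ω} (hT : 0 ≤ T)
    (hu : IsAdmissible P 𝓕 u) : Measurable (Function.uncurry u) :=
  (isStronglyProgressive_iff.1 hu.1).mono (progSpace_le hT 𝓕) le_rfl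

variable [IsProbabilityMeasure P]

theorem IsAdmissible.isSqProc {𝓕 : Filtration (Time T) mΩ} {u : Proc T Ω} (hT : 0 ≤ T)
    (hu : IsAdmissible P 𝓕 u) : IsSqProc P u :=
  isSqProc_of_lintegral (hu.measurable hT) hu.2

theorem IsSqProc.isAdmissible {𝓕 : Filtration (Time T) mΩ} {u : Proc T Ω} (hu : IsSqProc P u)
    (h : IsStronglyProgressive 𝓕 u) : IsAdmissible P 𝓕 u :=
  ⟨h, hu.lintegral_lt_top⟩

/-- Up to time τ the integral only involves `u` before τ, so `u` may be stopped at τ; the stopped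
process is a function of the restriction to [0,τ] × Ω. The σ-algebra on Ω is left free so that it
can be taken to be `𝓕 τ`. -/
theorem stronglyMeasurable_kerApply_of_volterra {Ω : Type*} [MeasurableSpace Ω] {τ : Time T}
    {u : Proc T Ω} (hu : StronglyMeasurable fun p : Set.Iic τ × Ω => u p.1 p.2) {B : Kernel T}
    (hB : Measurable (Function.uncurry B)) (hV : ∀ t s, t ≤ s → B t s = 0) :
    StronglyMeasurable fun p : Set.Iic τ × Ω => kerApply B (fun s => u s p.2) p.1 := by
  have h1 : Measurable fun q : (Set.Iic τ × Ω) × Time T => u (min q.2 τ) q.1.2 :=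
    hu.measurable.comp (((measurable_snd.min measurable_const).subtype_mk
      (h := fun q => min_le_right q.2 τ)).prodMk (measurable_snd.comp measurable_fst))
  have h2 : (fun p : Set.Iic τ × Ω => kerApply B (fun s => u s p.2) p.1)
      = fun p : Set.Iic τ × Ω => kerApply B (fun s => u (min s τ) p.2) p.1 := by
    funext p
    refine integral_congr_ae (ae_of_all _ fun s => ?_)
    rcases le_total (p.1 : Time T) s with h | h
    · simp [hV _ _ h]
    · simp [min_eq_left (h.trans p.1.2)]
  rw [h2]
  exact (measurable_kerApply hB (measurable_subtype_coe.comp measurable_fst) h1).stronglyMeasurable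

theorem isStronglyProgressive_kerApply {𝓕 : Filtration (Time T) mΩ} {u : Proc T Ω}
    (hu : IsStronglyProgressive 𝓕 u) {B : Kernel T} (hB : Measurable (Function.uncurry B))
    (hV : ∀ t s, t ≤ s → B t s = 0) :
    IsStronglyProgressive 𝓕 fun t ω => kerApply B (fun s => u s ω) t :=
  fun τ => @stronglyMeasurable_kerApply_of_volterra T Ω (𝓕 τ) τ u (hu τ) B hB hV

theorem stronglyMeasurable_path_before {Ω : Type*} [MeasurableSpace Ω] {t : Time T}
    {u : Proc T Ω} (hu : StronglyMeasurable fun p : Set.Iic t × Ω => u p.1 p.2) :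
    StronglyMeasurable fun ω => toL2 fun s => if t ≤ s then 0 else u s ω := by
  have h1 : Measurable fun q : Ω × Time T => u (min q.2 t) q.1 :=
    hu.measurable.comp (((measurable_snd.min measurable_const).subtype_mk
      (h := fun q => min_le_right q.2 t)).prodMk measurable_fst)
  refine stronglyMeasurable_toL2 (f := fun ω s => if t ≤ s then 0 else u s ω) ?_
  have h2 : (Function.uncurry fun ω s => if t ≤ s then 0 else u s ω)
      = fun q : Ω × Time T => if t ≤ q.2 then 0 else u (min q.2 t) q.1 := by
    funext q
    rcases le_or_gt t q.2 with h | h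
    · simp [h, Function.uncurry]
    · simp [not_le.2 h, Function.uncurry, min_eq_left h.le]
  rw [h2]
  exact Measurable.ite (measurableSet_le measurable_const measurable_snd) measurable_const h1

/-- Test processes whose random factor is known at time `t` and which vanish before `t`; they detect
conditional expectations of tails given `𝓕 t`. -/
theorem isAdmissible_indicator_tail {𝓕 : Filtration (Time T) mΩ} {t : Time T} {A : Set Ω}
    (hA : MeasurableSet[𝓕 t] A) {h : Time T → ℝ} (hm : Measurable h) (hh : MemLp h 2 volume) :
    IsAdmissible P 𝓕 fun s ω => A.indicator (fun _ => if t ≤ s then h s else 0) ω := by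
  have key : ∀ (τ : Time T) {m : MeasurableSpace Ω}, MeasurableSet[m] A →
      Measurable fun p : Set.Iic τ × Ω =>
        A.indicator (fun _ => if t ≤ (p.1 : Time T) then h p.1 else 0) p.2 := by
    intro τ m hA
    have h0 : Measurable fun p : Set.Iic τ × Ω => (p.1 : Time T) :=
      measurable_subtype_coe.comp measurable_fst
    have h1 : Measurable fun p : Set.Iic τ × Ω => if t ≤ (p.1 : Time T) then h p.1 else 0 :=
      Measurable.ite (measurableSet_le measurable_const h0) (hm.comp h0) measurable_const
    exact h1.indicator (measurable_snd hA)
  refine ⟨fun τ => ?_, ?_⟩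
  · rcases le_or_gt t τ with hτ | hτ
    · refine stronglyMeasurable_real (Subtype.instMeasurableSpace.prod (𝓕 τ)) ?_
      exact @key τ (𝓕 τ) (𝓕.mono hτ _ hA)
    · have h0 : (fun p : Set.Iic τ × Ω =>
          A.indicator (fun _ => if t ≤ (p.1 : Time T) then h p.1 else 0) p.2) = fun _ => 0 := by
        funext p
        simp [not_le.2 (lt_of_le_of_lt p.1.2 hτ)]
      rw [h0]
      exact @stronglyMeasurable_const _ _ (Subtype.instMeasurableSpace.prod (𝓕 τ)) _ _
  · refine lt_of_le_of_lt (b := ∫⁻ s, ‖h s‖ₑ ^ 2) (lintegral_mono fun s => ?_)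
      ((memLp_two_iff_lintegral hh.1).1 hh)
    refine (lintegral_mono (g := fun _ => ‖h s‖ₑ ^ 2) fun ω => ?_).trans (by simp)
    by_cases hω : ω ∈ A <;> by_cases hs : t ≤ s <;> simp [hω, hs]

/-- A square integrable function on `[0,T] × Ω` as a random variable with values in
`L²([0,T])`. -/
def pathIsometry (P : Measure Ω) [IsProbabilityMeasure P] (T : ℝ) :
    Lp ℝ 2 ((volume : Measure (Time T)).prod P) →ₗᵢ[ℝ] Lp (L2 T) 2 P where
  toFun f := procL2 P fun t ω => f (t, ω)
  map_add' f g := by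
    have h : ∀ f : Lp ℝ 2 ((volume : Measure (Time T)).prod P), IsSqProc P fun t ω => f (t, ω) :=
      fun f => ⟨(Lp.stronglyMeasurable f).measurable, Lp.memLp f⟩
    rw [← procL2_add (h f) (h g)]
    exact ProcessEq.procL2_eq (h _) ((h f).add (h g)) (Lp.coeFn_add f g)
  map_smul' c f := by
    have h : ∀ f : Lp ℝ 2 ((volume : Measure (Time T)).prod P), IsSqProc P fun t ω => f (t, ω) :=
      fun f => ⟨(Lp.stronglyMeasurable f).measurable, Lp.memLp f⟩
    rw [RingHom.id_apply, ← procL2_const_mul (h f)]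
    exact ProcessEq.procL2_eq (h _) ((h f).const_mul c) (Lp.coeFn_smul c f)
  norm_map' f := by
    have h : IsSqProc P fun t ω => f (t, ω) :=
      ⟨(Lp.stronglyMeasurable f).measurable, Lp.memLp f⟩
    exact h.norm_procL2.trans rfl

/-- The subspace of `L²(Ω; L²([0,T]))` of the classes of progressively measurable processes. -/
def progSubmodule (P : Measure Ω) [IsProbabilityMeasure P] (𝓕 : Filtration (Time T) mΩ) :
    Submodule ℝ (Lp (L2 T) 2 P) :=
  (lpMeas ℝ ℝ (progSpace 𝓕) 2 ((volume : Measure (Time T)).prod P)).map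
    (pathIsometry P T).toLinearMap

/-- The subspace is the isometric image of a complete space; completeness is what Lax–Milgram on it
requires. -/
theorem completeSpace_progSubmodule (hT : 0 ≤ T) (𝓕 : Filtration (Time T) mΩ) :
    CompleteSpace (progSubmodule P 𝓕) := by
  have : Fact (progSpace 𝓕 ≤ (inferInstance : MeasurableSpace (Time T × Ω))) :=
    ⟨progSpace_le hT 𝓕⟩
  have h : CompleteSpace (lpMeas ℝ ℝ (progSpace 𝓕) 2 ((volume : Measure (Time T)).prod P)) :=
    inferInstance
  exact completeSpace_coe_iff_isComplete.2
    ((LinearIsometry.isComplete_map_iff (pathIsometry P T)).2 (completeSpace_coe_iff_isComplete.1 h))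

/-- A class measurable for the progressive σ-algebra up to null sets is replaced by a strictly
measurable representative, so every element of the subspace comes from a genuine strategy. -/
theorem mem_progSubmodule (hT : 0 ≤ T) {𝓕 : Filtration (Time T) mΩ} {x : Lp (L2 T) 2 P} :
    x ∈ progSubmodule P 𝓕 ↔ ∃ u, IsAdmissible P 𝓕 u ∧ procL2 P u = x := by
  rw [progSubmodule, Submodule.mem_map]
  constructor
  · rintro ⟨f, hf, rfl⟩
    obtain ⟨g, hg, hfg⟩ := mem_lpMeas_iff_aestronglyMeasurable.1 hf
    have hgm : Measurable g := hg.measurable.mono (progSpace_le hT 𝓕) le_rfl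
    have hu : IsSqProc P fun t ω => g (t, ω) := ⟨hgm, (memLp_congr_ae hfg).1 (Lp.memLp f)⟩
    refine ⟨fun t ω => g (t, ω), hu.isAdmissible (isStronglyProgressive_iff.2 hg.measurable), ?_⟩
    have hf' : IsSqProc P fun t ω => f (t, ω) :=
      ⟨(Lp.stronglyMeasurable f).measurable, Lp.memLp f⟩
    exact (ProcessEq.procL2_eq hf' hu hfg).symm
  · rintro ⟨u, hu, rfl⟩
    have hs := hu.isSqProc hT
    refine ⟨hs.memLp.toLp _, ?_, ?_⟩
    · rw [mem_lpMeas_iff_aestronglyMeasurable]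
      refine AEStronglyMeasurable.congr ?_ hs.memLp.coeFn_toLp.symm
      exact (isStronglyProgressive_iff.1 hu.1).stronglyMeasurable.aestronglyMeasurable
    · have hf' : IsSqProc P fun t ω => hs.memLp.toLp (Function.uncurry u) (t, ω) :=
        ⟨(Lp.stronglyMeasurable _).measurable, Lp.memLp _⟩
      exact ProcessEq.procL2_eq hf' hs hs.memLp.coeFn_toLp

end Progressive

/-! ### Processes orthogonal to all progressively measurable processes -/

section Orthogonal

variable {Ω : Type*} [mΩ : MeasurableSpace Ω] {P : Measure Ω}

theorem inner_toLp_eq_integral {f g : Ω → ℝ} (hf : MemLp f 2 P) (hg : MemLp g 2 P) :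
    inner ℝ (hf.toLp f) (hg.toLp g) = ∫ ω, f ω * g ω ∂P := by
  rw [L2.inner_def]
  refine integral_congr_ae ?_
  filter_upwards [hf.coeFn_toLp, hg.coeFn_toLp] with ω h1 h2
  simp [h1, h2, mul_comm]

theorem sq_integral_mul_le {f g : Ω → ℝ} (hf : MemLp f 2 P) (hg : MemLp g 2 P) :
    (∫ ω, f ω * g ω ∂P) ^ 2 ≤ (∫ ω, f ω * f ω ∂P) * ∫ ω, g ω * g ω ∂P := by
  rw [sq, ← inner_toLp_eq_integral hf hg, ← inner_toLp_eq_integral hf hf,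
    ← inner_toLp_eq_integral hg hg]
  exact real_inner_mul_inner_self_le _ _

variable [IsProbabilityMeasure P]

theorem integral_condExp_mul {m : MeasurableSpace Ω} (hm : m ≤ mΩ) {f g : Ω → ℝ}
    (hf : MemLp f 2 P) (hg : MemLp g 2 P) :
    ∫ ω, (P[f | m]) ω * g ω ∂P = ∫ ω, f ω * (P[g | m]) ω ∂P := by
  have h := inner_condExpL2_left_eq_right (𝕜 := ℝ) hm (f := hf.toLp f) (g := hg.toLp g)
  rw [L2.inner_def, L2.inner_def] at h
  refine Eq.trans ?_ (h.trans ?_)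
  · refine integral_congr_ae ?_
    filter_upwards [hf.condExpL2_ae_eq_condExp (𝕜 := ℝ) hm, hg.coeFn_toLp] with ω h1 h2
    rw [h1, h2]
    simp [mul_comm]
  · refine integral_congr_ae ?_
    filter_upwards [hg.condExpL2_ae_eq_condExp (𝕜 := ℝ) hm, hf.coeFn_toLp] with ω h1 h2
    rw [h1, h2]
    simp [mul_comm]

theorem integral_condExp_mul_condExp {m₁ m₂ : MeasurableSpace Ω} (h12 : m₁ ≤ m₂) (h2 : m₂ ≤ mΩ)
    {z : Ω → ℝ} (hz : MemLp z 2 P) :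
    ∫ ω, (P[z | m₂]) ω * (P[z | m₁]) ω ∂P = ∫ ω, z ω * (P[z | m₁]) ω ∂P := by
  rw [integral_condExp_mul (mΩ := mΩ) h2 hz (hz.condExp one_le_two),
    condExp_of_stronglyMeasurable h2 (stronglyMeasurable_condExp.mono h12) integrable_condExp]

/-- Pythagoras: a martingale increment is orthogonal to the earlier value. -/
theorem integral_condExp_sub_sq {m₁ m₂ : MeasurableSpace Ω} (h12 : m₁ ≤ m₂) (h2 : m₂ ≤ mΩ)
    {z : Ω → ℝ} (hz : MemLp z 2 P) :
    ∫ ω, ((P[z | m₂]) ω - (P[z | m₁]) ω) * ((P[z | m₂]) ω - (P[z | m₁]) ω) ∂P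
      = ∫ ω, (P[z | m₂]) ω * (P[z | m₂]) ω ∂P - ∫ ω, (P[z | m₁]) ω * (P[z | m₁]) ω ∂P := by
  have i2 : MemLp (P[z | m₂]) 2 P := hz.condExp one_le_two
  have i1 : MemLp (P[z | m₁]) 2 P := hz.condExp one_le_two
  have e1 := integral_condExp_mul_condExp (mΩ := mΩ) h12 h2 hz
  have e2 := integral_condExp_mul_condExp (mΩ := mΩ) le_rfl (h12.trans h2) hz
  have e3 : ∀ ω, ((P[z | m₂]) ω - (P[z | m₁]) ω) * ((P[z | m₂]) ω - (P[z | m₁]) ω)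
      = ((P[z | m₂]) ω * (P[z | m₂]) ω - 2 * ((P[z | m₂]) ω * (P[z | m₁]) ω))
        + (P[z | m₁]) ω * (P[z | m₁]) ω := fun ω => by ring
  simp_rw [e3]
  have j22 : Integrable (fun ω => (P[z | m₂]) ω * (P[z | m₂]) ω) P := i2.integrable_mul i2
  have j21 : Integrable (fun ω => 2 * ((P[z | m₂]) ω * (P[z | m₁]) ω)) P :=
    (i2.integrable_mul i1).const_mul 2
  have j11 : Integrable (fun ω => (P[z | m₁]) ω * (P[z | m₁]) ω) P := i1.integrable_mul i1
  have j : Integrable (fun ω => (P[z | m₂]) ω * (P[z | m₂]) ω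
      - 2 * ((P[z | m₂]) ω * (P[z | m₁]) ω)) P := j22.sub j21
  rw [integral_add j j11, integral_sub j22 j21, integral_const_mul, e1, ← e2]
  ring

variable {T : ℝ}

/-- The point `k/(n+1)` of `[0,T]`, cut off at `T`. -/
def gridPoint (hT : 0 ≤ T) (n k : ℕ) : Time T :=
  ⟨min (k / (n + 1)) T, le_min (by positivity) hT, min_le_right _ _⟩

/-- The largest point of the grid of mesh `1/(n+1)` before `t`. -/
def gridFloor (hT : 0 ≤ T) (n : ℕ) (t : Time T) : Time T :=
  gridPoint hT n ⌊((n : ℝ) + 1) * t⌋₊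

theorem gridFloor_coe (hT : 0 ≤ T) (n : ℕ) (t : Time T) :
    (gridFloor hT n t : ℝ) = ⌊((n : ℝ) + 1) * t⌋₊ / ((n : ℝ) + 1) := by
  refine min_eq_left (le_trans ?_ t.2.2)
  rw [div_le_iff₀ (by positivity)]
  exact (Nat.floor_le (mul_nonneg (by positivity) t.2.1)).trans_eq (mul_comm _ _)

theorem gridFloor_le (hT : 0 ≤ T) (n : ℕ) (t : Time T) : gridFloor hT n t ≤ t := by
  rw [← Subtype.coe_le_coe, gridFloor_coe, div_le_iff₀ (by positivity)]
  exact (Nat.floor_le (mul_nonneg (by positivity) t.2.1)).trans_eq (mul_comm _ _)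

theorem tendsto_gridFloor (hT : 0 ≤ T) (t : Time T) :
    Filter.Tendsto (fun n => gridFloor hT n t) Filter.atTop (𝓝 t) := by
  rw [tendsto_subtype_rng]
  have h1 : Filter.Tendsto (fun n : ℕ => (t : ℝ) - 1 / ((n : ℝ) + 1)) Filter.atTop (𝓝 t) := by
    simpa using tendsto_const_nhds.sub (tendsto_one_div_add_atTop_nhds_zero_nat (𝕜 := ℝ))
  refine tendsto_of_tendsto_of_tendsto_of_le_of_le h1 tendsto_const_nhds (fun n => ?_)
    (fun n => gridFloor_le hT n t)
  rw [gridFloor_coe, le_div_iff₀ (by positivity), sub_mul, one_div_mul_cancel (by positivity)]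
  have := Nat.lt_floor_add_one (((n : ℝ) + 1) * t)
  linarith

/-- A step process that samples the martingale E_t[1_B] at the preceding grid point is progressive,
although no regular version of the martingale has been chosen. -/
theorem isAdmissible_step (hT : 0 ≤ T) (𝓕 : Filtration (Time T) mΩ) {B : Set Ω} (n : ℕ)
    {A : Set (Time T)} (hA : MeasurableSet A) :
    IsAdmissible P 𝓕 fun t ω => A.indicator
      (fun _ => (P[B.indicator (fun _ => (1 : ℝ)) | 𝓕 (gridFloor hT n t)]) ω) t := by
  refine ⟨fun τ => ?_, ?_⟩
  -- Capping the grid points at τ makes all of the countably many sampled variables `𝓕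
  -- τ`-measurable. For times up to τ the cap is inactive, as the preceding grid point is at most τ.
  · have h1 : ∀ k, StronglyMeasurable[𝓕 τ]
        (P[B.indicator (fun _ => (1 : ℝ)) | 𝓕 (min (gridPoint hT n k) τ)]) := fun k =>
      stronglyMeasurable_condExp.mono (𝓕.mono (min_le_right _ _))
    have key : ∀ {m : MeasurableSpace Ω} {M : ℕ → Ω → ℝ}, (∀ k, Measurable[m] (M k)) →
        Measurable fun p : Set.Iic τ × Ω =>
          A.indicator (fun _ => M ⌊((n : ℝ) + 1) * (p.1 : Time T)⌋₊ p.2) (p.1 : Time T) := by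
      intro m M hM
      have h2 : Measurable fun q : ℕ × Ω => M q.1 q.2 := measurable_from_prod_countable_right hM
      have h3 : Measurable fun p : Set.Iic τ × Ω => ⌊((n : ℝ) + 1) * (p.1 : Time T)⌋₊ := by
        fun_prop
      have h0 : Measurable fun p : Set.Iic τ × Ω => (p.1 : Time T) :=
        measurable_subtype_coe.comp measurable_fst
      exact (h2.comp (h3.prodMk measurable_snd)).indicator (h0 hA)
    have h4 := @key (𝓕 τ) _ fun k => (h1 k).measurable
    refine stronglyMeasurable_real (Subtype.instMeasurableSpace.prod (𝓕 τ)) ?_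
    convert! h4 using 2 with p
    by_cases hp : (p.1 : Time T) ∈ A
    · have hle : gridPoint hT n ⌊((n : ℝ) + 1) * (p.1 : Time T)⌋₊ ≤ τ :=
        (gridFloor_le hT n p.1).trans p.1.2
      simp only [Set.indicator_of_mem hp, min_eq_left hle]
      rfl
    · simp only [Set.indicator_of_notMem hp]
  · have hb : ∀ m : MeasurableSpace Ω, ∀ᵐ ω ∂P, ‖(P[B.indicator (fun _ => (1 : ℝ)) | m]) ω‖ ≤ 1 :=
      fun m => ae_bdd_norm_condExp_of_ae_bdd_norm (ae_of_all _ fun ω => by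
        by_cases h : ω ∈ B <;> simp [h])
    refine lt_of_le_of_lt (b := ∫⁻ _ : Time T, 1) (lintegral_mono fun t => ?_) (by
      rw [lintegral_one]; exact measure_lt_top _ _)
    refine (lintegral_mono_ae (g := fun _ => 1) ?_).trans (by simp)
    filter_upwards [hb (𝓕 (gridFloor hT n t))] with ω hω
    by_cases h : t ∈ A
    · rw [Set.indicator_of_mem h]
      refine pow_le_one' ?_ 2
      rw [← enorm_one (G := ℝ)]
      exact enorm_le_iff_norm_le.2 (by simpa using hω)
    · simp [h]

/-- Orthogonality to the step processes gives the identity with the martingale M sampled at grid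
points. The error of sampling is controlled by Cauchy–Schwarz and the increment of φ(t) = E[M_t²],
which tends to 0 at continuity points of φ. -/
theorem integral_condExp_indicator_mul_eq_zero (hT : 0 ≤ T) {𝓕 : Filtration (Time T) mΩ}
    {ρ : Proc T Ω} (hρ : IsSqProc P ρ)
    (h : ∀ v, IsAdmissible P 𝓕 v → inner ℝ (procL2 P ρ) (procL2 P v) = 0)
    {B : Set Ω} (hB : MeasurableSet B) :
    ∀ᵐ t : Time T, ∫ ω, (P[B.indicator (fun _ => (1 : ℝ)) | 𝓕 t]) ω * ρ t ω ∂P = 0 := by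
  set z : Ω → ℝ := B.indicator (fun _ => (1 : ℝ)) with hzd
  have hz : MemLp z 2 P := (memLp_const 1).indicator hB
  set M : Time T → Ω → ℝ := fun t => P[z | 𝓕 t] with hMd
  have hM : ∀ t, MemLp (M t) 2 P := fun t => hz.condExp one_le_two
  have hstep : ∀ n, ∀ᵐ t : Time T, ∫ ω, M (gridFloor hT n t) ω * ρ t ω ∂P = 0 := by
    intro n
    have hv := isAdmissible_step (P := P) hT 𝓕 (B := B) n MeasurableSet.univ
    have hint : Integrable (fun p : Time T × Ω => M (gridFloor hT n p.1) p.2 * ρ p.1 p.2)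
        ((volume : Measure (Time T)).prod P) := by
      have := MemLp.integrable_mul (hv.isSqProc hT).memLp hρ.memLp
      refine this.congr (ae_of_all _ fun p => ?_)
      simp [Function.uncurry, hMd, hzd]
    -- The factor 1_A(t) of the test process localises in time, so the integral over every
    -- measurable A vanishes.
    refine Integrable.ae_eq_zero_of_forall_setIntegral_eq_zero hint.integral_prod_left
      fun A hA _ => ?_
    have hvA := isAdmissible_step (P := P) hT 𝓕 (B := B) n hA
    have h0 := h _ hvA
    rw [inner_procL2 hρ (hvA.isSqProc hT)] at h0
    simp only [pairing] at h0
    have hintA : Integrable (Function.uncurry fun (ω : Ω) (t : Time T) => ρ t ω * A.indicator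
        (fun _ => (P[B.indicator (fun _ => (1 : ℝ)) | 𝓕 (gridFloor hT n t)]) ω) t)
        (P.prod volume) :=
      (MemLp.integrable_mul hρ.memLp (hvA.isSqProc hT).memLp).swap
    rw [integral_integral_swap hintA] at h0
    rw [← integral_indicator hA, ← h0]
    congr 1
    funext t
    by_cases ht : t ∈ A
    · simp only [Set.indicator_of_mem ht]
      congr 1
      funext ω
      exact mul_comm _ _
    · simp [Set.indicator_of_notMem ht]
  set φ : Time T → ℝ := fun t => ∫ ω, M t ω * M t ω ∂P with hφ
  have hdiff : ∀ s t, s ≤ t → ∫ ω, (M t ω - M s ω) * (M t ω - M s ω) ∂P = φ t - φ s :=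
    fun s t hst => integral_condExp_sub_sq (𝓕.mono hst) (𝓕.le t) hz
  have hmono : Monotone φ := fun s t hst => by
    have h1 : 0 ≤ ∫ ω, (M t ω - M s ω) * (M t ω - M s ω) ∂P :=
      integral_nonneg fun ω => mul_self_nonneg _
    rw [hdiff s t hst] at h1
    linarith
  -- A monotone function has countably many discontinuities. This replaces path regularity of the
  -- martingale.
  have hcont : ∀ᵐ t : Time T, ContinuousAt φ t :=
    (hmono.countable_not_continuousAt.measure_zero volume)
  filter_upwards [ae_all_iff.2 hstep, hcont, hρ.memLp_time] with t h1 h2 h3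
  have hle : ∀ n, (∫ ω, M t ω * ρ t ω ∂P) ^ 2
      ≤ (φ t - φ (gridFloor hT n t)) * ∫ ω, ρ t ω * ρ t ω ∂P := by
    intro n
    have e1 : ∫ ω, M t ω * ρ t ω ∂P
        = ∫ ω, (M t ω - M (gridFloor hT n t) ω) * ρ t ω ∂P := by
      have i1 : ∀ s, Integrable (fun ω => M s ω * ρ t ω) P := fun s => (hM s).integrable_mul h3
      simp_rw [sub_mul]
      rw [integral_sub (i1 t) (i1 _), h1 n, sub_zero]
    rw [e1, ← hdiff _ _ (gridFloor_le hT n t)]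
    exact sq_integral_mul_le ((hM t).sub (hM _)) h3
  have hlim : Filter.Tendsto
      (fun n => (φ t - φ (gridFloor hT n t)) * ∫ ω, ρ t ω * ρ t ω ∂P) Filter.atTop (𝓝 0) := by
    have h4 := (tendsto_const_nhds (x := φ t)).sub (h2.tendsto.comp (tendsto_gridFloor hT t))
    simpa using h4.mul_const (∫ ω, ρ t ω * ρ t ω ∂P)
  have h5 := ge_of_tendsto' hlim hle
  exact pow_eq_zero_iff two_ne_zero |>.1 (le_antisymm h5 (sq_nonneg _))

/-- For a fixed B the exceptional set of times depends on B, and a common one is not available for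
all B at once. An induction over measurable sets of the product therefore gives each S its own null
set. -/
theorem setIntegral_condExp_section_eq_zero (hT : 0 ≤ T) {𝓕 : Filtration (Time T) mΩ}
    {ρ : Proc T Ω} (hρ : IsSqProc P ρ)
    (h : ∀ v, IsAdmissible P 𝓕 v → inner ℝ (procL2 P ρ) (procL2 P v) = 0)
    {S : Set (Time T × Ω)} (hS : MeasurableSet S) :
    ∀ᵐ t : Time T, ∫ ω in Prod.mk t ⁻¹' S, (P[ρ t | 𝓕 t]) ω ∂P = 0 := by
  have hrect : ∀ {B : Set Ω}, MeasurableSet B →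
      ∀ᵐ t : Time T, ∫ ω in B, (P[ρ t | 𝓕 t]) ω ∂P = 0 := by
    intro B hB
    filter_upwards [integral_condExp_indicator_mul_eq_zero hT hρ h hB, hρ.memLp_time] with t h1 h2
    rw [integral_condExp_mul (𝓕.le t) ((memLp_const 1).indicator hB) h2] at h1
    rw [← integral_indicator hB]
    refine Eq.trans (integral_congr_ae (ae_of_all _ fun ω => ?_)) h1
    by_cases hω : ω ∈ B <;> simp [hω]
  induction S, hS using MeasurableSpace.induction_on_inter generateFrom_prod.symm
    isPiSystem_prod with
  | empty => simp
  | basic S hS =>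
    obtain ⟨A, hA, B, hB, rfl⟩ := hS
    filter_upwards [hrect hB] with t ht
    by_cases htA : t ∈ A
    · rw [Set.mk_preimage_prod_right htA, ht]
    · rw [Set.mk_preimage_prod_right_eq_empty htA]
      simp
  -- The complement is compared with the whole of Ω, for which the rectangle case also gives zero.
  | compl S hS ih =>
    filter_upwards [ih, hrect MeasurableSet.univ] with t h1 h2
    have h3 := integral_add_compl (measurable_prodMk_left (x := t) hS)
      (integrable_condExp (m := 𝓕 t) (μ := P) (f := ρ t))
    rw [setIntegral_univ] at h2
    rw [h1, h2, zero_add] at h3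
    exact h3
  | iUnion S hd hS ih =>
    filter_upwards [ae_all_iff.2 ih] with t h1
    rw [Set.preimage_iUnion, integral_iUnion (fun i => measurable_prodMk_left (hS i))
      (fun i j hij => (hd hij).preimage _) integrable_condExp.integrableOn]
    simp [h1]

/-- The process ρ is itself a limit of simple functions on the product, and only countably many null
sets occur. Testing E_t[ρ_t] against ρ_t gives E[(E_t[ρ_t])²] = 0, without a jointly measurable
version of the conditional expectations. -/
theorem condExp_eq_zero_of_orthogonal (hT : 0 ≤ T) {𝓕 : Filtration (Time T) mΩ}
    {ρ : Proc T Ω} (hρ : IsSqProc P ρ)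
    (h : ∀ v, IsAdmissible P 𝓕 v → inner ℝ (procL2 P ρ) (procL2 P v) = 0) :
    ∀ᵐ t : Time T, P[ρ t | 𝓕 t] =ᵐ[P] 0 := by
  have hsimple : ∀ f : SimpleFunc (Time T × Ω) ℝ, ∀ᵐ t : Time T,
      ∫ ω, f (t, ω) * (P[ρ t | 𝓕 t]) ω ∂P = 0 := by
    intro f
    induction f using SimpleFunc.induction with
    | @const c s hs =>
      filter_upwards [setIntegral_condExp_section_eq_zero hT hρ h hs] with t ht
      rw [← integral_indicator (measurable_prodMk_left hs)] at ht
      refine Eq.trans ?_ ((congrArg (c * ·) ht).trans (mul_zero c))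
      rw [← integral_const_mul]
      refine integral_congr_ae (ae_of_all _ fun ω => ?_)
      by_cases hω : (t, ω) ∈ s <;> simp [hω]
    | @add f g _ hf hg =>
      filter_upwards [hf, hg] with t h1 h2
      have hi : ∀ f : SimpleFunc (Time T × Ω) ℝ,
          Integrable (fun ω => f (t, ω) * (P[ρ t | 𝓕 t]) ω) P := fun f => by
        obtain ⟨C, hC⟩ := f.exists_forall_norm_le
        exact integrable_condExp.bdd_mul
          (f.measurable.comp measurable_prodMk_left).aestronglyMeasurable
          (ae_of_all _ fun ω => hC (t, ω))
      simp only [SimpleFunc.coe_add, Pi.add_apply, add_mul]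
      rw [integral_add (hi f) (hi g), h1, h2, add_zero]
  set f : ℕ → SimpleFunc (Time T × Ω) ℝ :=
    SimpleFunc.approxOn (Function.uncurry ρ) hρ.measurable Set.univ 0 trivial with hf
  filter_upwards [ae_all_iff.2 fun n => hsimple (f n), hρ.memLp_time] with t h1 h2
  have hη : MemLp (P[ρ t | 𝓕 t]) 2 P := h2.condExp one_le_two
  have hlim : Filter.Tendsto (fun n => ∫ ω, f n (t, ω) * (P[ρ t | 𝓕 t]) ω ∂P) Filter.atTop
      (𝓝 (∫ ω, ρ t ω * (P[ρ t | 𝓕 t]) ω ∂P)) := by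
    refine tendsto_integral_of_dominated_convergence
      (fun ω => 2 * (‖ρ t ω‖ * ‖(P[ρ t | 𝓕 t]) ω‖)) (fun n => ?_) ?_ (fun n => ?_) ?_
    · exact ((f n).measurable.comp measurable_prodMk_left).aestronglyMeasurable.mul hη.1
    · exact (h2.norm.integrable_mul hη.norm).const_mul 2
    · refine ae_of_all _ fun ω => ?_
      rw [norm_mul, ← mul_assoc]
      refine mul_le_mul_of_nonneg_right ?_ (norm_nonneg _)
      rw [two_mul]
      exact SimpleFunc.norm_approxOn_zero_le hρ.measurable (Set.mem_univ _) (t, ω) n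
    · refine ae_of_all _ fun ω => Filter.Tendsto.mul_const _ ?_
      exact SimpleFunc.tendsto_approxOn (x := (t, ω)) hρ.measurable (Set.mem_univ _) (by simp)
  have h3 : ∫ ω, ρ t ω * (P[ρ t | 𝓕 t]) ω ∂P = 0 :=
    tendsto_nhds_unique hlim (by simp [h1])
  have h4 : ∫ ω, (P[ρ t | 𝓕 t]) ω * (P[ρ t | 𝓕 t]) ω ∂P = 0 := by
    exact (integral_condExp_mul_condExp le_rfl (𝓕.le t) h2).trans h3
  have h5 := (integral_eq_zero_iff_of_nonneg (fun ω => mul_self_nonneg _)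
    (hη.integrable_mul hη)).1 h4
  filter_upwards [h5] with ω hω
  exact mul_self_eq_zero.1 hω

end Orthogonal

/-! ### Quadratic games in a Hilbert space -/

section Abstract

variable {E : Type*} [NormedAddCommGroup E] [InnerProductSpace ℝ E]

/-- Lax–Milgram for the compression of `L` to `W`, which inherits coercivity. -/
theorem exists_orthogonal_residual (W : Submodule ℝ E) [CompleteSpace W] (L : E →L[ℝ] E) {c : ℝ}
    (hc : 0 < c) (hL : ∀ x, c * ‖x‖ ^ 2 ≤ inner ℝ (L x) x) (g : E) :
    ∃ u ∈ W, ∀ h ∈ W, inner ℝ (L u - g) h = 0 := by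
  set A : W →L[ℝ] W := W.orthogonalProjectionOnto ∘L L ∘L W.subtypeL with hA
  have hU : IsUnit A := by
    refine ContinuousLinearMap.isUnit_of_forall_le_norm_inner_map A (c := ⟨c, hc.le⟩) hc fun x => ?_
    have h1 : inner ℝ (A x) x = inner ℝ (L x) (x : E) := by
      rw [hA, ContinuousLinearMap.comp_apply,
        Submodule.inner_orthogonalProjectionOnto_eq_of_mem_right]
      rfl
    rw [h1]
    exact (mul_comm _ _).trans_le ((hL x).trans (le_abs_self _))
  obtain ⟨u, hu⟩ := (ContinuousLinearMap.isUnit_iff_bijective.1 hU).2 (W.orthogonalProjectionOnto g)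
  refine ⟨u, u.2, fun h hh => ?_⟩
  have h1 : inner ℝ (A u) (⟨h, hh⟩ : W) = inner ℝ (L u) h := by
    rw [hA, ContinuousLinearMap.comp_apply, Submodule.inner_orthogonalProjectionOnto_eq_of_mem_right]
    rfl
  have h2 : inner ℝ (W.orthogonalProjectionOnto g) (⟨h, hh⟩ : W) = inner ℝ g h :=
    Submodule.inner_orthogonalProjectionOnto_eq_of_mem_right _ _
  rw [inner_sub_left, ← h1, ← h2, hu, sub_self]

theorem eq_of_orthogonal_residual {W : Submodule ℝ E} {L : E →L[ℝ] E} {c : ℝ} (hc : 0 < c)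
    (hL : ∀ x, c * ‖x‖ ^ 2 ≤ inner ℝ (L x) x) {g u v : E} (hu : u ∈ W) (hv : v ∈ W)
    (h1 : ∀ h ∈ W, inner ℝ (L u - g) h = 0) (h2 : ∀ h ∈ W, inner ℝ (L v - g) h = 0) : u = v := by
  have h3 : inner ℝ (L (u - v)) (u - v) = 0 := by
    have e : L (u - v) = (L u - g) - (L v - g) := by rw [map_sub]; abel
    rw [e, inner_sub_left, h1 _ (W.sub_mem hu hv), h2 _ (W.sub_mem hu hv), sub_zero]
  have h4 := hL (u - v)
  rw [h3] at h4
  have h5 : ‖u - v‖ ^ 2 ≤ 0 := nonpos_of_mul_nonpos_right h4 hc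
  rw [← sub_eq_zero, ← norm_eq_zero]
  exact pow_eq_zero_iff two_ne_zero |>.1 (le_antisymm h5 (sq_nonneg _))

variable {N : ℕ}

/-- The average of a profile. -/
def vecAverage (U : Fin N → E) : E := (1 / (N : ℝ)) • ∑ j, U j

/-- The payoff of player `i` in the linear quadratic game given by operators `A₁`, `A₂`, `A₃` and
an adjoint `A₃'` of `A₃`. -/
def quadPayoff (lam : ℝ) (A1 A2 A3 A3' : E →L[ℝ] E) (b : Fin N → E) (b0 : E) (c : Fin N → ℝ)
    (i : Fin N) (U : Fin N → E) : ℝ :=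
  - inner ℝ (vecAverage U) (A1 (vecAverage U)) - inner ℝ (U i) (lam • U i + A2 (U i))
    - inner ℝ (U i) (A3 (vecAverage U) + A3' (vecAverage U)) + inner ℝ (b i) (U i)
    + inner ℝ b0 (vecAverage U) + c i

theorem vecAverage_update (U : Fin N → E) (i : Fin N) (h : E) :
    vecAverage (Function.update U i (U i + h)) = vecAverage U + (1 / (N : ℝ)) • h := by
  rw [vecAverage, vecAverage, ← smul_add, Finset.sum_update_of_mem (Finset.mem_univ i),
    ← Finset.add_sum_erase _ _ (Finset.mem_univ i), Finset.sdiff_singleton_eq_erase]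
  congr 1
  abel

/-- Minus the gradient of the payoff of player `i` in its own strategy. -/
def quadResidual (lam : ℝ) (A1 A1' A2 A2' A3 A3' : E →L[ℝ] E) (b : Fin N → E) (b0 : E)
    (i : Fin N) (U : Fin N → E) : E :=
  (2 * lam) • U i + (A2 (U i) + A2' (U i)) + (1 / (N : ℝ)) • (A3 (U i) + A3' (U i))
    - (b i + (1 / (N : ℝ)) • b0
      - ((1 / (N : ℝ)) • (A1 (vecAverage U) + A1' (vecAverage U))
        + (A3 (vecAverage U) + A3' (vecAverage U))))

/-- The payoff is quadratic, so its second order expansion is exact. The bracket is the positive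
part responsible for concavity, with 1/N for each occurrence of the average. -/
theorem quadPayoff_update (lam : ℝ) {A1 A1' A2 A2' A3 A3' : E →L[ℝ] E}
    (h1 : ∀ x y, inner ℝ (A1' x) y = inner ℝ x (A1 y))
    (h2 : ∀ x y, inner ℝ (A2' x) y = inner ℝ x (A2 y))
    (h3 : ∀ x y, inner ℝ (A3' x) y = inner ℝ x (A3 y))
    (b : Fin N → E) (b0 : E) (c : Fin N → ℝ) (i : Fin N) (U : Fin N → E) (h : E) :
    quadPayoff lam A1 A2 A3 A3' b b0 c i (Function.update U i (U i + h))
      = quadPayoff lam A1 A2 A3 A3' b b0 c i U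
        - inner ℝ (quadResidual lam A1 A1' A2 A2' A3 A3' b b0 i U) h
        - (lam * ‖h‖ ^ 2 + inner ℝ h (A2 h) + (1 / (N : ℝ)) ^ 2 * inner ℝ h (A1 h)
          + 2 * (1 / (N : ℝ)) * inner ℝ h (A3 h)) := by
  simp only [quadPayoff, quadResidual, vecAverage_update, Function.update_self]
  generalize vecAverage U = V
  generalize U i = u
  generalize (1 / (N : ℝ)) = k
  simp only [map_add, map_smul, inner_add_left, inner_add_right, inner_sub_left, inner_smul_left,
    inner_smul_right, conj_trivial, h1, h2, h3, ← real_inner_self_eq_norm_sq]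
  have e1 : ∀ x y, inner ℝ x (A3' y) = inner ℝ y (A3 x) := fun x y => by
    rw [real_inner_comm, h3]
  simp only [e1]
  have c1 : inner ℝ (A1 V) h = inner ℝ h (A1 V) := real_inner_comm _ _
  have c2 : inner ℝ (A2 u) h = inner ℝ h (A2 u) := real_inner_comm _ _
  have c3 : inner ℝ (A3 u) h = inner ℝ h (A3 u) := real_inner_comm _ _
  have c4 : inner ℝ (A3 V) h = inner ℝ h (A3 V) := real_inner_comm _ _
  have c5 : inner ℝ h u = inner ℝ u h := real_inner_comm _ _
  rw [c1, c2, c3, c4, c5]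
  ring

/-- Concavity in the own strategy makes stationarity sufficient; it is necessary because `W` is a
linear space of deviations. -/
theorem quadPayoff_isMax_iff {lam : ℝ} (hlam : 0 < lam) {A1 A1' A2 A2' A3 A3' : E →L[ℝ] E}
    (h1 : ∀ x y, inner ℝ (A1' x) y = inner ℝ x (A1 y))
    (h2 : ∀ x y, inner ℝ (A2' x) y = inner ℝ x (A2 y))
    (h3 : ∀ x y, inner ℝ (A3' x) y = inner ℝ x (A3 y))
    (p1 : ∀ x, 0 ≤ inner ℝ x (A1 x)) (p2 : ∀ x, 0 ≤ inner ℝ x (A2 x))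
    (p3 : ∀ x, 0 ≤ inner ℝ x (A3 x)) (W : Submodule ℝ E)
    (b : Fin N → E) (b0 : E) (c : Fin N → ℝ) (i : Fin N) {U : Fin N → E} (hU : U i ∈ W) :
    (∀ v ∈ W, quadPayoff lam A1 A2 A3 A3' b b0 c i (Function.update U i v)
        ≤ quadPayoff lam A1 A2 A3 A3' b b0 c i U) ↔
      ∀ h ∈ W, inner ℝ (quadResidual lam A1 A1' A2 A2' A3 A3' b b0 i U) h = 0 := by
  have hQ : ∀ h : E, 0 ≤ lam * ‖h‖ ^ 2 + inner ℝ h (A2 h) + (1 / (N : ℝ)) ^ 2 * inner ℝ h (A1 h)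
      + 2 * (1 / (N : ℝ)) * inner ℝ h (A3 h) := fun h => by
    have := p1 h; have := p2 h; have := p3 h
    positivity
  constructor
  · intro hmax h hh
    set d := inner ℝ (quadResidual lam A1 A1' A2 A2' A3 A3' b b0 i U) h with hd
    set q := lam * ‖h‖ ^ 2 + inner ℝ h (A2 h) + (1 / (N : ℝ)) ^ 2 * inner ℝ h (A1 h)
      + 2 * (1 / (N : ℝ)) * inner ℝ h (A3 h) with hq
    have hq0 : 0 ≤ q := hQ h
    have key : ∀ ε : ℝ, 0 ≤ ε * d + ε ^ 2 * q := by
      intro ε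
      have h5 := hmax (U i + ε • h) (W.add_mem hU (W.smul_mem ε hh))
      rw [quadPayoff_update lam h1 h2 h3] at h5
      have e : lam * ‖ε • h‖ ^ 2 + inner ℝ (ε • h) (A2 (ε • h))
          + (1 / (N : ℝ)) ^ 2 * inner ℝ (ε • h) (A1 (ε • h))
          + 2 * (1 / (N : ℝ)) * inner ℝ (ε • h) (A3 (ε • h)) = ε ^ 2 * q := by
        simp only [norm_smul, map_smul, inner_smul_left, inner_smul_right, conj_trivial, mul_pow,
          Real.norm_eq_abs, sq_abs, hq]
        ring
      rw [e, inner_smul_right, ← hd] at h5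
      linarith
    -- Nearly the minimiser of εd + ε²q; with q + 1 in place of q the denominator is positive, and
    -- the value −(d/(q+1))² forces d = 0.
    have h6 := key (-d / (q + 1))
    have e : -d / (q + 1) * d + (-d / (q + 1)) ^ 2 * q = -(d / (q + 1)) ^ 2 := by
      field_simp
      ring
    rw [e] at h6
    have h7 : d / (q + 1) = 0 := by
      refine pow_eq_zero_iff two_ne_zero |>.1 (le_antisymm (by linarith) (sq_nonneg _))
    rcases div_eq_zero_iff.1 h7 with h8 | h8
    · exact h8
    · linarith
  · intro hres v hv
    have h5 := quadPayoff_update lam h1 h2 h3 b b0 c i U (v - U i)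
    rw [add_sub_cancel, hres _ (W.sub_mem hv hU)] at h5
    rw [h5]
    have := hQ (v - U i)
    linarith

theorem vecAverage_mem {W : Submodule ℝ E} {U : Fin N → E} (hU : ∀ i, U i ∈ W) :
    vecAverage U ∈ W :=
  W.smul_mem _ (W.sum_mem fun i _ => hU i)

theorem vecAverage_orthogonal {W : Submodule ℝ E} {U : Fin N → E}
    (hU : ∀ i, ∀ h ∈ W, inner ℝ (U i) h = 0) : ∀ h ∈ W, inner ℝ (vecAverage U) h = 0 := by
  intro h hh
  rw [vecAverage, inner_smul_left, sum_inner]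
  simp [hU _ h hh]

theorem vecAverage_residual (hN : N ≠ 0) (L : E →L[ℝ] E) (U β : Fin N → E) (x : E) :
    vecAverage (fun i => L (U i) - (β i - x)) = L (vecAverage U) - (vecAverage β - x) := by
  have hN' : (N : ℝ) ≠ 0 := Nat.cast_ne_zero.2 hN
  simp only [vecAverage, map_smul, map_sum, Finset.sum_sub_distrib, smul_sub, Finset.sum_const,
    Finset.card_univ, Fintype.card_fin]
  rw [← Nat.cast_smul_eq_nsmul ℝ, smul_smul, one_div_mul_cancel hN', one_smul]

/-- The players interact only through their average, and averaging the N conditions yields an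
equation for the average alone with operator L + M. Once that is solved the players decouple into
equations with operator L. The average of their solutions solves the frozen equation that the chosen
average solves, so the two agree. -/
theorem exists_unique_average_fixed_point (hN : N ≠ 0) (W : Submodule ℝ E) [CompleteSpace W]
    (L M : E →L[ℝ] E) {c : ℝ} (hc : 0 < c) (hL : ∀ x, c * ‖x‖ ^ 2 ≤ inner ℝ (L x) x)
    (hLM : ∀ x, c * ‖x‖ ^ 2 ≤ inner ℝ ((L + M) x) x) (β : Fin N → E) :
    ∃ U : Fin N → E, (∀ i, U i ∈ W) ∧
      (∀ i, ∀ h ∈ W, inner ℝ (L (U i) - (β i - M (vecAverage U))) h = 0) ∧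
      (∀ h ∈ W, inner ℝ ((L + M) (vecAverage U) - vecAverage β) h = 0) ∧
      ∀ V : Fin N → E, (∀ i, V i ∈ W) →
        (∀ i, ∀ h ∈ W, inner ℝ (L (V i) - (β i - M (vecAverage V))) h = 0) → V = U := by
  obtain ⟨ubar, hubar, hub⟩ := exists_orthogonal_residual W (L + M) hc hLM (vecAverage β)
  choose U hU hUr using fun i => exists_orthogonal_residual W L hc hL (β i - M ubar)
  have hsplit : ∀ x : E, (L + M) x - vecAverage β = L x - (vecAverage β - M x) := fun x => by
    rw [_root_.add_apply]; abel
  have havg : vecAverage U = ubar := by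
    refine eq_of_orthogonal_residual hc hL (vecAverage_mem hU) hubar
      (g := vecAverage β - M ubar) ?_ ?_
    · rw [← vecAverage_residual hN]
      exact vecAverage_orthogonal hUr
    · rw [← hsplit]
      exact hub
  refine ⟨U, hU, by rwa [havg], by rwa [havg], fun V hV hVr => ?_⟩
  have hVavg : vecAverage V = ubar := by
    refine eq_of_orthogonal_residual hc hLM (vecAverage_mem hV) hubar (g := vecAverage β) ?_ hub
    rw [hsplit, ← vecAverage_residual hN]
    exact vecAverage_orthogonal hVr
  funext i
  refine eq_of_orthogonal_residual hc hL (hV i) (hU i) ?_ (hUr i)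
  have := hVr i
  rwa [hVavg] at this

end Abstract

/-! ### The explicit solution of the linear equation -/

section Explicit

variable {Ω : Type*} [mΩ : MeasurableSpace Ω] {P : Measure Ω} {T : ℝ}

/-- The operator on `L²(Ω; L²([0,T]))` which applies `𝐊` path by path. -/
def kerLift (P : Measure Ω) (K : Kernel T) : Lp (L2 T) 2 P →L[ℝ] Lp (L2 T) 2 P :=
  (intOp K).compLpL 2 P

theorem kerLift_coeFn (K : Kernel T) (x : Lp (L2 T) 2 P) :
    ∀ᵐ ω ∂P, kerLift P K x ω = intOp K (x ω) :=
  (intOp K).coeFn_compLpL x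

variable [IsProbabilityMeasure P]

theorem Lp_integrable {F : Type*} [NormedAddCommGroup F] (x : Lp F 2 P) : Integrable x P :=
  (Lp.memLp x).integrable one_le_two

/-- The test processes 1_A 1_{t≤·}h with A in `𝓕 t` and h in L² determine the vector-valued
conditional expectation weakly. Since h is a fixed vector, the conclusion holds for every `t` and
not just almost every one. -/
theorem condExp_tailProj_eq_zero {𝓕 : Filtration (Time T) mΩ} (hT : 0 ≤ T) {x : Lp (L2 T) 2 P}
    (hx : ∀ h ∈ progSubmodule P 𝓕, inner ℝ x h = 0) (t : Time T) :
    P[fun ω => tailProj t (x ω) | 𝓕 t] =ᵐ[P] 0 := by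
  have hint : Integrable (fun ω => tailProj t (x ω)) P :=
    (tailProj t).integrable_comp (Lp_integrable x)
  symm
  refine ae_eq_condExp_of_forall_setIntegral_eq (𝓕.le t) hint
    (fun _ _ _ => (integrable_zero _ _ _).integrableOn) (fun A hA _ => ?_)
    aestronglyMeasurable_zero
  have hA' : MeasurableSet A := 𝓕.le t _ hA
  simp only [Pi.zero_apply, integral_zero]
  symm
  refine ext_inner_left ℝ fun h => ?_
  have hm : Measurable (h : Time T → ℝ) := (Lp.stronglyMeasurable h).measurable
  have hv := isAdmissible_indicator_tail (P := P) hA hm (Lp.memLp h)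
  have h0 := hx _ ((mem_progSubmodule hT).2 ⟨_, hv, rfl⟩)
  rw [inner_zero_right, ← integral_inner hint.integrableOn, ← integral_indicator hA', ← h0,
    L2.inner_def]
  refine integral_congr_ae ?_
  filter_upwards [(hv.isSqProc hT).procL2_coeFn] with ω hω
  rw [hω]
  by_cases hωA : ω ∈ A
  · simp only [Set.indicator_of_mem hωA]
    rw [toL2_eq_of_ae (tailProj_coeFn t h).symm, ← inner_tailProj_left, real_inner_comm]
  · simp only [Set.indicator_of_notMem hωA]
    have e : toL2 (fun _ : Time T => (0 : ℝ)) = 0 :=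
      toL2_eq_of_ae (Lp.coeFn_zero ℝ 2 (volume : Measure (Time T))).symm
    rw [e, inner_zero_right]

theorem IsVolterraKernel.tailL2_col {K : Kernel T} (hK : IsVolterraKernel K) (t : Time T) :
    tailL2 t (fun r => K r t) = toL2 fun r => K r t := by
  refine congrArg toL2 (funext fun s => ?_)
  split_ifs with h
  · rfl
  · exact (hK.volterra _ _ (not_le.1 h).le).symm

theorem path_sub_tailProj {u : Proc T Ω} (hu : IsSqProc P u) (t : Time T) :
    (fun ω => procL2 P u ω - tailProj t (procL2 P u ω))
      =ᵐ[P] fun ω => toL2 fun s => if t ≤ s then 0 else u s ω := by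
  filter_upwards [hu.procL2_path] with ω hω
  symm
  refine toL2_eq_of_ae ?_
  filter_upwards [hω, tailProj_coeFn t (procL2 P u ω),
    Lp.coeFn_sub (procL2 P u ω) (tailProj t (procL2 P u ω))] with s h1 h2 h3
  rw [h3, Pi.sub_apply, h2, h1]
  split_ifs <;> simp

/-- The equation is projected on [t,T] and conditioned on `𝓕 t`: the residual disappears and the
bounded operator D_t commutes with conditioning. Inverting D_t expresses the forecast of the tail by
the data and the past. -/
theorem condExp_tailProj_eq {K : Kernel T} (hK : IsVolterraKernel K) {lam : ℝ} (hlam : 0 < lam)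
    {𝓕 : Filtration (Time T) mΩ} (hT : 0 ≤ T) {u : Proc T Ω} (hu : IsAdmissible P 𝓕 u)
    {g : Lp (L2 T) 2 P}
    (h : ∀ v ∈ progSubmodule P 𝓕, inner ℝ ((2 * lam) • procL2 P u
      + (kerLift P K (procL2 P u) + kerLift P (adjKernel K) (procL2 P u)) - g) v = 0)
    (t : Time T) :
    P[fun ω => tailProj t (procL2 P u ω) | 𝓕 t]
      =ᵐ[P] fun ω => truncInv lam K t ((P[fun ω => tailProj t (g ω) | 𝓕 t]) ω)
        - truncInv lam K t
          (tailProj t (intOp K (procL2 P u ω - tailProj t (procL2 P u ω)))) := by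
  have hs := hu.isSqProc hT
  set U := procL2 P u with hU
  set R := (2 * lam) • U + (kerLift P K U + kerLift P (adjKernel K) U) - g with hR
  have iU : Integrable U P := Lp_integrable U
  have iTU : Integrable (fun ω => tailProj t (U ω)) P := (tailProj t).integrable_comp iU
  have iTR : Integrable (fun ω => tailProj t (R ω)) P :=
    (tailProj t).integrable_comp (Lp_integrable R)
  have iTg : Integrable (fun ω => tailProj t (g ω)) P :=
    (tailProj t).integrable_comp (Lp_integrable g)
  have iY : Integrable (fun ω => tailProj t (intOp K (U ω - tailProj t (U ω)))) P :=
    (tailProj t).integrable_comp ((intOp K).integrable_comp (iU.sub iTU))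
  have hY : P[fun ω => tailProj t (intOp K (U ω - tailProj t (U ω))) | 𝓕 t]
      =ᵐ[P] fun ω => tailProj t (intOp K (U ω - tailProj t (U ω))) := by
    -- The past of a progressive process is known at time `t`, so conditioning leaves this term
    -- unchanged.
    refine condExp_of_aestronglyMeasurable' (𝓕.le t) ?_ iY
    have h1 : StronglyMeasurable[𝓕 t] fun ω => toL2 fun s => if t ≤ s then 0 else u s ω :=
      @stronglyMeasurable_path_before T Ω (𝓕 t) t u (hu.1 t)
    have h2 := ((tailProj t).continuous.comp (intOp K).continuous).comp_stronglyMeasurable h1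
    refine AEStronglyMeasurable.congr h2.aestronglyMeasurable ?_
    filter_upwards [path_sub_tailProj hs t] with ω hω
    rw [hω]
    rfl
  have hpt : (truncOp lam K t) ∘ (fun ω => tailProj t (U ω))
      =ᵐ[P] (fun ω => tailProj t (R ω)) + (fun ω => tailProj t (g ω))
        - fun ω => tailProj t (intOp K (U ω - tailProj t (U ω))) := by
    filter_upwards [Lp.coeFn_sub ((2 * lam) • U + (kerLift P K U + kerLift P (adjKernel K) U)) g,
      Lp.coeFn_add ((2 * lam) • U) (kerLift P K U + kerLift P (adjKernel K) U),
      Lp.coeFn_add (kerLift P K U) (kerLift P (adjKernel K) U), Lp.coeFn_smul (2 * lam) U,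
      kerLift_coeFn K U, kerLift_coeFn (adjKernel K) U] with ω e1 e2 e3 e4 e5 e6
    rw [Pi.sub_apply, Pi.add_apply, Function.comp_apply, hK.truncOp_tailProj, hR, e1, Pi.sub_apply,
      e2, Pi.add_apply, e3, Pi.add_apply, e4, Pi.smul_apply, e5, e6, ← map_add (tailProj t),
      sub_add_cancel]
  have c1 := (truncOp lam K t).comp_condExp_comm (m := 𝓕 t) iTU
  have c2 := condExp_congr_ae (m := 𝓕 t) hpt
  have c3 := condExp_sub (iTR.add iTg) iY (𝓕 t)
  have c4 := condExp_add iTR iTg (𝓕 t)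
  filter_upwards [c1, c2, c3, c4, hY, condExp_tailProj_eq_zero hT h t] with ω d1 d2 d3 d4 d5 d6
  have e := d1.trans (d2.trans d3)
  rw [Pi.sub_apply, d4, Pi.add_apply, d5, d6, Pi.zero_apply, zero_add, Function.comp_apply] at e
  rw [← map_sub, ← e, hK.truncInv_truncOp hlam]

theorem procL2_residual {K : Kernel T} (hK : IsVolterraKernel K) (lam : ℝ) {u g : Proc T Ω}
    (hu : IsSqProc P u) (hg : IsSqProc P g) :
    procL2 P (fun t ω => (2 * lam * u t ω + (kerApply K (fun s => u s ω) t
        + kerApply (adjKernel K) (fun s => u s ω) t)) - g t ω)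
      = (2 * lam) • procL2 P u
        + (kerLift P K (procL2 P u) + kerLift P (adjKernel K) (procL2 P u)) - procL2 P g := by
  have m1 : Measurable (Function.uncurry (adjKernel K)) := hK.measurable.comp measurable_swap
  have k1 := hu.kerApply hK.measurable hK.isL2Kernel
  have k2 := hu.kerApply m1 hK.isL2Kernel.adj
  rw [procL2_sub ((hu.const_mul (2 * lam)).add (k1.add k2)) hg,
    procL2_add (hu.const_mul (2 * lam)) (k1.add k2), procL2_add k1 k2, procL2_const_mul hu,
    procL2_kerApply hu hK.measurable hK.isL2Kernel, procL2_kerApply hu m1 hK.isL2Kernel.adj]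
  rfl

/-- The equation conditioned at the single time `t` involves the future only through the forecast of
the tail; inserting `condExp_tailProj_eq` turns it into the Volterra equation. The process `x`
stands for E_t[g_t], so adapted inputs can be used without conditioning. -/
theorem isVersion_coeffA {K : Kernel T} (hK : IsVolterraKernel K) {lam : ℝ} (hlam : 0 < lam)
    {𝓕 : Filtration (Time T) mΩ} (hT : 0 ≤ T) {u g x : Proc T Ω} (hu : IsAdmissible P 𝓕 u)
    (hg : IsSqProc P g) (hx : ∀ᵐ t : Time T, x t =ᵐ[P] P[g t | 𝓕 t])
    (h : ∀ v ∈ progSubmodule P 𝓕, inner ℝ ((2 * lam) • procL2 P u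
      + (kerLift P K (procL2 P u) + kerLift P (adjKernel K) (procL2 P u)) - procL2 P g) v = 0) :
    IsVersion P (fun t ω => u t ω - kerApply (kerB lam (truncOp lam K) K) (fun s => u s ω) t)
      (coeffA P 𝓕 lam (truncOp lam K) K x g) := by
  have hs := hu.isSqProc hT
  have m1 : Measurable (Function.uncurry (adjKernel K)) := hK.measurable.comp measurable_swap
  have k1 := hs.kerApply hK.measurable hK.isL2Kernel
  have k2 := hs.kerApply m1 hK.isL2Kernel.adj
  have k1prog := isStronglyProgressive_kerApply hu.1 hK.measurable hK.volterra
  have hρ := ((hs.const_mul (2 * lam)).add (k1.add k2)).sub hg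
  have hzero := condExp_eq_zero_of_orthogonal hT (𝓕 := 𝓕) hρ fun v hv => by
    rw [procL2_residual hK lam hs hg]
    exact h _ ((mem_progSubmodule hT).2 ⟨v, hv, rfl⟩)
  filter_upwards [hx, hzero, hs.memLp_time, k1.memLp_time, k2.memLp_time, hg.memLp_time]
    with t hxt hzt hut hk1t hk2t hgt
  set U := procL2 P u with hU
  set k := tailL2 t fun r => K r t with hk
  have iTU : Integrable (fun ω => tailProj t (U ω)) P :=
    (tailProj t).integrable_comp (Lp_integrable U)
  have iu : Integrable (fun ω => 2 * lam * u t ω) P := (hut.integrable one_le_two).const_mul _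
  have ik1 := hk1t.integrable one_le_two
  have ik2 := hk2t.integrable one_le_two
  have ig := hgt.integrable one_le_two
  have su : StronglyMeasurable[𝓕 t] fun ω => 2 * lam * u t ω :=
    (hu.1.stronglyAdapted t).const_mul _
  have sk1 := k1prog.stronglyAdapted t
  have c1 := condExp_sub (iu.add (ik1.add ik2)) ig (𝓕 t)
  have c2 := condExp_add iu (ik1.add ik2) (𝓕 t)
  have c3 := condExp_add ik1 ik2 (𝓕 t)
  rw [condExp_of_stronglyMeasurable (𝓕.le t) su iu] at c2
  rw [condExp_of_stronglyMeasurable (𝓕.le t) sk1 ik1] at c3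
  -- Since K(·,t) vanishes up to time `t`, the term (𝐊*u)_t is a continuous linear functional of the
  -- tail of `u`, and such functionals commute with conditioning.
  have hcol : (fun ω => kerApply (adjKernel K) (fun s => u s ω) t)
      =ᵐ[P] (innerSL ℝ k) ∘ fun ω => tailProj t (U ω) := by
    filter_upwards [hs.memLp_path, hs.procL2_coeFn] with ω h1 h2
    rw [hK.kerApply_adj_eq_inner h1, ← hK.tailL2_col, ← hk, Function.comp_apply, innerSL_apply_apply,
      hU, h2, ← inner_tailProj_left]
    congr 1
    rw [hk, tailL2_eq t (hK.memLp_col t), tailProj_tailProj]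
  have c4 := condExp_congr_ae (m := 𝓕 t) hcol
  have c5 := (innerSL ℝ k).comp_condExp_comm (m := 𝓕 t) iTU
  have hgtail : (fun ω => tailL2 t fun s => g s ω) =ᵐ[P] fun ω => tailProj t (procL2 P g ω) := by
    filter_upwards [hg.memLp_path, hg.procL2_coeFn] with ω h1 h2
    rw [tailL2_eq t h1, h2]
  filter_upwards [hxt, hzt, c1, c2, c3, c4, c5, condExp_tailProj_eq hK hlam hT hu h t,
    condExp_congr_ae (m := 𝓕 t) hgtail, hs.memLp_path, hs.procL2_coeFn]
    with ω d1 d2 d3 d4 d5 d6 d7 d8 d9 d10 d11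
  have e1 := d3.symm.trans d2
  rw [Pi.sub_apply, d4, Pi.add_apply, d5, Pi.add_apply, d6, ← d7, Function.comp_apply, d8, ← d1,
    innerSL_apply_apply, Pi.zero_apply, inner_sub_right] at e1
  rw [coeffA, hK.kerApply_kerB hlam d10 t, ← hk, d9, ← d11, ← hU]
  change _ = 1 / (2 * lam) * (x t ω - inner ℝ k (truncInv lam K t _))
  have hl : 2 * lam ≠ 0 := by positivity
  field_simp
  linarith

theorem isAdmissible_sub_kerB {K : Kernel T} (hK : IsVolterraKernel K) {lam : ℝ} (hlam : 0 < lam)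
    {𝓕 : Filtration (Time T) mΩ} (hT : 0 ≤ T) {u : Proc T Ω} (hu : IsAdmissible P 𝓕 u) :
    IsAdmissible P 𝓕
      fun t ω => u t ω - kerApply (kerB lam (truncOp lam K) K) (fun s => u s ω) t := by
  have hs := hu.isSqProc hT
  refine (hs.sub (hs.kerApply (hK.measurable_kerB hlam) (hK.isL2Kernel_kerB hlam))).isAdmissible ?_
  exact isStronglyProgressive_iff.2 ((isStronglyProgressive_iff.1 hu.1).sub
    (isStronglyProgressive_iff.1 (isStronglyProgressive_kerApply hu.1 (hK.measurable_kerB hlam)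
      fun _ _ => kerB_of_le _ _ _)))

/-- With a defined as u − 𝐁u, the resolvent identity is pathwise algebra; the substance lies in
`isVersion_coeffA`, which identifies this a. -/
theorem isResolventSolution_sub_kerB {K : Kernel T} (hK : IsVolterraKernel K) {lam : ℝ}
    (hlam : 0 < lam) {u : Proc T Ω} (hs : IsSqProc P u) :
    IsResolventSolution P (kerB lam (truncOp lam K) K)
      (fun t ω => u t ω - kerApply (kerB lam (truncOp lam K) K) (fun s => u s ω) t) u := by
  set B := kerB lam (truncOp lam K) K with hB
  filter_upwards [hs.memLp_path] with ω hω
  have hL := hK.isL2Kernel_kerB hlam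
  have h1 : toL2 (fun t => u t ω - kerApply B (fun s => u s ω) t)
      = (1 - intOp B) (toL2 fun t => u t ω) := by
    refine toL2_eq_of_ae ?_
    rw [_root_.sub_apply, one_apply_eq_self]
    filter_upwards [Lp.coeFn_sub (toL2 fun t => u t ω) (intOp B (toL2 fun t => u t ω)),
      toL2_coeFn hω, intOp_apply hL (toL2 fun t => u t ω)] with t e1 e2 e3
    rw [e1, Pi.sub_apply, e2, e3, kerApply_congr B (toL2_coeFn hω)]
  rw [h1]
  exact (congrArg (fun A : L2 T →L[ℝ] L2 T => A (toL2 fun t => u t ω))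
    (Ring.inverse_mul_cancel _ (hK.isUnit_one_sub_kerB hlam))).symm

end Explicit

/-! ### The game as a quadratic game in `L²(Ω; L²([0,T]))` -/

section Lift

variable {Ω : Type*} [mΩ : MeasurableSpace Ω] {P : Measure Ω} {T : ℝ}

theorem inner_kerLift_adj {K : Kernel T} (hK : IsL2Kernel K) (x y : Lp (L2 T) 2 P) :
    inner ℝ (kerLift P (adjKernel K) x) y = inner ℝ x (kerLift P K y) := by
  rw [L2.inner_def, L2.inner_def]
  refine integral_congr_ae ?_
  filter_upwards [kerLift_coeFn (adjKernel K) x, kerLift_coeFn K y] with ω h1 h2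
  rw [h1, h2, inner_intOp_adj hK]

theorem IsVolterraKernel.inner_kerLift_nonneg {K : Kernel T} (hK : IsVolterraKernel K)
    (x : Lp (L2 T) 2 P) : 0 ≤ inner ℝ x (kerLift P K x) := by
  rw [L2.inner_def]
  refine integral_nonneg_of_ae ?_
  filter_upwards [kerLift_coeFn K x] with ω h1
  rw [h1]
  exact hK.inner_nonneg _

theorem kerLift_add {K K' : Kernel T} (hK : IsL2Kernel K) (hK' : IsL2Kernel K')
    (x : Lp (L2 T) 2 P) :
    kerLift P (fun t s => K t s + K' t s) x = kerLift P K x + kerLift P K' x := by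
  refine Lp.ext ?_
  filter_upwards [kerLift_coeFn (fun t s => K t s + K' t s) x, kerLift_coeFn K x,
    kerLift_coeFn K' x, Lp.coeFn_add (kerLift P K x) (kerLift P K' x)] with ω h1 h2 h3 h4
  rw [h4, Pi.add_apply, h1, h2, h3, intOp_add hK hK', _root_.add_apply]

theorem kerLift_const_mul {K : Kernel T} (hK : IsL2Kernel K) (a : ℝ) (x : Lp (L2 T) 2 P) :
    kerLift P (fun t s => a * K t s) x = a • kerLift P K x := by
  refine Lp.ext ?_
  filter_upwards [kerLift_coeFn (fun t s => a * K t s) x, kerLift_coeFn K x,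
    Lp.coeFn_smul a (kerLift P K x)] with ω h1 h2 h4
  rw [h4, Pi.smul_apply, h1, h2, intOp_const_mul hK, _root_.smul_apply]

/-- The symmetrised lift `𝐊 + 𝐊*`. -/
def symLift (P : Measure Ω) (K : Kernel T) : Lp (L2 T) 2 P →L[ℝ] Lp (L2 T) 2 P :=
  kerLift P K + kerLift P (adjKernel K)

theorem symLift_apply (K : Kernel T) (x : Lp (L2 T) 2 P) :
    symLift P K x = kerLift P K x + kerLift P (adjKernel K) x := rfl

theorem symLift_add {K K' : Kernel T} (hK : IsL2Kernel K) (hK' : IsL2Kernel K') :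
    symLift P (fun t s => K t s + K' t s) = symLift P K + symLift P K' := by
  refine ContinuousLinearMap.ext fun x => ?_
  have h : kerLift P (adjKernel fun t s => K t s + K' t s) x
      = kerLift P (adjKernel K) x + kerLift P (adjKernel K') x := kerLift_add hK.adj hK'.adj x
  rw [_root_.add_apply, symLift_apply, symLift_apply, symLift_apply, kerLift_add hK hK', h]
  abel

theorem symLift_const_mul {K : Kernel T} (hK : IsL2Kernel K) (a : ℝ) :
    symLift P (fun t s => a * K t s) = a • symLift P K := by
  refine ContinuousLinearMap.ext fun x => ?_
  have h : kerLift P (adjKernel fun t s => a * K t s) x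
      = a • kerLift P (adjKernel K) x := kerLift_const_mul hK.adj a x
  rw [_root_.smul_apply, symLift_apply, symLift_apply, kerLift_const_mul hK, h, smul_add]

/-- The operator `2λ id + 𝐊 + 𝐊*` on `L²(Ω; L²([0,T]))`. -/
def liftOp (P : Measure Ω) (lam : ℝ) (K : Kernel T) : Lp (L2 T) 2 P →L[ℝ] Lp (L2 T) 2 P :=
  (2 * lam) • ContinuousLinearMap.id ℝ _ + symLift P K

theorem liftOp_apply (lam : ℝ) (K : Kernel T) (x : Lp (L2 T) 2 P) :
    liftOp P lam K x
      = (2 * lam) • x + (kerLift P K x + kerLift P (adjKernel K) x) := rfl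

theorem liftOp_add {K K' : Kernel T} (hK : IsL2Kernel K) (hK' : IsL2Kernel K') (lam : ℝ) :
    liftOp P lam (fun t s => K t s + K' t s) = liftOp P lam K + symLift P K' := by
  rw [liftOp, liftOp, symLift_add hK hK', add_assoc]

theorem IsVolterraKernel.liftOp_coercive {K : Kernel T} (hK : IsVolterraKernel K) (lam : ℝ)
    (x : Lp (L2 T) 2 P) : 2 * lam * ‖x‖ ^ 2 ≤ inner ℝ (liftOp P lam K x) x := by
  rw [liftOp_apply, inner_add_left, inner_add_left, inner_smul_left, inner_kerLift_adj hK.isL2Kernel,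
    real_inner_self_eq_norm_sq]
  have := hK.inner_kerLift_nonneg x
  have := real_inner_comm x (kerLift P K x)
  simp only [conj_trivial]
  linarith

end Lift

/-! ### The kernels of the game -/

section Kernels

variable {T : ℝ}

theorem symTrunc_add_const_mul {K K' : Kernel T} (hK : IsL2Kernel K) (hK' : IsL2Kernel K') (a : ℝ)
    (t : Time T) :
    symTrunc (fun t s => a * K t s + K' t s) t = a • symTrunc K t + symTrunc K' t := by
  have h1 : intOp (fun t s => a * K t s + K' t s) = a • intOp K + intOp K' := by
    rw [intOp_add (hK.const_mul a) hK', intOp_const_mul hK]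
  have h2 : intOp (adjKernel fun t s => a * K t s + K' t s)
      = a • intOp (adjKernel K) + intOp (adjKernel K') := by
    refine (intOp_add (hK.adj.const_mul a) hK'.adj).trans ?_
    rw [intOp_const_mul hK.adj]
  rw [symTrunc_eq hK, symTrunc_eq hK', symTrunc_eq ((hK.const_mul a).add hK'), h1, h2]
  ext1 f
  simp only [_root_.add_apply, ContinuousLinearMap.comp_apply, _root_.smul_apply, map_add, map_smul,
    smul_add]
  abel

theorem opDBar_eq_truncOp {G H : Kernel T} (hG : IsL2Kernel G) (hH : IsL2Kernel H) (N : ℕ)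
    (lam : ℝ) : opDBar N lam G H = truncOp lam (kerBar N G H) := by
  funext t
  have h := symTrunc_add_const_mul hH hG (((N : ℝ) - 1) / (N : ℝ)) t
  have h' := symTrunc_eq ((hH.const_mul (((N : ℝ) - 1) / (N : ℝ))).add hG) t
  rw [opDBar, add_assoc, ← h, h']
  rfl

theorem opDTilde_eq_truncOp {G H : Kernel T} (hG : IsL2Kernel G) (hH : IsL2Kernel H) (N : ℕ)
    (lam : ℝ) : opDTilde N lam G H = truncOp lam (kerHat N G H) := by
  funext t
  have e : kerHat N G H = fun t s => -(1 / (N : ℝ)) * H t s + G t s := by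
    funext t s
    rw [kerHat]
    ring
  have h := symTrunc_add_const_mul hH hG (-(1 / (N : ℝ))) t
  have h' := symTrunc_eq ((hH.const_mul (-(1 / (N : ℝ)))).add hG) t
  rw [opDTilde, sub_eq_add_neg, ← neg_smul, add_assoc, ← h, h', e]
  rfl

variable {A1 A2 A3 : Kernel T}

theorem isVolterraKernel_kerH (h1 : IsVolterraKernel A1) (h3 : IsVolterraKernel A3) (N : ℕ) :
    IsVolterraKernel (kerH N A1 A3) := by
  have h := (h1.const_mul (a := 1 / (N : ℝ)) (by positivity)).add h3
  convert! h using 3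
  rw [kerH]
  ring

theorem isVolterraKernel_kerG (h1 : IsVolterraKernel A1) (h2 : IsVolterraKernel A2)
    (h3 : IsVolterraKernel A3) (N : ℕ) : IsVolterraKernel (kerG N A1 A2 A3) := by
  have h := ((h1.const_mul (a := 1 / (N : ℝ) ^ 2) (by positivity)).add
    (h3.const_mul (a := 2 * (1 / (N : ℝ))) (by positivity))).add h2
  convert! h using 3
  rw [kerG]
  ring

/-- The A₁ terms cancel and one of the two copies of A₃/N remains. So K̂ is a nonnegative
combination of admissible kernels in spite of the minus sign in its definition. -/
theorem kerHat_eq (N : ℕ) :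
    kerHat N (kerG N A1 A2 A3) (kerH N A1 A3) = fun t s => 1 / (N : ℝ) * A3 t s + A2 t s := by
  funext t s
  rw [kerHat, kerG, kerH]
  ring

theorem isVolterraKernel_kerHat (h2 : IsVolterraKernel A2) (h3 : IsVolterraKernel A3) (N : ℕ) :
    IsVolterraKernel (kerHat N (kerG N A1 A2 A3) (kerH N A1 A3)) := by
  rw [kerHat_eq]
  exact (h3.const_mul (by positivity)).add h2

/-- The algebra behind the averaging step: the coefficient of H is (N−1)/N = 1 − 1/N. -/
theorem kerBar_eq {N : ℕ} (hN : N ≠ 0) (G H : Kernel T) :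
    kerBar N G H = fun t s => kerHat N G H t s + H t s := by
  have hN' : (N : ℝ) ≠ 0 := Nat.cast_ne_zero.2 hN
  funext t s
  rw [kerBar, kerHat]
  field_simp
  ring

end Kernels

/-! ### Payoffs and equilibria -/

section Game

variable {Ω : Type*} [mΩ : MeasurableSpace Ω] {P : Measure Ω} {T : ℝ} {N : ℕ}

theorem integral_payoff {α : Type*} [MeasurableSpace α] {μ : Measure α}
    {f₁ f₂ f₃ f₄ f₅ f₆ : α → ℝ} (h₁ : Integrable f₁ μ) (h₂ : Integrable f₂ μ)
    (h₃ : Integrable f₃ μ) (h₄ : Integrable f₄ μ) (h₅ : Integrable f₅ μ) (h₆ : Integrable f₆ μ) :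
    ∫ x, (-f₁ x - f₂ x - f₃ x + f₄ x + f₅ x + f₆ x) ∂μ
      = -∫ x, f₁ x ∂μ - ∫ x, f₂ x ∂μ - ∫ x, f₃ x ∂μ + ∫ x, f₄ x ∂μ + ∫ x, f₅ x ∂μ
        + ∫ x, f₆ x ∂μ := by
  have j₂ : Integrable (fun x => -f₁ x - f₂ x) μ := h₁.neg.sub h₂
  have j₃ : Integrable (fun x => -f₁ x - f₂ x - f₃ x) μ := j₂.sub h₃
  have j₄ : Integrable (fun x => -f₁ x - f₂ x - f₃ x + f₄ x) μ := j₃.add h₄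
  have j₅ : Integrable (fun x => -f₁ x - f₂ x - f₃ x + f₄ x + f₅ x) μ := j₄.add h₅
  rw [integral_add j₅ h₆, integral_add j₄ h₅, integral_add j₃ h₄, integral_sub j₂ h₃,
    integral_sub (f := fun x => -f₁ x) h₁.neg h₂, integral_neg]

theorem isSqProc_inputBar {b : Fin N → Proc T Ω} {b0 : Proc T Ω} (hb : ∀ i, IsSqProc P (b i))
    (hb0 : IsSqProc P b0) : IsSqProc P (inputBar b b0) :=
  (isSqProc_playerAverage hb).add (hb0.const_mul _)

variable [IsProbabilityMeasure P]

theorem performance_eq_quadPayoff {A1 A2 A3 : Kernel T} (h1 : IsVolterraKernel A1)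
    (h2 : IsVolterraKernel A2) (h3 : IsVolterraKernel A3) (lam : ℝ) {b : Fin N → Proc T Ω}
    {b0 : Proc T Ω} {c : Fin N → Ω → ℝ} (hb : ∀ i, IsSqProc P (b i)) (hb0 : IsSqProc P b0)
    (hc : ∀ i, Integrable (c i) P) (i : Fin N) {u : Fin N → Proc T Ω}
    (hu : ∀ j, IsSqProc P (u j)) :
    performance P lam A1 A2 A3 b b0 c i u
      = quadPayoff lam (kerLift P A1) (kerLift P A2) (kerLift P A3) (kerLift P (adjKernel A3))
        (fun j => procL2 P (b j)) (procL2 P b0) (fun j => ∫ ω, c j ω ∂P) i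
        (fun j => procL2 P (u j)) := by
  have m3 : Measurable (Function.uncurry (adjKernel A3)) := h3.measurable.comp measurable_swap
  have hbar := isSqProc_playerAverage hu
  have k1 := hbar.kerApply h1.measurable h1.isL2Kernel
  have k2 := (hu i).kerApply h2.measurable h2.isL2Kernel
  have k3 := hbar.kerApply h3.measurable h3.isL2Kernel
  have k4 := hbar.kerApply m3 h3.isL2Kernel.adj
  have l2 := ((hu i).const_mul lam).add k2
  have l3 := k3.add k4
  have havg : vecAverage (fun j => procL2 P (u j)) = procL2 P (playerAverage u) :=
    (procL2_playerAverage hu).symm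
  have e1 : kerLift P A1 (procL2 P (playerAverage u)) = _ :=
    (procL2_kerApply hbar h1.measurable h1.isL2Kernel).symm
  have e2 : lam • procL2 P (u i) + kerLift P A2 (procL2 P (u i)) = _ :=
    ((procL2_add ((hu i).const_mul lam) k2).trans (congrArg₂ (· + ·) (procL2_const_mul (hu i) lam)
      (procL2_kerApply (hu i) h2.measurable h2.isL2Kernel))).symm
  have e3 : kerLift P A3 (procL2 P (playerAverage u))
      + kerLift P (adjKernel A3) (procL2 P (playerAverage u)) = _ :=
    ((procL2_add k3 k4).trans (congrArg₂ (· + ·)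
      (procL2_kerApply hbar h3.measurable h3.isL2Kernel)
      (procL2_kerApply hbar m3 h3.isL2Kernel.adj))).symm
  have i1 := integrable_pairing hbar k1
  have i2 := integrable_pairing (hu i) l2
  have i3 := integrable_pairing (hu i) l3
  have i4 := integrable_pairing (hb i) (hu i)
  have i5 := integrable_pairing hb0 hbar
  rw [quadPayoff, havg, e1, e2, e3, inner_procL2 hbar k1, inner_procL2 (hu i) l2,
    inner_procL2 (hu i) l3, inner_procL2 (hb i) (hu i), inner_procL2 hb0 hbar]
  exact integral_payoff i1 i2 i3 i4 i5 (hc i)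

/-- The gradient regroups as follows: the player's own A₃ terms join Â₂ in K̂, and everything that
acts on the average is H + H*. Every element of the subspace is the class of an admissible process,
so process and Hilbert space deviations correspond. -/
theorem isNash_iff (hT : 0 ≤ T) {𝓕 : Filtration (Time T) mΩ} {A1 A2 A3 : Kernel T}
    (h1 : IsVolterraKernel A1) (h2 : IsVolterraKernel A2) (h3 : IsVolterraKernel A3) {lam : ℝ}
    (hlam : 0 < lam) {b : Fin N → Proc T Ω} {b0 : Proc T Ω} {c : Fin N → Ω → ℝ}
    (hb : ∀ i, IsSqProc P (b i)) (hb0 : IsSqProc P b0) (hc : ∀ i, Integrable (c i) P)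
    {u : Fin N → Proc T Ω} (hu : ∀ j, IsAdmissible P 𝓕 (u j)) :
    IsNash P 𝓕 (performance P lam A1 A2 A3 b b0 c) u ↔
      ∀ i, ∀ h ∈ progSubmodule P 𝓕, inner ℝ (liftOp P lam
          (kerHat N (kerG N A1 A2 A3) (kerH N A1 A3)) (procL2 P (u i))
        - (procL2 P (b i) + (1 / (N : ℝ)) • procL2 P b0
          - symLift P (kerH N A1 A3) (vecAverage fun j => procL2 P (u j)))) h = 0 := by
  have hs := fun j => (hu j).isSqProc hT
  rw [IsNash, and_iff_right hu]
  refine forall_congr' fun i => ?_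
  have key := quadPayoff_isMax_iff hlam (inner_kerLift_adj (P := P) h1.isL2Kernel)
    (inner_kerLift_adj h2.isL2Kernel) (inner_kerLift_adj h3.isL2Kernel) h1.inner_kerLift_nonneg
    h2.inner_kerLift_nonneg h3.inner_kerLift_nonneg (progSubmodule P 𝓕)
    (fun j => procL2 P (b j)) (procL2 P b0) (fun j => ∫ ω, c j ω ∂P) i
    (U := fun j => procL2 P (u j)) ((mem_progSubmodule hT).2 ⟨_, hu i, rfl⟩)
  have hres : quadResidual lam (kerLift P A1) (kerLift P (adjKernel A1)) (kerLift P A2)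
      (kerLift P (adjKernel A2)) (kerLift P A3) (kerLift P (adjKernel A3))
      (fun j => procL2 P (b j)) (procL2 P b0) i (fun j => procL2 P (u j))
      = liftOp P lam (kerHat N (kerG N A1 A2 A3) (kerH N A1 A3)) (procL2 P (u i))
        - (procL2 P (b i) + (1 / (N : ℝ)) • procL2 P b0
          - symLift P (kerH N A1 A3) (vecAverage fun j => procL2 P (u j))) := by
    have eH : kerH N A1 A3 = fun t s => 1 / (N : ℝ) * A1 t s + A3 t s := by
      funext t s
      rw [kerH]
      ring
    rw [kerHat_eq, eH, symLift_add (h1.isL2Kernel.const_mul _) h3.isL2Kernel,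
      symLift_const_mul h1.isL2Kernel, liftOp,
      symLift_add (h3.isL2Kernel.const_mul _) h2.isL2Kernel, symLift_const_mul h3.isL2Kernel]
    simp only [quadResidual, symLift, _root_.add_apply, _root_.smul_apply,
      ContinuousLinearMap.id_apply]
    abel
  rw [hres] at key
  rw [← key]
  have hperf : ∀ w, IsAdmissible P 𝓕 w →
      performance P lam A1 A2 A3 b b0 c i (Function.update u i w)
        = quadPayoff lam (kerLift P A1) (kerLift P A2) (kerLift P A3)
          (kerLift P (adjKernel A3)) (fun j => procL2 P (b j)) (procL2 P b0)
          (fun j => ∫ ω, c j ω ∂P) i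
          (Function.update (fun j => procL2 P (u j)) i (procL2 P w)) := by
    intro w hw
    rw [performance_eq_quadPayoff h1 h2 h3 lam hb hb0 hc i fun j => ?_]
    · congr 1
      funext j
      rcases eq_or_ne j i with rfl | hj
      · simp
      · simp [hj]
    · rcases eq_or_ne j i with rfl | hj
      · simpa using hw.isSqProc hT
      · simpa [hj] using hs j
  have hperf' := performance_eq_quadPayoff h1 h2 h3 lam hb hb0 hc i hs
  constructor
  · intro h v hv
    obtain ⟨w, hw, rfl⟩ := (mem_progSubmodule hT).1 hv
    have h5 := h w hw
    rwa [hperf w hw, hperf'] at h5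
  · intro h w hw
    rw [hperf w hw, hperf']
    exact h _ ((mem_progSubmodule hT).2 ⟨w, hw, rfl⟩)

theorem procL2_inputBar (hN : N ≠ 0) {b : Fin N → Proc T Ω} {b0 : Proc T Ω}
    (hb : ∀ i, IsSqProc P (b i)) (hb0 : IsSqProc P b0) :
    procL2 P (inputBar b b0)
      = vecAverage fun i => procL2 P (b i) + (1 / (N : ℝ)) • procL2 P b0 := by
  have hN' : (N : ℝ) ≠ 0 := Nat.cast_ne_zero.2 hN
  refine (procL2_add (isSqProc_playerAverage hb) (hb0.const_mul _)).trans ?_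
  rw [procL2_playerAverage hb, procL2_const_mul hb0, vecAverage, Finset.sum_add_distrib, smul_add]
  congr 1
  rw [Finset.sum_const, Finset.card_univ, Fintype.card_fin, ← Nat.cast_smul_eq_nsmul ℝ,
    ← smul_assoc (1 / (N : ℝ)), smul_eq_mul, one_div_mul_cancel hN', one_smul]

theorem isSqProc_inputHat {H : Kernel T} (hH : IsVolterraKernel H) {bi b0 ubar : Proc T Ω}
    (hbi : IsSqProc P bi) (hb0 : IsSqProc P b0) (hu : IsSqProc P ubar) (N : ℕ) :
    IsSqProc P (inputHat N H bi b0 ubar) :=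
  (hbi.add (hb0.const_mul _)).sub ((hu.kerApply hH.measurable hH.isL2Kernel).add
    (hu.kerApply (hH.measurable.comp measurable_swap) hH.isL2Kernel.adj))

theorem procL2_inputHat {H : Kernel T} (hH : IsVolterraKernel H) {bi b0 ubar : Proc T Ω}
    (hbi : IsSqProc P bi) (hb0 : IsSqProc P b0) (hu : IsSqProc P ubar) (N : ℕ) :
    procL2 P (inputHat N H bi b0 ubar)
      = procL2 P bi + (1 / (N : ℝ)) • procL2 P b0 - symLift P H (procL2 P ubar) := by
  have m1 : Measurable (Function.uncurry (adjKernel H)) := hH.measurable.comp measurable_swap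
  have k1 := hu.kerApply hH.measurable hH.isL2Kernel
  have k2 := hu.kerApply m1 hH.isL2Kernel.adj
  refine (procL2_sub (hbi.add (hb0.const_mul _)) (k1.add k2)).trans ?_
  rw [procL2_add hbi (hb0.const_mul _), procL2_const_mul hb0, procL2_add k1 k2,
    procL2_kerApply hu hH.measurable hH.isL2Kernel, procL2_kerApply hu m1 hH.isL2Kernel.adj]
  rfl

theorem isStronglyProgressive_inputBar {𝓕 : Filtration (Time T) mΩ} {b : Fin N → Proc T Ω}
    {b0 : Proc T Ω} (hb : ∀ i, IsStronglyProgressive 𝓕 (b i)) (hb0 : IsStronglyProgressive 𝓕 b0) :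
    IsStronglyProgressive 𝓕 (inputBar b b0) := by
  have h1 : IsStronglyProgressive 𝓕 fun t ω => ∑ j, b j t ω := by
    simpa using IsStronglyProgressive.finsetSum (s := Finset.univ) fun j _ => hb j
  exact ((isStronglyProgressive_const 𝓕 (1 / (N : ℝ))).mul h1).add
    ((isStronglyProgressive_const 𝓕 (1 / (N : ℝ))).mul hb0)

end Game

end VolterraGame

end

/-! ### Assembly of the equilibrium and its explicit form. -/

open VolterraGame

theorem theorem2 {Ω : Type*} [mΩ : MeasurableSpace Ω] (P : Measure Ω) [IsProbabilityMeasure P]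
    (T : ℝ) (hT : 0 < T)
    -- a filtration satisfying the usual conditions
    (𝓕 : Filtration (Time T) mΩ) (hright : 𝓕.IsRightContinuous)
    (hcomplete : ∀ S : Set Ω, P S = 0 → ∀ t, MeasurableSet[𝓕 t] S)
    (N : ℕ) (hN : 2 ≤ N) (lam : ℝ) (hlam : 0 < lam)
    (A1 A2hat A3 : Kernel T)
    (hA1 : IsAdmissibleKernel A1) (hA2 : IsAdmissibleKernel A2hat) (hA3 : IsAdmissibleKernel A3)
    (b : Fin N → Proc T Ω) (b0 : Proc T Ω) (c : Fin N → Ω → ℝ)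
    (hb : ∀ i, IsAdmissible P 𝓕 (b i)) (hb0 : IsAdmissible P 𝓕 b0)
    (hc : ∀ i, Integrable (c i) P) :
    let J := performance P lam A1 A2hat A3 b b0 c
    let G := kerG N A1 A2hat A3
    let H := kerH N A1 A3
    let Kbar := kerBar N G H
    let Khat := kerHat N G H
    let Dbar := opDBar N lam G H
    let Dtil := opDTilde N lam G H
    let Bbar := kerB lam Dbar Kbar
    let B := kerB lam Dtil Khat
    -- the operators that are inverted are well defined and invertible
    (∀ t, IsUnit (Dbar t)) ∧ (∀ t, IsUnit (Dtil t)) ∧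
    IsL2Kernel Bbar ∧ IsL2Kernel B ∧
    IsUnit (1 - intOp Bbar) ∧ IsUnit (1 - intOp B) ∧
    ∃ (abar ubar : Proc T Ω) (a uhat : Fin N → Proc T Ω),
      -- the equilibrium average
      IsAdmissible P 𝓕 abar ∧ IsAdmissible P 𝓕 ubar ∧
      IsVersion P abar
        (coeffA P 𝓕 lam Dbar Kbar (inputBar b b0) (inputBar b b0)) ∧
      IsResolventSolution P Bbar abar ubar ∧
      ProcessEq P ubar (playerAverage uhat) ∧
      -- the individual strategies
      (∀ i, IsAdmissible P 𝓕 (a i)) ∧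
      (∀ i, IsVersion P (a i)
        (coeffA P 𝓕 lam Dtil Khat (fun t => P[inputHat N H (b i) b0 ubar t | 𝓕 t])
          (inputHat N H (b i) b0 ubar))) ∧
      (∀ i, IsResolventSolution P B (a i) (uhat i)) ∧
      -- they form the unique Nash equilibrium
      IsNash P 𝓕 J uhat ∧
      ∀ w : Fin N → Proc T Ω, IsNash P 𝓕 J w → ∀ i, ProcessEq P (w i) (uhat i) := by
  intro J G H Kbar Khat Dbar Dtil Bbar B
  have hT0 := hT.le
  have hN0 : N ≠ 0 := by omega
  have v1 := hA1.isVolterraKernel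
  have v2 := hA2.isVolterraKernel
  have v3 := hA3.isVolterraKernel
  have vH : IsVolterraKernel H := isVolterraKernel_kerH v1 v3 N
  have vG : IsVolterraKernel G := isVolterraKernel_kerG v1 v2 v3 N
  have vhat : IsVolterraKernel Khat := isVolterraKernel_kerHat v2 v3 N
  have hbar_eq : Kbar = fun t s => Khat t s + H t s := kerBar_eq hN0 G H
  have vbar : IsVolterraKernel Kbar := by
    rw [hbar_eq]
    exact vhat.add vH
  have hDbar : Dbar = truncOp lam Kbar := opDBar_eq_truncOp vG.isL2Kernel vH.isL2Kernel N lam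
  have hDtil : Dtil = truncOp lam Khat := opDTilde_eq_truncOp vG.isL2Kernel vH.isL2Kernel N lam
  have hBbar : Bbar = kerB lam (truncOp lam Kbar) Kbar := congrArg (kerB lam · Kbar) hDbar
  have hB : B = kerB lam (truncOp lam Khat) Khat := congrArg (kerB lam · Khat) hDtil
  have sb := fun i => (hb i).isSqProc hT0
  have sb0 := hb0.isSqProc hT0
  have hlift : liftOp P lam Kbar = liftOp P lam Khat + symLift P H := by
    rw [hbar_eq]
    exact liftOp_add vhat.isL2Kernel vH.isL2Kernel lam
  rw [hDbar, hDtil, hBbar, hB]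
  refine ⟨fun t => vbar.isUnit_truncOp hlam t, fun t => vhat.isUnit_truncOp hlam t,
    vbar.isL2Kernel_kerB hlam, vhat.isL2Kernel_kerB hlam, vbar.isUnit_one_sub_kerB hlam,
    vhat.isUnit_one_sub_kerB hlam, ?_⟩
  have : CompleteSpace (progSubmodule P 𝓕) := completeSpace_progSubmodule hT0 𝓕
  obtain ⟨U, hUW, hUfoc, hUavg, hUuniq⟩ := exists_unique_average_fixed_point hN0
    (progSubmodule P 𝓕) (liftOp P lam Khat) (symLift P H) (c := 2 * lam) (by positivity)
    (vhat.liftOp_coercive lam) (by rw [← hlift]; exact vbar.liftOp_coercive lam)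
    (fun i => procL2 P (b i) + (1 / (N : ℝ)) • procL2 P b0)
  choose uhat huhat hUu using fun i => (mem_progSubmodule hT0).1 (hUW i)
  obtain ⟨ubar, hubar, hUbar⟩ := (mem_progSubmodule hT0).1 (vecAverage_mem hUW)
  have su := fun i => (huhat i).isSqProc hT0
  have subar := hubar.isSqProc hT0
  have hUfun : (fun j => procL2 P (uhat j)) = U := funext hUu
  have sin := isSqProc_inputBar sb sb0
  -- The inhomogeneous terms are taken to be u − 𝐁u, which are progressive by construction; what
  -- remains is that they are versions of the stated formulas.
  refine ⟨_, ubar, fun i => _, uhat, isAdmissible_sub_kerB vbar hlam hT0 hubar, hubar, ?_,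
    isResolventSolution_sub_kerB vbar hlam subar, ?_,
    fun i => isAdmissible_sub_kerB vhat hlam hT0 (huhat i), fun i => ?_,
    fun i => isResolventSolution_sub_kerB vhat hlam (su i), ?_, fun w hw i => ?_⟩
  · refine isVersion_coeffA vbar hlam hT0 hubar sin ?_ fun v hv => ?_
    -- The averaged input is adapted, hence its own conditional expectation. The individual inputs
    -- contain the adjoint of H, which looks into the future, and must be conditioned.
    · filter_upwards [sin.memLp_time] with t ht
      rw [condExp_of_stronglyMeasurable (𝓕.le t)
        ((isStronglyProgressive_inputBar (fun i => (hb i).1) hb0.1).stronglyAdapted t)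
        (ht.integrable one_le_two)]
    · rw [hUbar, procL2_inputBar hN0 sb sb0, ← liftOp_apply, hlift]
      exact hUavg v hv
  · refine processEq_of_procL2_eq subar (isSqProc_playerAverage su) ?_
    rw [hUbar, procL2_playerAverage su, ← hUfun, vecAverage]
  · refine isVersion_coeffA vhat hlam hT0 (huhat i)
      (isSqProc_inputHat vH (sb i) sb0 subar N) (ae_of_all _ fun t => Filter.EventuallyEq.rfl)
      fun v hv => ?_
    rw [procL2_inputHat vH (sb i) sb0 subar, hUbar, hUu i, ← liftOp_apply]
    exact hUfoc i v hv
  · refine (isNash_iff hT0 v1 v2 v3 hlam sb sb0 hc huhat).2 fun i v hv => ?_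
    rw [hUfun, hUu i]
    exact hUfoc i v hv
  · have hw' := (isNash_iff hT0 v1 v2 v3 hlam sb sb0 hc hw.1).1 hw
    refine processEq_of_procL2_eq ((hw.1 i).isSqProc hT0) (su i) ?_
    rw [hUu i]
    exact congrFun (hUuniq (fun j => procL2 P (w j))
      (fun j => (mem_progSubmodule hT0).2 ⟨_, hw.1 j, rfl⟩) hw') i
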